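/- Let $J=J^0\oplus J^1$ be the Jouanolou dg algebra of the punctured affine plane $\mathbb C^2\setminus 0$: the graded commutative $\mathbb C[z^1,z^2]$-algebra generated by $x^1,x^2$ in degree $0$ and $dx^1,dx^2$ in degree $1$, subject to $z^1x^1+z^2x^2=1$ and $z^1dx^1+z^2dx^2=0$, with the $\mathbb C[z^1,z^2]$-linear differential $\bar\partial x^i=dx^i$. (Here $x^i$ stands for $\bar z^i/(z^1\bar z^1+z^2\bar z^2)$; these relations force $J^2=0$.) The holomorphic derivatives $\partial_i=\partial/\partial z^i$ act on $J$ as commuting derivations, commuting with $\bar\partial$, with $\partial_i z^j=\delta_{ij}$ and $\partial_i x^j=-x^ix^j$. Put $P=x^1\,\bar\partial x^2-x^2\,\bar\partial x^1\in J^1$. Let $\mathcal D_2^{poly}=J[\partial_1,\partial_2]$ be the algebra of polynomial differential operators on the punctured affine plane, acting on $J$, regarded as a dg Lie algebra over $\mathbb C$ (concentrated in degrees $0$ and $1$) with the graded commutator bracket and the differential $[\bar\partial,-]$. Its Lie algebra hyperhomology $\mathbb H^{Lie}_\bullet(\mathcal D_2^{poly})$ is the homology of the Chevalley–Eilenberg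 complex of chains $\mathrm{Sym}(\mathcal D_2^{poly}[1])$ with differential $\bar\partial+d^{Lie}$, graded by total homological degree, so that an element of $\mathcal D_2^{poly}$ of degree $k$ contributes homological degree $1-k$. **Theorem.** The second hyperhomology $\mathbb H^{Lie}_2(\mathcal D_2^{poly})$ is a one-dimensional complex vector space, and it is generated by the class $[P\wedge z^1\wedge z^2]$. -/

import Mathlib

open scoped TensorProduct

noncomputable section

/-! ### Hyperhomology of a dg Lie algebra concentrated in degrees `0` and `1` -/

namespace DGLie

section SymmetricAlgebra

variable {K M : Type*} [CommRing K] [AddCommGroup M] [Module K M]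

/-- Auxiliary algebra map into the dual numbers over `S(M)`, given on `M` by `m ↦ m + ε φ(m)`. -/
def symDerAux (φ : M →ₗ[K] M) :
    SymmetricAlgebra K M →ₐ[K] TrivSqZeroExt (SymmetricAlgebra K M) (SymmetricAlgebra K M) :=
  SymmetricAlgebra.lift
    ((TrivSqZeroExt.inlAlgHom K (SymmetricAlgebra K M) (SymmetricAlgebra K M)).toLinearMap ∘ₗ
        SymmetricAlgebra.ι K M +
      (TrivSqZeroExt.inrHom (SymmetricAlgebra K M) (SymmetricAlgebra K M)).restrictScalars K ∘ₗ
        SymmetricAlgebra.ι K M ∘ₗ φ)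

theorem symDerAux_ι (φ : M →ₗ[K] M) (m : M) :
    symDerAux φ (SymmetricAlgebra.ι K M m) =
      TrivSqZeroExt.inl (SymmetricAlgebra.ι K M m) +
        TrivSqZeroExt.inr (SymmetricAlgebra.ι K M (φ m)) := by
  simp [symDerAux]

theorem fst_symDerAux (φ : M →ₗ[K] M) (s : SymmetricAlgebra K M) : (symDerAux φ s).fst = s := by
  have h : (TrivSqZeroExt.fstHom K (SymmetricAlgebra K M) (SymmetricAlgebra K M)).comp
      (symDerAux φ) = AlgHom.id K _ := by
    apply SymmetricAlgebra.algHom_ext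
    ext m
    simp [symDerAux_ι]
  exact DFunLike.congr_fun h s

/-- The derivation of the symmetric algebra `S(M)` that extends an endomorphism `φ` of `M`. -/
def symDer (φ : M →ₗ[K] M) : Derivation K (SymmetricAlgebra K M) (SymmetricAlgebra K M) :=
  Derivation.mk'
    ((TrivSqZeroExt.sndHom (SymmetricAlgebra K M) (SymmetricAlgebra K M)).restrictScalars K ∘ₗ
      (symDerAux φ).toLinearMap)
    (fun a b => by simp [fst_symDerAux, mul_comm])

@[simp] theorem symDer_ι (φ : M →ₗ[K] M) (m : M) :
    symDer φ (SymmetricAlgebra.ι K M m) = SymmetricAlgebra.ι K M (φ m) := by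
  simp [symDer, symDerAux_ι]

theorem symDerivation_ext
    {D D' : Derivation K (SymmetricAlgebra K M) (SymmetricAlgebra K M)}
    (h : ∀ m, D (SymmetricAlgebra.ι K M m) = D' (SymmetricAlgebra.ι K M m)) : D = D' := by
  ext s
  induction s using SymmetricAlgebra.induction with
  | algebraMap r => simp
  | ι x => exact h x
  | mul a b ha hb => simp [ha, hb]
  | add a b ha hb => simp [ha, hb]

theorem symDer_add (φ ψ : M →ₗ[K] M) : symDer (φ + ψ) = symDer φ + symDer ψ :=
  symDerivation_ext (fun m => by simp)

theorem symDer_smul (r : K) (φ : M →ₗ[K] M) : symDer (r • φ) = r • symDer φ :=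
  symDerivation_ext (fun m => by simp)

theorem symDer_lie (φ ψ : Module.End K M) : symDer ⁅φ, ψ⁆ = ⁅symDer φ, symDer ψ⁆ :=
  symDerivation_ext (fun m => by simp [Derivation.commutator_apply, Ring.lie_def])

end SymmetricAlgebra

section ExteriorAlgebra

variable {K V : Type*} [CommRing K] [AddCommGroup V] [Module K V]

/-- The derivation of the exterior algebra `Λ(V)` that extends an endomorphism `φ` of `V`. -/
def extDer (φ : V →ₗ[K] V) : ExteriorAlgebra K V →ₗ[K] ExteriorAlgebra K V :=
  CliffordAlgebra.foldr' (0 : QuadraticForm K V)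
    (LinearMap.mk₂ K (fun v p => ExteriorAlgebra.ι K (φ v) * p.1 + ExteriorAlgebra.ι K v * p.2)
      (by intros; simp [add_mul]; abel) (by intros; simp [smul_add])
      (by intros; simp [mul_add]; abel) (by intros; simp [smul_add]))
    (by
      intro v x fx
      have h1 : ExteriorAlgebra.ι K v * ExteriorAlgebra.ι K v = 0 := ExteriorAlgebra.ι_sq_zero v
      have h2 : ExteriorAlgebra.ι K (φ v) * ExteriorAlgebra.ι K v =
          - (ExteriorAlgebra.ι K v * ExteriorAlgebra.ι K (φ v)) := by
        rw [eq_neg_iff_add_eq_zero, add_comm]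
        exact ExteriorAlgebra.ι_add_mul_swap v (φ v)
      change ExteriorAlgebra.ι K (φ v) * (ExteriorAlgebra.ι K v * x) +
        ExteriorAlgebra.ι K v * (ExteriorAlgebra.ι K (φ v) * x + ExteriorAlgebra.ι K v * fx) = _
      rw [mul_add, ← mul_assoc, ← mul_assoc, ← mul_assoc, h1, h2]
      simp)
    0

@[simp] theorem extDer_one (φ : V →ₗ[K] V) : extDer φ (1 : ExteriorAlgebra K V) = 0 := by
  rw [← (algebraMap K (ExteriorAlgebra K V)).map_one, extDer]
  exact (CliffordAlgebra.foldr'_algebraMap _ _ _ _ _).trans (smul_zero _)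

@[simp] theorem extDer_ι_mul (φ : V →ₗ[K] V) (v : V) (x : ExteriorAlgebra K V) :
    extDer φ (ExteriorAlgebra.ι K v * x) =
      ExteriorAlgebra.ι K (φ v) * x + ExteriorAlgebra.ι K v * extDer φ x :=
  CliffordAlgebra.foldr'_ι_mul _ _ _ _ _ _

theorem ext_induction {C : ExteriorAlgebra K V → Prop} (one : C 1)
    (smul : ∀ (r : K) x, C x → C (r • x)) (add : ∀ x y, C x → C y → C (x + y))
    (mul : ∀ v x, C x → C (ExteriorAlgebra.ι K v * x)) (x : ExteriorAlgebra K V) : C x :=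
  CliffordAlgebra.left_induction (Q := (0 : QuadraticForm K V)) (P := C)
    (fun r => by rw [Algebra.algebraMap_eq_smul_one]; exact smul _ _ one)
    add (fun x v hx => mul v x hx) x

theorem extDer_add (φ ψ : V →ₗ[K] V) : extDer (φ + ψ) = extDer φ + extDer ψ := by
  refine LinearMap.ext fun x => ?_
  induction x using ext_induction with
  | one => simp
  | smul r x h => simp only [map_smul, h]
  | add x y hx hy => simp only [map_add, hx, hy]
  | mul v x h =>
    rw [LinearMap.add_apply] at h
    simp only [extDer_ι_mul, h, LinearMap.add_apply, map_add, add_mul, mul_add]; abel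

theorem extDer_smul (r : K) (φ : V →ₗ[K] V) : extDer (r • φ) = r • extDer φ := by
  refine LinearMap.ext fun x => ?_
  induction x using ext_induction with
  | one => simp
  | smul r x h => simp only [map_smul, h]
  | add x y hx hy => simp only [map_add, hx, hy]
  | mul v x h =>
    rw [LinearMap.smul_apply] at h
    simp only [extDer_ι_mul, h, LinearMap.smul_apply, map_smul, smul_mul_assoc, mul_smul_comm,
      smul_add]

end ExteriorAlgebra

section Chains

variable (K : Type*) (L₀ L₁ : Type*) [CommRing K] [AddCommGroup L₀] [Module K L₀]
  [AddCommGroup L₁] [Module K L₁]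

/-- Underlying space of the complex of Chevalley-Eilenberg chains of a dg Lie algebra
`L = L₀ ⊕ L₁` in cohomological degrees `0` and `1`: the graded symmetric algebra on the shift
`L[1]`.  As `L₀[1]` is odd and `L₁[1]` is even, this is `Λ(L₀) ⊗ S(L₁)`. -/
abbrev Chains : Type _ := ExteriorAlgebra K L₀ ⊗[K] SymmetricAlgebra K L₁

/-- Chains of total homological degree `n`: as `L₀[1]` sits in homological degree `1` and `L₁[1]`
in degree `0`, this is `Λⁿ(L₀) ⊗ S(L₁)`. -/
def chainsOfDegree (n : ℕ) : Submodule K (Chains K L₀ L₁) :=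
  Submodule.map₂ (TensorProduct.mk K (ExteriorAlgebra K L₀) (SymmetricAlgebra K L₁))
    (⋀[K]^n L₀) ⊤

variable {L₀ L₁}

/-- Multiplication `c ↦ a ∧ c` of chains by `a ∈ L₀`. -/
def wedge : L₀ →ₗ[K] Module.End K (Chains K L₀ L₁) :=
  LinearMap.rTensorHom (SymmetricAlgebra K L₁) ∘ₗ LinearMap.mul K _ ∘ₗ ExteriorAlgebra.ι K

/-- Multiplication `c ↦ m ∧ c` of chains by `m ∈ L₁`. -/
def mulSym : L₁ →ₗ[K] Module.End K (Chains K L₀ L₁) :=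
  LinearMap.lTensorHom (ExteriorAlgebra K L₀) ∘ₗ LinearMap.mul K _ ∘ₗ SymmetricAlgebra.ι K L₁

@[simp] theorem wedge_tmul (a : L₀) (x : ExteriorAlgebra K L₀) (s : SymmetricAlgebra K L₁) :
    wedge K a (x ⊗ₜ[K] s) = (ExteriorAlgebra.ι K a * x) ⊗ₜ[K] s := by
  simp [wedge]

@[simp] theorem mulSym_tmul (m : L₁) (x : ExteriorAlgebra K L₀) (s : SymmetricAlgebra K L₁) :
    mulSym K m (x ⊗ₜ[K] s) = x ⊗ₜ[K] (SymmetricAlgebra.ι K L₁ m * s) := by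
  simp [mulSym]

theorem wedge_wedge (a : L₀) (c : Chains K L₀ L₁) : wedge K a (wedge K a c) = 0 := by
  induction c using TensorProduct.induction_on with
  | zero => simp
  | tmul x s => simp [← mul_assoc]
  | add x y hx hy => simp [hx, hy]

theorem wedge_mulSym (a : L₀) (m : L₁) (c : Chains K L₀ L₁) :
    wedge K a (mulSym K m c) = mulSym K m (wedge K a c) := by
  induction c using TensorProduct.induction_on with
  | zero => simp
  | tmul x s => simp
  | add x y hx hy => simp [hx, hy]

theorem chains_induction {C : Chains K L₀ L₁ → Prop} (one : ∀ s, C (1 ⊗ₜ[K] s))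
    (add : ∀ x y, C x → C y → C (x + y)) (wedge : ∀ a x, C x → C (wedge K a x))
    (c : Chains K L₀ L₁) : C c := by
  induction c using TensorProduct.induction_on with
  | zero => simpa using one 0
  | add x y hx hy => exact add _ _ hx hy
  | tmul x s =>
    induction x using ext_induction generalizing s with
    | one => exact one s
    | smul r x h => rw [TensorProduct.smul_tmul]; exact h _
    | add x y hx hy => rw [TensorProduct.add_tmul]; exact add _ _ (hx s) (hy s)
    | mul a x h => have := wedge a _ (h s); rwa [wedge_tmul] at this

end Chains

section Differential

variable (K : Type*) {L₀ L₁ : Type*} [CommRing K] [LieRing L₀] [LieAlgebra K L₀]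
  [AddCommGroup L₁] [Module K L₁] [LieRingModule L₀ L₁] [LieModule K L₀ L₁]

/-- The action of `a ∈ L₀` on chains: the derivation that extends the bracket with `a`. -/
def ad : L₀ →ₗ[K] Module.End K (Chains K L₀ L₁) where
  toFun a := (extDer (LieModule.toEnd K L₀ L₀ a)).rTensor _ +
    ((symDer (LieModule.toEnd K L₀ L₁ a)).toLinearMap).lTensor _
  map_add' a b := by
    rw [map_add, map_add, extDer_add, symDer_add, LinearMap.rTensor_add,
      Derivation.coe_add_linearMap, LinearMap.lTensor_add]
    abel
  map_smul' r a := by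
    rw [map_smul, map_smul, extDer_smul, symDer_smul, LinearMap.rTensor_smul,
      Derivation.coe_smul_linearMap, LinearMap.lTensor_smul, RingHom.id_apply, smul_add]

theorem ad_tmul (a : L₀) (x : ExteriorAlgebra K L₀) (s : SymmetricAlgebra K L₁) :
    ad K a (x ⊗ₜ[K] s) = extDer (LieModule.toEnd K L₀ L₀ a) x ⊗ₜ[K] s +
      x ⊗ₜ[K] symDer (LieModule.toEnd K L₀ L₁ a) s := by
  simp [ad]

theorem ad_wedge (a b : L₀) (c : Chains K L₀ L₁) :
    ad K a (wedge K b c) = wedge K ⁅a, b⁆ c + wedge K b (ad K a c) := by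
  induction c using TensorProduct.induction_on with
  | zero => simp
  | tmul x s => simp [ad_tmul, TensorProduct.add_tmul]; abel
  | add x y hx hy => simp only [map_add, hx, hy]; abel

theorem ad_mulSym (a : L₀) (m : L₁) (c : Chains K L₀ L₁) :
    ad K a (mulSym K m c) = mulSym K ⁅a, m⁆ c + mulSym K m (ad K a c) := by
  induction c using TensorProduct.induction_on with
  | zero => simp
  | tmul x s => simp [ad_tmul, TensorProduct.tmul_add, mul_comm]; abel
  | add x y hx hy => simp only [map_add, hx, hy]; abel

theorem ad_lie (a b : L₀) (c : Chains K L₀ L₁) :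
    ad K ⁅a, b⁆ c = ad K a (ad K b c) - ad K b (ad K a c) := by
  induction c using chains_induction with
  | one s =>
    simp only [ad_tmul, extDer_one, TensorProduct.zero_tmul, zero_add, LieHom.map_lie, symDer_lie,
      Derivation.commutator_apply, TensorProduct.tmul_sub]
  | add x y hx hy => simp only [map_add, hx, hy]; abel
  | wedge v x h => simp only [ad_wedge, h, map_add, map_sub, lie_lie, LinearMap.sub_apply]; abel

/-- The total differential `∂̄ + d_CE` on Chevalley-Eilenberg chains, where `δ : L₀ → L₁` is the
internal differential.  It is determined by Cartan's formula: it vanishes on `1 ⊗ S(L₁)` and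
`d (a ∧ c) = ad_a c - a ∧ d c + δ(a) ∧ c` for `a ∈ L₀`
(see `diff_one_tmul` and `diff_wedge`). -/
def diff (δ : L₀ →ₗ[K] L₁) : Module.End K (Chains K L₀ L₁) :=
  TensorProduct.lift <| CliffordAlgebra.foldr' (0 : QuadraticForm K L₀)
    (LinearMap.mk₂ K
      (fun a p => ad K a ∘ₗ TensorProduct.mk K _ _ p.1 - wedge K a ∘ₗ p.2 +
        mulSym K (δ a) ∘ₗ TensorProduct.mk K _ _ p.1)
      (by intros; ext; simp; abel) (by intros; ext; simp [smul_sub])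
      (by intros; ext; simp; abel)
      (by
        intros
        simp only [Prod.smul_fst, Prod.smul_snd, map_smul, LinearMap.comp_smul]
        module))
    (by
      intro a x f
      ext s
      have h1 := ad_wedge K a a (x ⊗ₜ[K] s)
      have h2 := wedge_wedge K a (f s)
      have h3 := wedge_mulSym K a (δ a) (x ⊗ₜ[K] s)
      rw [wedge_tmul, lie_self, map_zero, LinearMap.zero_apply, zero_add] at h1
      rw [wedge_tmul] at h3
      change ad K a ((ExteriorAlgebra.ι K a * x) ⊗ₜ[K] s) - wedge K a (ad K a (x ⊗ₜ[K] s) -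
        wedge K a (f s) + mulSym K (δ a) (x ⊗ₜ[K] s)) +
        mulSym K (δ a) ((ExteriorAlgebra.ι K a * x) ⊗ₜ[K] s) = _
      rw [map_add, map_sub, h1, h2, h3]
      simp)
    0

variable (δ : L₀ →ₗ[K] L₁)

@[simp] theorem diff_one_tmul (s : SymmetricAlgebra K L₁) :
    diff K δ ((1 : ExteriorAlgebra K L₀) ⊗ₜ[K] s) = 0 := by
  rw [← (algebraMap K (ExteriorAlgebra K L₀)).map_one, diff, TensorProduct.lift.tmul]
  exact DFunLike.congr_fun ((CliffordAlgebra.foldr'_algebraMap _ _ _ _ _).trans (smul_zero _)) s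

theorem diff_wedge (a : L₀) (c : Chains K L₀ L₁) :
    diff K δ (wedge K a c) = ad K a c - wedge K a (diff K δ c) + mulSym K (δ a) c := by
  induction c using TensorProduct.induction_on with
  | zero => simp
  | tmul x s =>
    rw [wedge_tmul, diff, TensorProduct.lift.tmul, CliffordAlgebra.foldr'_ι_mul]
    rfl
  | add x y hx hy => simp only [map_add, hx, hy]; abel

/-- The differential lowers the degree by one. -/
theorem diff_mem (n : ℕ) {c : Chains K L₀ L₁} (hc : c ∈ chainsOfDegree K L₀ L₁ (n + 1)) :
    diff K δ c ∈ chainsOfDegree K L₀ L₁ n := by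
  have hw : ∀ (n : ℕ) (a : L₀) (c : Chains K L₀ L₁), c ∈ chainsOfDegree K L₀ L₁ n →
      wedge K a c ∈ chainsOfDegree K L₀ L₁ (n + 1) := by
    intro n a c hc
    refine Submodule.map₂_le (r := (chainsOfDegree K L₀ L₁ (n + 1)).comap (wedge K a)) |>.2 ?_ hc
    intro x hx s _
    rw [Submodule.mem_comap, TensorProduct.mk_apply, wedge_tmul]
    refine Submodule.apply_mem_map₂ _ ?_ trivial
    rw [ExteriorAlgebra.exteriorPower, pow_succ']
    exact Submodule.mul_mem_mul ⟨a, rfl⟩ hx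
  have hm : ∀ (n : ℕ) (m : L₁) (c : Chains K L₀ L₁), c ∈ chainsOfDegree K L₀ L₁ n →
      mulSym K m c ∈ chainsOfDegree K L₀ L₁ n := by
    intro n m c hc
    refine Submodule.map₂_le (r := (chainsOfDegree K L₀ L₁ n).comap (mulSym K m)) |>.2 ?_ hc
    intro x hx s _
    rw [Submodule.mem_comap, TensorProduct.mk_apply, mulSym_tmul]
    exact Submodule.apply_mem_map₂ _ hx trivial
  have hspan : ∀ (n : ℕ) (N : Submodule K (Chains K L₀ L₁)),
      (∀ a, ∀ c ∈ chainsOfDegree K L₀ L₁ n, wedge K a c ∈ N) →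
        chainsOfDegree K L₀ L₁ (n + 1) ≤ N := by
    intro n N h
    refine Submodule.map₂_le.2 ?_
    intro x hx s _
    rw [ExteriorAlgebra.exteriorPower, pow_succ'] at hx
    induction hx using Submodule.mul_induction_on' with
    | mem_mul_mem y hy x hx =>
      obtain ⟨a, rfl⟩ := hy
      rw [TensorProduct.mk_apply, ← wedge_tmul]
      exact h a _ (Submodule.apply_mem_map₂ _ hx trivial)
    | add x _ y _ hx hy => rw [map_add]; exact N.add_mem hx hy
  have h0 : ∀ s, (1 : ExteriorAlgebra K L₀) ⊗ₜ[K] s ∈ chainsOfDegree K L₀ L₁ 0 := fun s =>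
    Submodule.apply_mem_map₂ _ (by rw [ExteriorAlgebra.exteriorPower, pow_zero]; exact Submodule.one_le.1 le_rfl) trivial
  have hle0 : ∀ N : Submodule K (Chains K L₀ L₁), (∀ s, 1 ⊗ₜ[K] s ∈ N) →
      chainsOfDegree K L₀ L₁ 0 ≤ N := by
    intro N h
    refine Submodule.map₂_le.2 ?_
    intro x hx s _
    rw [ExteriorAlgebra.exteriorPower, pow_zero, Submodule.mem_one] at hx
    obtain ⟨r, rfl⟩ := hx
    rw [TensorProduct.mk_apply, Algebra.algebraMap_eq_smul_one, TensorProduct.smul_tmul]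
    exact h _
  have had : ∀ (n : ℕ) (a : L₀), chainsOfDegree K L₀ L₁ n ≤
      (chainsOfDegree K L₀ L₁ n).comap (ad K a) := by
    intro n a
    induction n with
    | zero =>
      refine hle0 _ fun s => ?_
      rw [Submodule.mem_comap, ad_tmul, extDer_one, TensorProduct.zero_tmul, zero_add]
      exact h0 _
    | succ n ih =>
      refine hspan n _ fun b c hc => ?_
      rw [Submodule.mem_comap, ad_wedge]
      exact add_mem (hw _ _ _ hc) (hw _ _ _ (ih hc))
  induction n generalizing c with
  | zero =>
    refine hspan 0 ((chainsOfDegree K L₀ L₁ 0).comap (diff K δ)) (fun a c hc => ?_) hc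
    have hz : diff K δ c = 0 := hle0 (LinearMap.ker (diff K δ)) (fun s => by simp) hc
    rw [Submodule.mem_comap, diff_wedge, hz, map_zero, sub_zero]
    exact add_mem (had 0 a hc) (hm _ _ _ hc)
  | succ n ih =>
    refine hspan (n + 1) ((chainsOfDegree K L₀ L₁ (n + 1)).comap (diff K δ)) (fun a c hc => ?_) hc
    rw [Submodule.mem_comap, diff_wedge]
    exact add_mem (sub_mem (had _ a hc) (hw _ _ _ (ih hc))) (hm _ _ _ hc)

theorem diff_mulSym_wedge (a : L₀) (m : L₁) (c : Chains K L₀ L₁) :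
    diff K δ (mulSym K m (wedge K a c)) - mulSym K m (diff K δ (wedge K a c)) =
      mulSym K ⁅a, m⁆ c - wedge K a (diff K δ (mulSym K m c) - mulSym K m (diff K δ c)) := by
  have hmm : mulSym K (δ a) (mulSym K m c) = mulSym K m (mulSym K (δ a) c) := by
    induction c using TensorProduct.induction_on with
    | zero => simp
    | tmul x s => simp [mul_left_comm]
    | add x y hx hy => simp only [map_add, hx, hy]
  rw [← wedge_mulSym, diff_wedge, diff_wedge, ad_mulSym, hmm]
  simp only [map_add, map_sub, wedge_mulSym]
  abel

theorem diff_ad (hδ : ∀ a b : L₀, δ ⁅a, b⁆ = ⁅a, δ b⁆ - ⁅b, δ a⁆) (a : L₀)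
    (c : Chains K L₀ L₁) :
    diff K δ (ad K a c) - ad K a (diff K δ c) +
      (diff K δ (mulSym K (δ a) c) - mulSym K (δ a) (diff K δ c)) = 0 := by
  induction c using chains_induction with
  | one s => simp [ad_tmul]
  | add x y hx hy =>
    rw [← add_zero (0 : Chains K L₀ L₁)]
    nth_rewrite 1 [← hx]
    rw [← hy]
    simp only [map_add]; abel
  | wedge b x h =>
    rw [diff_mulSym_wedge, ad_wedge, map_add, diff_wedge, diff_wedge, diff_wedge, hδ]
    have h' := congrArg (wedge K b) h
    rw [map_zero] at h'
    refine Eq.trans ?_ (neg_eq_zero.2 h')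
    simp only [map_add, map_sub, LinearMap.sub_apply, ad_lie, ad_wedge, ad_mulSym]
    abel

/-- The differential squares to zero as soon as `δ` is a derivation. -/
theorem diff_diff (hδ : ∀ a b : L₀, δ ⁅a, b⁆ = ⁅a, δ b⁆ - ⁅b, δ a⁆) (c : Chains K L₀ L₁) :
    diff K δ (diff K δ c) = 0 := by
  induction c using chains_induction with
  | one s => simp
  | add x y hx hy => simp only [map_add, hx, hy, add_zero]
  | wedge b x h =>
    rw [diff_wedge, map_add, map_sub, diff_wedge, h, map_zero, sub_zero, ← diff_ad K δ hδ b x]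
    abel

/-- Cycles of degree `n`. -/
def cycles (n : ℕ) : Submodule K (Chains K L₀ L₁) :=
  LinearMap.ker (diff K δ) ⊓ chainsOfDegree K L₀ L₁ n

/-- Boundaries of degree `n`. -/
def boundaries (n : ℕ) : Submodule K (Chains K L₀ L₁) :=
  (chainsOfDegree K L₀ L₁ (n + 1)).map (diff K δ)

theorem boundaries_le_cycles (hδ : ∀ a b : L₀, δ ⁅a, b⁆ = ⁅a, δ b⁆ - ⁅b, δ a⁆) (n : ℕ) :
    boundaries K δ n ≤ cycles K δ n := by
  rintro _ ⟨c, hc, rfl⟩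
  exact ⟨diff_diff K δ hδ c, diff_mem K δ n hc⟩

/-- The `n`-th Lie algebra hyperhomology of the dg Lie algebra `δ : L₀ → L₁`, that is, cycles
modulo boundaries, realised as a subspace of chains modulo boundaries. -/
def hyperhomology (n : ℕ) : Submodule K (Chains K L₀ L₁ ⧸ boundaries K δ n) :=
  (cycles K δ n).map (boundaries K δ n).mkQ

end Differential

end DGLie

/-! ### The Jouanolou dg algebra of the punctured affine plane and its differential operators -/

namespace Jouanolou

/-- Generators `z¹, z²` (coordinates), `x¹, x²` (standing for `z̄ⁱ / (z¹ z̄¹ + z² z̄²)`) and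
`dx¹, dx²` (standing for `∂̄x¹, ∂̄x²`). -/
inductive Gen : Type
  | z (i : Fin 2)
  | x (i : Fin 2)
  | dx (i : Fin 2)

open MvPolynomial in
/-- Defining relations of the Jouanolou algebra: `z¹x¹ + z²x² = 1`, its `∂̄`-derivative
`z¹dx¹ + z²dx² = 0`, and `dxⁱ dxʲ = 0`. -/
inductive Rel : MvPolynomial Gen ℂ → Prop
  | zx : Rel (∑ i, X (Gen.z i) * X (Gen.x i) - 1)
  | zdx : Rel (∑ i, X (Gen.z i) * X (Gen.dx i))
  | dxdx (i j : Fin 2) : Rel (X (Gen.dx i) * X (Gen.dx j))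

/-- The ideal generated by the relations. -/
def relIdeal : Ideal (MvPolynomial Gen ℂ) := Ideal.span {r | Rel r}

/-- The Jouanolou dg algebra `J = J⁰ ⊕ J¹` of the punctured affine plane: the graded commutative
algebra over `ℂ[z¹, z²]` with generators `x¹, x²` in degree `0` and `dx¹, dx²` in degree `1`, and
relations `∑ zⁱxⁱ = 1`, `∑ zⁱdxⁱ = 0`.
By graded commutativity `(dxⁱ)² = 0`, so that `zⁱ dx¹dx² = 0` for both `i` by the second relation
and `dx¹dx² = 0` by the first; hence there is nothing in degree `2`, all products of odd elements
vanish, and the graded commutative algebra is this commutative ring. -/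
def J : Type := MvPolynomial Gen ℂ ⧸ relIdeal

instance : CommRing J := inferInstanceAs (CommRing (MvPolynomial Gen ℂ ⧸ relIdeal))

instance : Algebra ℂ J := inferInstanceAs (Algebra ℂ (MvPolynomial Gen ℂ ⧸ relIdeal))

/-- The quotient map. -/
def proj : MvPolynomial Gen ℂ →ₐ[ℂ] J := Ideal.Quotient.mkₐ ℂ relIdeal

theorem proj_surjective : Function.Surjective proj := Ideal.Quotient.mk_surjective

theorem proj_eq_zero_iff {p : MvPolynomial Gen ℂ} : proj p = 0 ↔ p ∈ relIdeal :=
  Ideal.Quotient.eq_zero_iff_mem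

/-- The coordinate functions `zⁱ`. -/
def z (i : Fin 2) : J := proj (MvPolynomial.X (Gen.z i))

/-- The functions `xⁱ`. -/
def x (i : Fin 2) : J := proj (MvPolynomial.X (Gen.x i))

/-- The `(0,1)`-forms `dxⁱ = ∂̄xⁱ`. -/
def dx (i : Fin 2) : J := proj (MvPolynomial.X (Gen.dx i))

/-- The degree one part `J¹`: the ideal generated by `dx¹, dx²`. -/
def J₁ : Ideal J := Ideal.span (Set.range dx)

/-- The `(0,1)`-form `P = x¹ ∂̄x² - x² ∂̄x¹`. -/
def P : J := x 0 * dx 1 - x 1 * dx 0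

theorem z_mul_x : ∑ i, z i * x i = 1 := by
  have h : proj (∑ i, MvPolynomial.X (Gen.z i) * MvPolynomial.X (Gen.x i) - 1)
      = 0 := proj_eq_zero_iff.2 (Ideal.subset_span Rel.zx)
  rw [map_sub, map_sum, map_one, sub_eq_zero] at h
  exact h

theorem z_mul_dx : ∑ i, z i * dx i = 0 := by
  have h : proj (∑ i, MvPolynomial.X (Gen.z i) * MvPolynomial.X (Gen.dx i))
      = 0 := proj_eq_zero_iff.2 (Ideal.subset_span Rel.zdx)
  rw [map_sum] at h
  exact h

theorem dx_mul_dx (i j : Fin 2) : dx i * dx j = 0 :=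
  proj_eq_zero_iff.2 (Ideal.subset_span (Rel.dxdx i j))

theorem derivation_mem {d : Derivation ℂ (MvPolynomial Gen ℂ) (MvPolynomial Gen ℂ)}
    (hd : ∀ r, Rel r → proj (d r) = 0) (p : MvPolynomial Gen ℂ)
    (hp : proj p = 0) : proj (d p) = 0 := by
  rw [proj_eq_zero_iff] at hp
  refine Submodule.span_induction (p := fun p _ => proj (d p) = 0)
    (fun r hr => hd r hr) (by simp) (fun a b _ _ ha hb => by simp [ha, hb])
    (fun a b hb h => ?_) hp
  rw [smul_eq_mul, Derivation.leibniz, map_add, smul_eq_mul, smul_eq_mul, map_mul, map_mul, h,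
    proj_eq_zero_iff.2 (show b ∈ relIdeal from hb), mul_zero, zero_mul, add_zero]

open MvPolynomial in
/-- Values on generators of the holomorphic derivative `∂ᵢ = ∂/∂zⁱ`; thus
`∂ᵢxʲ = ∂/∂zⁱ (z̄ʲ / z z̄) = -xⁱxʲ`, and `∂ᵢdxʲ = ∂̄(∂ᵢxʲ)`. -/
def partialGen (i : Fin 2) : Gen → MvPolynomial Gen ℂ
  | .z j => if i = j then 1 else 0
  | .x j => -(X (.x i) * X (.x j))
  | .dx j => -(X (.x i) * X (.dx j) + X (.x j) * X (.dx i))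

theorem proj_mkDerivation_partialGen (i : Fin 2) (p : MvPolynomial Gen ℂ) (hp : proj p = 0) :
    proj (MvPolynomial.mkDerivation ℂ (partialGen i) p) = 0 := by
  revert p
  exact (derivation_mem (by
      have h1 := z_mul_x
      have h2 := z_mul_dx
      have h3 := dx_mul_dx
      rintro _ (_ | _ | ⟨j, k⟩)
      · have : -(x i * (∑ k, z k * x k - 1)) = 0 := by rw [h1]; ring
        rw [← this]
        fin_cases i <;>
          simp [partialGen, Fin.sum_univ_two, MvPolynomial.mkDerivation_X, z, x] <;> ring
      · have : -(x i * (∑ k, z k * dx k)) - dx i * (∑ k, z k * x k - 1) = 0 := by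
          rw [h1, h2]; ring
        rw [← this]
        fin_cases i <;>
          simp [partialGen, Fin.sum_univ_two, MvPolynomial.mkDerivation_X, z, x, dx] <;> ring
      · have : -(2 * x i * (dx j * dx k) + x j * (dx i * dx k) + x k * (dx j * dx i)) = 0 := by
          simp only [h3]; ring
        rw [← this]
        simp [partialGen, MvPolynomial.mkDerivation_X, x, dx]; ring))

/-- The holomorphic derivative `∂ᵢ = ∂/∂zⁱ` on `J`. -/
def pderiv (i : Fin 2) : Derivation ℂ J J :=
  Derivation.liftOfSurjective proj_surjective (proj_mkDerivation_partialGen i)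

open MvPolynomial in
/-- Values on generators of `∂̄`. -/
def dbarGen : Gen → MvPolynomial Gen ℂ
  | .z _ => 0
  | .x j => X (.dx j)
  | .dx _ => 0

theorem proj_mkDerivation_dbarGen (p : MvPolynomial Gen ℂ) (hp : proj p = 0) :
    proj (MvPolynomial.mkDerivation ℂ dbarGen p) = 0 := by
  revert p
  exact (derivation_mem (by
      have h2 := z_mul_dx
      rintro _ (_ | _ | ⟨j, k⟩)
      · rw [← h2]
        simp [dbarGen, Fin.sum_univ_two, MvPolynomial.mkDerivation_X, z, dx]
      · simp [dbarGen, Fin.sum_univ_two, MvPolynomial.mkDerivation_X]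
      · simp [dbarGen, MvPolynomial.mkDerivation_X]))

/-- The differential `∂̄` of `J`.  Since products of odd elements vanish, the graded Leibniz rule
is the ordinary one. -/
def dbar : Derivation ℂ J J :=
  Derivation.liftOfSurjective proj_surjective proj_mkDerivation_dbarGen

theorem pderiv_mk (i : Fin 2) (p : MvPolynomial Gen ℂ) :
    pderiv i (proj p) =
      proj (MvPolynomial.mkDerivation ℂ (partialGen i) p) :=
  Derivation.liftOfSurjective_apply proj_surjective (proj_mkDerivation_partialGen i) p

theorem dbar_mk (p : MvPolynomial Gen ℂ) :
    dbar (proj p) =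
      proj (MvPolynomial.mkDerivation ℂ dbarGen p) :=
  Derivation.liftOfSurjective_apply proj_surjective proj_mkDerivation_dbarGen p

@[simp] theorem pderiv_z (i j : Fin 2) : pderiv i (z j) = if i = j then 1 else 0 := by
  rw [z, pderiv_mk, MvPolynomial.mkDerivation_X, partialGen]; split_ifs <;> simp

@[simp] theorem pderiv_x (i j : Fin 2) : pderiv i (x j) = -(x i * x j) := by
  rw [x, pderiv_mk, MvPolynomial.mkDerivation_X, partialGen]; simp [x]

@[simp] theorem pderiv_dx (i j : Fin 2) : pderiv i (dx j) = -(x i * dx j + x j * dx i) := by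
  rw [dx, pderiv_mk, MvPolynomial.mkDerivation_X, partialGen]; simp [x, dx]

@[simp] theorem dbar_z (j : Fin 2) : dbar (z j) = 0 := by
  rw [z, dbar_mk, MvPolynomial.mkDerivation_X, dbarGen, map_zero]

@[simp] theorem dbar_x (j : Fin 2) : dbar (x j) = dx j := by
  rw [x, dbar_mk, MvPolynomial.mkDerivation_X, dbarGen, dx]

@[simp] theorem dbar_dx (j : Fin 2) : dbar (dx j) = 0 := by
  rw [dx, dbar_mk, MvPolynomial.mkDerivation_X, dbarGen, map_zero]

theorem derivation_ext {D D' : Derivation ℂ J J} (hz : ∀ i, D (z i) = D' (z i))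
    (hx : ∀ i, D (x i) = D' (x i)) (hdx : ∀ i, D (dx i) = D' (dx i)) : D = D' := by
  ext a
  obtain ⟨p, rfl⟩ := proj_surjective a
  induction p using MvPolynomial.induction_on with
  | C r =>
    have : proj (MvPolynomial.C r) = algebraMap ℂ J r := proj.commutes r
    rw [this, Derivation.map_algebraMap, Derivation.map_algebraMap]
  | add p q hp hq => simp only [map_add, hp, hq]
  | mul_X p g hp =>
    rw [map_mul, Derivation.leibniz, Derivation.leibniz, hp]
    rcases g with i | i | i
    · exact congrArg (fun t => _ • t + _) (hz i)
    · exact congrArg (fun t => _ • t + _) (hx i)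
    · exact congrArg (fun t => _ • t + _) (hdx i)

theorem dbar_pderiv (i : Fin 2) (a : J) : dbar (pderiv i a) = pderiv i (dbar a) := by
  have h : ⁅dbar, pderiv i⁆ = 0 := by
    refine derivation_ext ?_ ?_ ?_ <;> intro j <;> rw [Derivation.commutator_apply]
    · simp only [pderiv_z, dbar_z, map_zero, sub_zero]; split_ifs <;> simp
    · simp
    · simp [dx_mul_dx]
  have := DFunLike.congr_fun h a
  rwa [Derivation.commutator_apply, Derivation.zero_apply, sub_eq_zero] at this

theorem mem_J₁_of_dx (i : Fin 2) : dx i ∈ J₁ := Ideal.subset_span ⟨i, rfl⟩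

theorem pderiv_mem_J₁ (i : Fin 2) {a : J} (ha : a ∈ J₁) : pderiv i a ∈ J₁ := by
  induction ha using Submodule.span_induction with
  | mem a h =>
    obtain ⟨j, rfl⟩ := h
    rw [pderiv_dx]
    exact neg_mem (add_mem (J₁.mul_mem_left _ (mem_J₁_of_dx j)) (J₁.mul_mem_left _ (mem_J₁_of_dx i)))
  | zero => simp
  | add a b _ _ ha hb => rw [map_add]; exact add_mem ha hb
  | smul r a h ih =>
    rw [smul_eq_mul, Derivation.leibniz]
    exact add_mem (J₁.mul_mem_left _ ih) (J₁.mul_mem_right _ h)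

theorem P_mem_J₁ : P ∈ J₁ :=
  sub_mem (J₁.mul_mem_left _ (mem_J₁_of_dx 1)) (J₁.mul_mem_left _ (mem_J₁_of_dx 0))

/-- `∂̄x¹ = -z²P` and `∂̄x² = z¹P`; so `J¹` is generated by `P`. -/
theorem dx_eq : dx 0 = -(z 1 * P) ∧ dx 1 = z 0 * P := by
  have h1 := z_mul_x
  have h2 := z_mul_dx
  rw [Fin.sum_univ_two] at h1 h2
  constructor
  · rw [P]; linear_combination (-dx 0) * h1 + x 0 * h2
  · rw [P]; linear_combination (-dx 1) * h1 + x 1 * h2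

/-- Multiplication operators on `J`. -/
abbrev mul : J →ₐ[ℂ] Module.End ℂ J := Algebra.lmul ℂ J

/-- `∂ᵢ` as an operator on `J`. -/
def partialOp (i : Fin 2) : Module.End ℂ J := (pderiv i : J →ₗ[ℂ] J)

/-- `∂̄` as an operator on `J`. -/
def dbarOp : Module.End ℂ J := (dbar : J →ₗ[ℂ] J)

theorem partialOp_mul (i : Fin 2) (a : J) :
    partialOp i * mul a = mul (pderiv i a) + mul a * partialOp i := by
  refine LinearMap.ext fun b => ?_
  simp [partialOp]; ring

theorem dbarOp_mul (a : J) : dbarOp * mul a - mul a * dbarOp = mul (dbar a) := by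
  refine LinearMap.ext fun b => ?_
  simp [dbarOp]; ring

theorem dbarOp_partialOp (i : Fin 2) : dbarOp * partialOp i - partialOp i * dbarOp = 0 :=
  LinearMap.ext fun b => sub_eq_zero.2 (dbar_pderiv i b)

/-- Generators of the degree zero differential operators: multiplication by `zⁱ` and by `xⁱ`, and
the derivatives `∂ᵢ`. -/
inductive IsGen₀ : Module.End ℂ J → Prop
  | z (i : Fin 2) : IsGen₀ (mul (z i))
  | x (i : Fin 2) : IsGen₀ (mul (x i))
  | partialOp (i : Fin 2) : IsGen₀ (partialOp i)

/-- The algebra `J⁰[∂₁, ∂₂]` of polynomial differential operators of cohomological degree zero, as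
operators on `J`. -/
def D₀ : Subalgebra ℂ (Module.End ℂ J) := Algebra.adjoin ℂ {T | IsGen₀ T}

/-- The space `J¹[∂₁, ∂₂]` of polynomial differential operators of cohomological degree one,
spanned by the operators `ω ∘ T` with `ω ∈ J¹` and `T ∈ J⁰[∂₁, ∂₂]`. -/
def D₁ : Submodule ℂ (Module.End ℂ J) :=
  (J₁.restrictScalars ℂ).map mul.toLinearMap * Subalgebra.toSubmodule D₀

theorem mul_mem_D₁ {w : J} (hw : w ∈ J₁) {T : Module.End ℂ J} (hT : T ∈ D₀) : mul w * T ∈ D₁ :=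
  Submodule.mul_mem_mul ⟨w, hw, rfl⟩ hT

theorem D₁_induction {C : Module.End ℂ J → Prop}
    (mul : ∀ w ∈ J₁, ∀ T ∈ D₀, C (mul w * T)) (add : ∀ S S', C S → C S' → C (S + S'))
    {S : Module.End ℂ J} (hS : S ∈ D₁) : C S := by
  refine Submodule.mul_induction_on hS ?_ add
  rintro _ ⟨w, hw, rfl⟩ T hT
  exact mul w hw T hT

theorem D₀_mul_D₁ {T : Module.End ℂ J} (hT : T ∈ D₀) : ∀ S ∈ D₁, T * S ∈ D₁ := by
  have hmul : ∀ (a : J), ∀ S ∈ D₁, mul a * S ∈ D₁ := by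
    intro a S hS
    refine D₁_induction (C := fun S => mul a * S ∈ D₁) (fun w hw S hS => ?_) (fun S S' h h' => ?_) hS
    · rw [← mul_assoc, ← map_mul]
      exact mul_mem_D₁ (J₁.mul_mem_left _ hw) hS
    · rw [mul_add]; exact add_mem h h'
  refine Algebra.adjoin_induction (p := fun T _ => ∀ S ∈ D₁, T * S ∈ D₁) ?_ ?_ ?_ ?_ hT
  · rintro _ (i | i | i)
    · exact hmul _
    · exact hmul _
    · intro S hS
      refine D₁_induction (C := fun S => partialOp i * S ∈ D₁) (fun w hw S hS => ?_)
        (fun S S' h h' => ?_) hS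
      · rw [← mul_assoc, partialOp_mul, add_mul, mul_assoc]
        exact add_mem (mul_mem_D₁ (pderiv_mem_J₁ i hw) hS)
          (mul_mem_D₁ hw (mul_mem (Algebra.subset_adjoin (IsGen₀.partialOp i)) hS))
      · rw [mul_add]; exact add_mem h h'
  · intro r S hS
    rw [← Algebra.smul_def]
    exact Submodule.smul_mem _ _ hS
  · intro T T' _ _ h h' S hS; rw [add_mul]; exact add_mem (h S hS) (h' S hS)
  · intro T T' _ _ h h' S hS; rw [mul_assoc]; exact h _ (h' S hS)

theorem D₁_mul_D₀ {T S : Module.End ℂ J} (hT : T ∈ D₀) (hS : S ∈ D₁) : S * T ∈ D₁ := by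
  refine D₁_induction (C := fun S => S * T ∈ D₁) (fun w hw S hS => ?_) (fun S S' h h' => ?_) hS
  · rw [mul_assoc]; exact mul_mem_D₁ hw (mul_mem hS hT)
  · rw [add_mul]; exact add_mem h h'

/-- The degree zero part `J⁰[∂₁, ∂₂]` of the dg Lie algebra of polynomial differential operators
on the punctured affine plane, with the commutator bracket. -/
def L₀ : Type := D₀

/-- The degree one part `J¹[∂₁, ∂₂]` of the dg Lie algebra of polynomial differential operators on
the punctured affine plane. -/
def L₁ : Type := D₁

instance : LieRing L₀ := (LieRing.ofAssociativeRing : LieRing D₀)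

instance : LieAlgebra ℂ L₀ :=
  letI := (LieRing.ofAssociativeRing : LieRing D₀)
  (LieAlgebra.ofAssociativeAlgebra : LieAlgebra ℂ D₀)

instance : AddCommGroup L₁ := inferInstanceAs (AddCommGroup D₁)

instance : Module ℂ L₁ := inferInstanceAs (Module ℂ D₁)

/-- An element of `L₀` as an operator on `J`. -/
def op₀ : L₀ →ₗ[ℂ] Module.End ℂ J where
  toFun T := (T : D₀).1
  map_add' _ _ := rfl
  map_smul' _ _ := rfl

/-- An element of `L₁` as an operator on `J`. -/
def op₁ : L₁ →ₗ[ℂ] Module.End ℂ J where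
  toFun S := (S : D₁).1
  map_add' _ _ := rfl
  map_smul' _ _ := rfl

/-- An operator in `D₀` as an element of `L₀`. -/
def mk₀ (T : Module.End ℂ J) (hT : T ∈ D₀) : L₀ := (⟨T, hT⟩ : D₀)

/-- An operator in `D₁` as an element of `L₁`. -/
def mk₁ (S : Module.End ℂ J) (hS : S ∈ D₁) : L₁ := (⟨S, hS⟩ : D₁)

@[simp] theorem op₀_mk₀ (T : Module.End ℂ J) (hT : T ∈ D₀) : op₀ (mk₀ T hT) = T := rfl

@[simp] theorem op₁_mk₁ (S : Module.End ℂ J) (hS : S ∈ D₁) : op₁ (mk₁ S hS) = S := rfl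

theorem op₀_mem (T : L₀) : op₀ T ∈ D₀ := T.2

theorem op₁_mem (S : L₁) : op₁ S ∈ D₁ := S.2

theorem op₀_injective : Function.Injective op₀ := fun _ _ h => Subtype.ext h

theorem op₁_injective : Function.Injective op₁ := fun _ _ h => Subtype.ext h

theorem op₀_lie (T T' : L₀) : op₀ ⁅T, T'⁆ = op₀ T * op₀ T' - op₀ T' * op₀ T := rfl

/-- The bracket of `T` in degree zero and `S` in degree one is the commutator. -/
instance : Bracket L₀ L₁ where
  bracket T S := mk₁ (op₀ T * op₁ S - op₁ S * op₀ T)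
    (sub_mem (D₀_mul_D₁ (op₀_mem T) _ (op₁_mem S)) (D₁_mul_D₀ (op₀_mem T) (op₁_mem S)))

theorem op₁_lie (T : L₀) (S : L₁) : op₁ ⁅T, S⁆ = op₀ T * op₁ S - op₁ S * op₀ T := rfl

instance : LieRingModule L₀ L₁ where
  add_lie T T' S := op₁_injective (by
    simp only [op₁_lie, map_add, add_mul, mul_add]; abel)
  lie_add T S S' := op₁_injective (by
    simp only [op₁_lie, map_add, add_mul, mul_add]; abel)
  leibniz_lie T T' S := op₁_injective (by
    simp only [op₁_lie, op₀_lie, map_add, sub_mul, mul_sub, mul_assoc]; abel)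

instance : LieModule ℂ L₀ L₁ where
  smul_lie r T S := op₁_injective (by
    simp only [op₁_lie, map_smul, smul_mul_assoc, mul_smul_comm, smul_sub])
  lie_smul r T S := op₁_injective (by
    simp only [op₁_lie, map_smul, smul_mul_assoc, mul_smul_comm, smul_sub])

theorem commutator_dbar_mem {T : Module.End ℂ J} (hT : T ∈ D₀) :
    dbarOp * T - T * dbarOp ∈ D₁ := by
  refine Algebra.adjoin_induction (p := fun T _ => dbarOp * T - T * dbarOp ∈ D₁) ?_ ?_ ?_ ?_ hT
  · rintro _ (i | i | i)
    · rw [dbarOp_mul, dbar_z, map_zero]; exact zero_mem _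
    · rw [dbarOp_mul, dbar_x, ← mul_one (mul (dx i))]
      exact mul_mem_D₁ (mem_J₁_of_dx i) (one_mem _)
    · rw [dbarOp_partialOp]; exact zero_mem _
  · intro r
    rw [Algebra.commutes, sub_self]; exact zero_mem _
  · intro T T' _ _ h h'
    rw [mul_add, add_mul, add_sub_add_comm]; exact add_mem h h'
  · intro T T' hT hT' h h'
    have : dbarOp * (T * T') - T * T' * dbarOp =
        (dbarOp * T - T * dbarOp) * T' + T * (dbarOp * T' - T' * dbarOp) := by
      rw [sub_mul, mul_sub, mul_assoc, mul_assoc, mul_assoc, sub_add_sub_cancel]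
    rw [this]
    exact add_mem (D₁_mul_D₀ hT' h) (D₀_mul_D₁ hT _ h')

/-- The internal differential of the dg Lie algebra `L = L₀ ⊕ L₁` of polynomial differential
operators on the punctured affine plane, `T ↦ ∂̄ ∘ T - T ∘ ∂̄`, that is
`f ∂₁ᵃ∂₂ᵇ ↦ ∂̄(f) ∂₁ᵃ∂₂ᵇ`.  The part `Lᵢ` sits in cohomological degree `i`; the bracket of `L` is
the graded commutator, which vanishes on `L₁ × L₁` because `L` has no part of degree two. -/
def dbarL : L₀ →ₗ[ℂ] L₁ where
  toFun T := mk₁ (dbarOp * op₀ T - op₀ T * dbarOp) (commutator_dbar_mem (op₀_mem T))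
  map_add' T T' := op₁_injective (by
    simp only [op₁_mk₁, map_add, add_mul, mul_add]; abel)
  map_smul' r T := op₁_injective (by
    simp only [op₁_mk₁, map_smul, smul_mul_assoc, mul_smul_comm, smul_sub, RingHom.id_apply])

theorem op₁_dbarL (T : L₀) : op₁ (dbarL T) = dbarOp * op₀ T - op₀ T * dbarOp := rfl

/-- `∂̄` is a derivation of the bracket. -/
theorem dbarL_lie (T T' : L₀) : dbarL ⁅T, T'⁆ = ⁅T, dbarL T'⁆ - ⁅T', dbarL T⁆ :=
  op₁_injective (by
    simp only [op₁_dbarL, op₀_lie, op₁_lie, map_sub, sub_mul, mul_sub, mul_assoc]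
    abel)

/-- The coordinate `zⁱ` as a differential operator of order zero. -/
def zOp (i : Fin 2) : L₀ := mk₀ (mul (z i)) (Algebra.subset_adjoin (IsGen₀.z i))

/-- The form `P` as a differential operator of order zero. -/
def POp : L₁ :=
  mk₁ (mul P) (by rw [← mul_one (mul P)]; exact mul_mem_D₁ P_mem_J₁ (one_mem _))

theorem op₀_zOp (i : Fin 2) : op₀ (zOp i) = mul (z i) := rfl

theorem op₁_POp : op₁ POp = mul P := rfl

/-- The chain `P ∧ z¹ ∧ z²`. -/
def chainPzz : DGLie.Chains ℂ L₀ L₁ :=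
  DGLie.mulSym ℂ POp (DGLie.wedge ℂ (zOp 0) (DGLie.wedge ℂ (zOp 1) (1 ⊗ₜ[ℂ] 1)))

theorem chainPzz_mem_cycles : chainPzz ∈ DGLie.cycles ℂ dbarL 2 := by
  have h01 : ⁅zOp 0, zOp 1⁆ = 0 := op₀_injective (by
    rw [op₀_lie, map_zero, op₀_zOp, op₀_zOp, ← map_mul, ← map_mul, mul_comm, sub_self])
  have hP : ∀ i, ⁅zOp i, POp⁆ = 0 := fun i => op₁_injective (by
    rw [op₁_lie, map_zero, op₀_zOp, op₁_POp, ← map_mul, ← map_mul, mul_comm, sub_self])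
  have hd : ∀ i, dbarL (zOp i) = 0 := fun i => op₁_injective (by
    rw [op₁_dbarL, op₀_zOp, dbarOp_mul, dbar_z, map_zero, map_zero])
  constructor
  · rw [SetLike.mem_coe, LinearMap.mem_ker, chainPzz, ← DGLie.wedge_mulSym, ← DGLie.wedge_mulSym,
      DGLie.diff_wedge, DGLie.diff_wedge, DGLie.ad_wedge, DGLie.ad_mulSym, DGLie.ad_mulSym, h01,
      hd, hd, hP, hP]
    simp [DGLie.ad_tmul]
  · rw [chainPzz, DGLie.wedge_tmul, DGLie.wedge_tmul, DGLie.mulSym_tmul, mul_one]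
    refine Submodule.apply_mem_map₂ _ ?_ trivial
    rw [ExteriorAlgebra.exteriorPower, pow_two]
    exact Submodule.mul_mem_mul ⟨_, rfl⟩ ⟨_, rfl⟩

/-- The homology class `[P ∧ z¹ ∧ z²]` in the second hyperhomology. -/
def classPzz : DGLie.hyperhomology ℂ dbarL 2 :=
  ⟨(DGLie.boundaries ℂ dbarL 2).mkQ chainPzz, Submodule.mem_map_of_mem chainPzz_mem_cycles⟩

end Jouanolou

end

/-! The coordinates z¹, z² are closed and commute, and their adjoint actions lower the order of a
differential operator, so they are locally nilpotent. With Rⱼ(T) = -T∂ⱼ one has [zⁱ, RⱼT] = Rⱼ[zⁱ,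
T] + δᵢⱼT on both L₀ and L₁. Extended to chains as derivations, ad zⁱ and Rᵢ have as commutator the
number of factors (`chainDer_weyl`), which is nonzero in positive degree. Hence on chains of
positive degree ad z¹ is surjective, and ad z² is surjective on the kernel of ad z¹
(`exists_chainDer_eq`). Cartan's formula d(zⁱ ∧ b) = ad(zⁱ)b - zⁱ ∧ db then moves every 2-cycle, up
to a boundary, to z¹ ∧ z² ∧ b with b a boundary in S(L₁) that is invariant, that is, killed by both
ad zⁱ (`exists_wedge_wedge`). The reverse zigzag shows that, for an invariant m ∈ L₁, z¹ ∧ z² ∧ m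
bounds only if m bounds an invariant 1-chain (`exists_diff_eq_mulSym`). What remains is to study
invariant elements of S(L₁) modulo boundaries of invariant 1-chains.

Upper bound. Let E = z¹∂₁ + z²∂₂. A contracting homotopy built from E and the Rᵢ kills every
invariant of positive weight (number of factors) and Euler weight other than -2
(`IsEuler.exists_diff_eq`). The ∂̄-cohomology of L₁ has Euler weights at most -2, so products of two
or more classes have weights at most -4. Therefore an invariant with at least two factors and Euler
weight -2 is ∂̄-exact; replacing it by the bracket part of the differential of a primitive lowers
the number of factors by one. By induction only invariant elements of L₁ survive
(`IsEuler.exists_wedge_wedge_mulSym`). These have order zero, so they are gP with g ∈ J⁰, and an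
explicit computation of exact monomials leaves only the multiples of P (`mulSym_mem_map`).

Lower bound. A residue functional on J¹ is 1 on P and vanishes on ∂̄-exact forms and on
∂ᵢ-derivatives (`res_P`, `res_dbar`, `res_pderiv`). If P = de with e an invariant 1-chain, then 1 is
the value of a ⊗ l ↦ res([a, l](1)) on the component of e in L₀ ⊗ L₁. Invariant tensors are
generated from tensors of order-zero operators by Rᵢ ⊗ 1 - 1 ⊗ Rᵢ. Integration by parts turns this
operator into ad ∂ᵢ on the first factor, which preserves order zero, and order-zero operators
commute; so the value is 0 (`resLie_eq_zero_of_mem_invTensor`), a contradiction. -/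

noncomputable section

/-! ### Eigenvector decompositions and Weyl pairs of operators -/

namespace LinearMap

open Module.End

section Eigen

variable {K V : Type*} [Field K] [AddCommGroup V] [Module K V]

/-- The sum of the eigenspaces of `f` for the eigenvalues in `A`. -/
def eigSum (f : Module.End K V) (A : Set K) : Submodule K V := ⨆ μ : A, eigenspace f μ

theorem mem_eigSum {f : Module.End K V} {A : Set K} {μ : K} (hμ : μ ∈ A) {v : V}
    (hv : f v = μ • v) : v ∈ eigSum f A :=
  Submodule.mem_iSup_of_mem (⟨μ, hμ⟩ : A) (mem_eigenspace_iff.2 hv)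

theorem eigSum_le {f : Module.End K V} {A : Set K} {N : Submodule K V}
    (h : ∀ μ ∈ A, ∀ v, f v = μ • v → v ∈ N) : eigSum f A ≤ N :=
  iSup_le fun μ v hv => h μ μ.2 v (mem_eigenspace_iff.1 hv)

theorem exists_sum_of_mem_eigSum {f : Module.End K V} {A : Set K} {c : V} (hc : c ∈ eigSum f A) :
    ∃ (s : Finset K) (v : K → V), (∀ μ ∈ s, μ ∈ A) ∧ (∀ μ, f (v μ) = μ • v μ) ∧
      ∑ μ ∈ s, v μ = c := by
  classical
  refine Submodule.iSup_induction (p := fun μ : A => eigenspace f (μ : K))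
    (motive := fun c => ∃ (s : Finset K) (v : K → V), (∀ μ ∈ s, μ ∈ A) ∧
      (∀ μ, f (v μ) = μ • v μ) ∧ ∑ μ ∈ s, v μ = c) hc ?_ ?_ ?_
  · intro μ x hx
    refine ⟨{(μ : K)}, fun ν => if ν = μ then x else 0, ?_, ?_, ?_⟩
    · intro ν hν; rw [Finset.mem_singleton.1 hν]; exact μ.2
    · intro ν
      dsimp only
      split_ifs with h
      · rw [h]; exact mem_eigenspace_iff.1 hx
      · simp
    · simp
  · exact ⟨∅, 0, by simp, by simp, by simp⟩
  · rintro x y ⟨s, v, hs, hv, rfl⟩ ⟨t, w, ht, hw, rfl⟩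
    refine ⟨s ∪ t, fun μ => (if μ ∈ s then v μ else 0) + (if μ ∈ t then w μ else 0), ?_, ?_, ?_⟩
    · intro μ hμ
      rcases Finset.mem_union.1 hμ with h | h
      exacts [hs μ h, ht μ h]
    · intro μ
      dsimp only
      split_ifs <;> simp [hv, hw]
    · rw [Finset.sum_add_distrib]
      congr 1 <;> rw [Finset.sum_ite_mem]
      · rw [Finset.union_inter_cancel_left]
      · rw [Finset.union_inter_cancel_right]

/-- Applying `f - ν` to the sum stays in `p`, deletes the summand of eigenvalue `ν` and rescales
each other one by a nonzero scalar, so the number of summands can be lowered by induction. -/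
theorem eigen_components {f : Module.End K V} {p : Submodule K V} (hp : ∀ v ∈ p, f v ∈ p)
    (s : Finset K) (v : K → V) (hv : ∀ μ ∈ s, f (v μ) = μ • v μ) (h : ∑ μ ∈ s, v μ ∈ p) :
    ∀ μ ∈ s, v μ ∈ p := by
  classical
  induction s using Finset.induction_on generalizing v with
  | empty => simp
  | insert ν s hν ih =>
    have hs : ∀ μ ∈ s, v μ ∈ p := by
      have h1 : ∑ μ ∈ s, (μ - ν) • v μ ∈ p := by
        have h2 := sub_mem (hp _ h) (p.smul_mem ν h)
        convert h2 using 1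
        rw [map_sum, Finset.smul_sum, ← Finset.sum_sub_distrib, Finset.sum_insert hν,
          hv ν (Finset.mem_insert_self _ _), sub_self, zero_add]
        refine Finset.sum_congr rfl fun μ hμ => ?_
        rw [hv μ (Finset.mem_insert_of_mem hμ), sub_smul]
      intro μ hμ
      have h3 := ih (fun μ => (μ - ν) • v μ)
        (fun μ hμ => by rw [map_smul, hv μ (Finset.mem_insert_of_mem hμ), smul_comm]) h1 μ hμ
      have hne : μ - ν ≠ 0 := sub_ne_zero.2 (fun h => hν (h ▸ hμ))
      exact (Submodule.smul_mem_iff p hne).1 h3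
    intro μ hμ
    rcases Finset.mem_insert.1 hμ with rfl | hμ
    · rw [Finset.sum_insert hν] at h
      exact (Submodule.add_mem_iff_left p (Submodule.sum_mem p hs)).1 h
    · exact hs μ hμ

/-- An operator-stable submodule is the sum of its intersections with the eigenspaces. -/
theorem inf_eigSum_le {f : Module.End K V} {p N : Submodule K V} {A : Set K}
    (hp : ∀ v ∈ p, f v ∈ p) (h : ∀ μ ∈ A, ∀ v ∈ p, f v = μ • v → v ∈ N) :
    p ⊓ eigSum f A ≤ N := by
  rintro c ⟨hc, hcA⟩
  obtain ⟨s, v, hs, hv, rfl⟩ := exists_sum_of_mem_eigSum hcA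
  exact Submodule.sum_mem N fun μ hμ => h μ (hs μ hμ) _
    (eigen_components hp s v (fun μ _ => hv μ) hc μ hμ) (hv μ)

/-- This is the way a single eigencomponent is extracted below. With `p = ⊥` it says that an
eigenvector which is also a sum of eigenvectors for other eigenvalues is zero. -/
theorem mem_of_add_eigSum_mem {f : Module.End K V} {p : Submodule K V} {A : Set K} {μ : K}
    (hp : ∀ v ∈ p, f v ∈ p) (hμ : μ ∉ A) {c t : V} (hc : f c = μ • c) (ht : t ∈ eigSum f A)
    (h : c + t ∈ p) : c ∈ p := by
  classical
  obtain ⟨s, v, hs, hv, rfl⟩ := exists_sum_of_mem_eigSum ht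
  have hμs : μ ∉ s := fun h => hμ (hs μ h)
  have := eigen_components hp (insert μ s) (fun ν => if ν = μ then c else v ν) ?_ ?_ μ
    (Finset.mem_insert_self _ _)
  · simpa using this
  · intro ν _
    split_ifs with h
    · rw [h, hc]
    · exact hv ν
  · rw [Finset.sum_insert hμs, if_pos rfl]
    convert h using 2
    exact Finset.sum_congr rfl fun ν hν => if_neg (fun h' : ν = μ => hμs (h' ▸ hν))

/-- Eigenvectors lift along maps that intertwine two operators. -/
theorem exists_eigen_lift {V' : Type*} [AddCommGroup V'] [Module K V'] {f : Module.End K V}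
    {f' : Module.End K V'} {φ : V →ₗ[K] V'} {p : Submodule K V} (hp : ∀ v ∈ p, f v ∈ p)
    (hφ : ∀ v ∈ p, φ (f v) = f' (φ v)) {u : V} (hu : u ∈ p) (huf : u ∈ eigSum f Set.univ) {μ : K}
    (h : f' (φ u) = μ • φ u) : ∃ u' ∈ p, f u' = μ • u' ∧ φ u' = φ u := by
  classical
  obtain ⟨s, v, hs, hv, rfl⟩ := exists_sum_of_mem_eigSum huf
  have hvp := eigen_components hp s v (fun μ _ => hv μ) hu
  refine ⟨if μ ∈ s then v μ else 0, ?_, ?_, ?_⟩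
  · split_ifs with h
    exacts [hvp μ h, zero_mem _]
  · split_ifs with h
    · exact hv μ
    · simp
  -- The difference is an eigenvector of `f'` for `μ` and also a sum of eigenvectors for other
  -- eigenvalues.
  · have key : φ (∑ ν ∈ s, v ν) - φ (if μ ∈ s then v μ else 0) ∈ (⊥ : Submodule K V') := by
      refine mem_of_add_eigSum_mem (f := f') (A := {μ}ᶜ) (μ := μ)
        (t := -∑ ν ∈ s.erase μ, φ (v ν)) (by simp) (by simp) ?_ ?_ ?_
      · rw [map_sub, h, smul_sub]
        congr 1
        split_ifs with hμ
        · rw [← hφ _ (hvp μ hμ), hv, map_smul]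
        · simp
      · refine neg_mem (Submodule.sum_mem _ fun ν hν => ?_)
        have := Finset.mem_erase.1 hν
        refine mem_eigSum (μ := ν) (by simpa using this.1) ?_
        rw [← hφ _ (hvp ν this.2), hv, map_smul]
      · rw [Submodule.mem_bot, map_sum]
        by_cases hμ : μ ∈ s
        · rw [if_pos hμ, ← Finset.add_sum_erase s _ hμ]; abel
        · rw [if_neg hμ, Finset.erase_eq_of_notMem hμ]; simp
    rw [Submodule.mem_bot, sub_eq_zero] at key
    exact key.symm

end Eigen

/-! ### Locally nilpotent operators in Weyl pairs -/

section Weyl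

variable {K V : Type*} [Field K] [AddCommGroup V] [Module K V]

/-- `v` is killed by a power of `X`. -/
def IsNil (X : Module.End K V) (v : V) : Prop := ∃ k : ℕ, (X ^ k) v = 0

theorem IsNil.of_apply_eq_zero {X : Module.End K V} {v : V} (h : X v = 0) : IsNil X v :=
  ⟨1, by simpa using h⟩

theorem IsNil.of_apply {X : Module.End K V} {v : V} (h : IsNil X (X v)) : IsNil X v := by
  obtain ⟨k, hk⟩ := h
  exact ⟨k + 1, by rw [pow_succ, Module.End.mul_apply, hk]⟩

theorem IsNil.add {X : Module.End K V} {v w : V} (hv : IsNil X v) (hw : IsNil X w) :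
    IsNil X (v + w) := by
  obtain ⟨k, hk⟩ := hv
  obtain ⟨l, hl⟩ := hw
  refine ⟨k + l, ?_⟩
  rw [map_add]
  nth_rewrite 1 [add_comm k l]
  rw [pow_add, pow_add, Module.End.mul_apply, Module.End.mul_apply, hk, hl]
  simp

theorem IsNil.smul {X : Module.End K V} {v : V} (r : K) (hv : IsNil X v) : IsNil X (r • v) := by
  obtain ⟨k, hk⟩ := hv
  exact ⟨k, by rw [map_smul, hk, smul_zero]⟩

/-- Local nilpotency is inherited by products, for operators that satisfy the Leibniz rule. -/
theorem IsNil.bilin {V₁ V₂ : Type*} [AddCommGroup V₁] [Module K V₁] [AddCommGroup V₂]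
    [Module K V₂] {X₁ : Module.End K V₁} {X₂ : Module.End K V₂} {X : Module.End K V}
    {B : V₁ →ₗ[K] V₂ →ₗ[K] V} (h : ∀ v w, X (B v w) = B (X₁ v) w + B v (X₂ w)) {v : V₁} {w : V₂}
    (hv : IsNil X₁ v) (hw : IsNil X₂ w) : IsNil X (B v w) := by
  obtain ⟨k, hk⟩ := hv
  obtain ⟨l, hl⟩ := hw
  obtain ⟨n, hn⟩ : ∃ n, n = k + l := ⟨_, rfl⟩
  induction n generalizing k l v w with
  | zero =>
    have : k = 0 := by omega
    subst this
    have : v = 0 := by simpa using hk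
    exact ⟨0, by simp [this]⟩
  | succ n ih =>
    refine IsNil.of_apply ?_
    rw [h]
    refine IsNil.add ?_ ?_
    · rcases k with _ | k
      · have : v = 0 := by simpa using hk
        exact ⟨0, by simp [this]⟩
      · exact ih k (by rwa [pow_succ, Module.End.mul_apply] at hk) l hl (by omega)
    · rcases l with _ | l
      · have : w = 0 := by simpa using hl
        exact ⟨0, by simp [this]⟩
      · exact ih k hk l (by rwa [pow_succ, Module.End.mul_apply] at hl) (by omega)

theorem pow_apply_weyl {X R : Module.End K V} {U : Submodule K V} (hX : ∀ u ∈ U, X u ∈ U)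
    {c : K} (hXR : ∀ u ∈ U, X (R u) = R (X u) + c • u) (k : ℕ) :
    ∀ u ∈ U, (X ^ (k + 1)) (R u) = R ((X ^ (k + 1)) u) + ((k + 1 : ℕ) * c) • (X ^ k) u := by
  induction k with
  | zero => intro u hu; simpa using hXR u hu
  | succ k ih =>
    intro u hu
    rw [pow_succ, Module.End.mul_apply, hXR u hu, map_add, ih _ (hX u hu), map_smul,
      ← Module.End.mul_apply (X ^ (k + 1)), ← pow_succ, ← Module.End.mul_apply (X ^ k), ← pow_succ,
      add_assoc, ← add_smul]
    congr 2
    push_cast; ring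

variable [CharZero K]

/-- A locally nilpotent operator `X` that forms a Weyl pair `[X, R] = c ≠ 0` is surjective. -/
theorem exists_apply_eq_of_weyl {X R : Module.End K V} {U : Submodule K V}
    (hX : ∀ u ∈ U, X u ∈ U) (hR : ∀ u ∈ U, R u ∈ U) {c : K} (hc : c ≠ 0)
    (hXR : ∀ u ∈ U, X (R u) = R (X u) + c • u) {u : V} (hu : u ∈ U) (hn : IsNil X u) :
    ∃ v ∈ U, X v = u := by
  obtain ⟨k, hk⟩ := hn
  induction k generalizing u with
  | zero => exact ⟨0, zero_mem _, by simpa using hk.symm⟩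
  | succ k ih =>
    -- Since `X ^ (k + 1)` kills `u`, this scalar makes `X ^ (k + 1)` send `a • R u` to `(X ^ k) u`.
    -- Subtracting `X (a • R u)` from `u` therefore lowers its nilpotency order.
    set a : K := ((k + 1 : ℕ) * c)⁻¹ with ha
    have hne : ((k + 1 : ℕ) : K) * c ≠ 0 := mul_ne_zero (Nat.cast_ne_zero.2 k.succ_ne_zero) hc
    obtain ⟨v, hv, hvu⟩ := ih (u := u - X (a • R u))
      (sub_mem hu (hX _ (U.smul_mem _ (hR u hu)))) (by
        rw [map_sub, ← Module.End.mul_apply, ← pow_succ, map_smul, pow_apply_weyl hX hXR k u hu, hk,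
          map_zero, zero_add, smul_smul, ha, inv_mul_cancel₀ hne, one_smul, sub_self])
    exact ⟨v + a • R u, add_mem hv (U.smul_mem _ (hR u hu)), by rw [map_add, hvu]; abel⟩

/-- If `X` is locally nilpotent and forms a Weyl pair with `R`, then a preimage of a vector
killed by `X'` under a map `φ` intertwining the operators can be chosen to be killed by `X`. -/
theorem exists_ker_lift_of_weyl {V' : Type*} [AddCommGroup V'] [Module K V'] {X R : Module.End K V}
    {X' R' : Module.End K V'} {φ : V →ₗ[K] V'} {U : Submodule K V}
    (hX : ∀ u ∈ U, X u ∈ U) (hR : ∀ u ∈ U, R u ∈ U) {c : K} (hc : c ≠ 0)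
    (hXR : ∀ u ∈ U, X (R u) = R (X u) + c • u) (hφX : ∀ u ∈ U, φ (X u) = X' (φ u))
    (hφR : ∀ u ∈ U, φ (R u) = R' (φ u)) {u : V} (hu : u ∈ U) (hn : IsNil X u)
    (h : X' (φ u) = 0) : ∃ v ∈ U, X v = 0 ∧ φ v = φ u := by
  obtain ⟨k, hk⟩ := hn
  induction k generalizing u with
  | zero => exact ⟨0, zero_mem _, by simp, by rw [show u = 0 by simpa using hk]⟩
  | succ k ih =>
    rcases k with _ | k
    · exact ⟨u, hu, by simpa using hk, rfl⟩
    -- Subtracting `a • R (X u)` leaves `φ u` unchanged because `X' (φ u) = 0`. As `X ^ (k + 2)`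
    -- kills `u`, the scalar makes `X ^ (k + 1)` take the same value on `a • R (X u)` as on `u`.
    set a : K := ((k + 1 : ℕ) * c)⁻¹ with ha
    have hne : ((k + 1 : ℕ) : K) * c ≠ 0 := mul_ne_zero (Nat.cast_ne_zero.2 k.succ_ne_zero) hc
    have hXu := hX u hu
    have hφ : φ (u - a • R (X u)) = φ u := by
      rw [map_sub, map_smul, hφR _ hXu, hφX _ hu, h, map_zero, smul_zero, sub_zero]
    obtain ⟨v, hv, hv0, hvu⟩ := ih (u := u - a • R (X u))
      (sub_mem hu (U.smul_mem _ (hR _ hXu))) (by rw [hφ, h]) (by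
        rw [map_sub, map_smul, pow_apply_weyl hX hXR k _ hXu, ← Module.End.mul_apply (X ^ (k + 1)),
          ← pow_succ, hk, map_zero, zero_add, ← Module.End.mul_apply (X ^ k), ← pow_succ,
          smul_smul, ha, inv_mul_cancel₀ hne, one_smul, sub_self])
    exact ⟨v, hv, hv0, hvu.trans hφ⟩

/-- If `V₀ ⊆ ker X` and `R V` span, for a locally nilpotent `X` with `[X, R] = 1`, then `V₀` is all
of the kernel. -/
theorem mem_of_weyl_ker {X R : Module.End K V} (hXR : ∀ u, X (R u) = R (X u) + u)
    {v v₀ u : V} (hX₀ : X v₀ = 0) (hn : IsNil X u) (hv : v = v₀ + R u) (hXv : X v = 0) :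
    v = v₀ := by
  have h1 : R (X u) + u = 0 := by rw [← hXR, ← hXv, hv, map_add, hX₀, zero_add]
  suffices u = 0 by rw [hv, this, map_zero, add_zero]
  obtain ⟨k, hk⟩ := hn
  induction k with
  | zero => simpa using hk
  | succ k ih =>
    refine ih ?_
    rcases k with _ | k
    · have h2 : X u = 0 := by simpa using hk
      rw [h2, map_zero, zero_add] at h1
      simpa using h1
    -- Moving `X ^ (k + 1)` past `R` in `R (X u) + u = 0` produces `k + 1` further copies of `X ^ (k
    -- + 1) u`, hence `(k + 2) • X ^ (k + 1) u = 0`.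
    have h2 := congrArg (X ^ (k + 1)) h1
    rw [map_add, pow_apply_weyl (U := ⊤) (c := 1) (fun _ _ => trivial)
        (fun u _ => by rw [hXR, one_smul]) k _ trivial,
      ← Module.End.mul_apply (X ^ (k + 1)), ← pow_succ, hk, map_zero, zero_add, ← Module.End.mul_apply (X ^ k),
      ← pow_succ, map_zero] at h2
    have h3 : (((k + 1 : ℕ) : K) * 1 + 1) • (X ^ (k + 1)) u = 0 := by rw [add_smul, one_smul, h2]
    refine (smul_eq_zero.1 h3).resolve_left ?_
    rw [mul_one, ← Nat.cast_succ]
    exact Nat.cast_ne_zero.2 (Nat.succ_ne_zero _)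

end Weyl

/-! ### Subspaces generated by two operators -/

section Closure

variable {K V : Type*} [Field K] [AddCommGroup V] [Module K V]

/-- The smallest submodule that contains `S` and is stable under two operators. -/
def stableSpan (R₁ R₂ : Module.End K V) (S : Submodule K V) : Submodule K V :=
  sInf {N | S ≤ N ∧ N ≤ N.comap R₁ ∧ N ≤ N.comap R₂}

variable {R₁ R₂ : Module.End K V} {S : Submodule K V}

theorem le_stableSpan : S ≤ stableSpan R₁ R₂ S := le_sInf fun _ h => h.1

theorem stableSpan_le {N : Submodule K V} (h : S ≤ N) (h₁ : ∀ v ∈ N, R₁ v ∈ N)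
    (h₂ : ∀ v ∈ N, R₂ v ∈ N) : stableSpan R₁ R₂ S ≤ N := sInf_le ⟨h, h₁, h₂⟩

theorem stableSpan_left {v : V} (hv : v ∈ stableSpan R₁ R₂ S) : R₁ v ∈ stableSpan R₁ R₂ S := by
  rw [stableSpan, Submodule.mem_sInf] at hv ⊢
  exact fun N hN => hN.2.1 (hv N hN)

theorem stableSpan_right {v : V} (hv : v ∈ stableSpan R₁ R₂ S) : R₂ v ∈ stableSpan R₁ R₂ S := by
  rw [stableSpan, Submodule.mem_sInf] at hv ⊢
  exact fun N hN => hN.2.2 (hv N hN)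

/-- For two commuting Weyl pairs with locally nilpotent `X₁, X₂`, a space generated by
`S ⊆ ker X₁ ∩ ker X₂` under `R₁, R₂` has `ker X₁ ∩ ker X₂ = S`. -/
theorem mem_of_stableSpan_eq_top [CharZero K] {X₁ X₂ : Module.End K V}
    (h₁₁ : ∀ u, X₁ (R₁ u) = R₁ (X₁ u) + u) (h₂₂ : ∀ u, X₂ (R₂ u) = R₂ (X₂ u) + u)
    (h₁₂ : ∀ u, X₁ (R₂ u) = R₂ (X₁ u)) (hR : ∀ u, R₁ (R₂ u) = R₂ (R₁ u))
    (hn₁ : ∀ u, IsNil X₁ u) (hn₂ : ∀ u, IsNil X₂ u)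
    (hS₁ : ∀ s ∈ S, X₁ s = 0) (hS₂ : ∀ s ∈ S, X₂ s = 0) (htop : stableSpan R₁ R₂ S = ⊤) {v : V}
    (hv₁ : X₁ v = 0) (hv₂ : X₂ v = 0) : v ∈ S := by
  -- With `R₂` in both slots, this is the closure of `S` under `R₂` alone. The argument strips off
  -- `R₁` first and then `R₂`.
  have hT₁ : stableSpan R₂ R₂ S ≤ ker X₁ := stableSpan_le hS₁
    (fun v hv => by rw [mem_ker, h₁₂, hv, map_zero]) (fun v hv => by rw [mem_ker, h₁₂, hv, map_zero])
  have h1 : ⊤ ≤ stableSpan R₂ R₂ S ⊔ range R₁ := by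
    rw [← htop]
    refine stableSpan_le (le_stableSpan.trans le_sup_left)
      (fun v _ => Submodule.mem_sup_right ⟨v, rfl⟩) ?_
    intro v hv
    obtain ⟨a, ha, _, ⟨b, rfl⟩, rfl⟩ := Submodule.mem_sup.1 hv
    rw [map_add, ← hR]
    exact add_mem (Submodule.mem_sup_left (stableSpan_left ha))
      (Submodule.mem_sup_right ⟨_, rfl⟩)
  obtain ⟨v₀, hv₀, _, ⟨b, rfl⟩, rfl⟩ := Submodule.mem_sup.1 (h1 (Submodule.mem_top (x := v)))
  have h2 := mem_of_weyl_ker h₁₁ (hT₁ hv₀) (hn₁ b) rfl hv₁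
  rw [h2] at hv₂ ⊢
  have h3 : stableSpan R₂ R₂ S ≤ S ⊔ range R₂ :=
    stableSpan_le le_sup_left (fun v _ => Submodule.mem_sup_right ⟨v, rfl⟩)
      (fun v _ => Submodule.mem_sup_right ⟨v, rfl⟩)
  obtain ⟨s, hs, _, ⟨c, rfl⟩, h4⟩ := Submodule.mem_sup.1 (h3 hv₀)
  rwa [mem_of_weyl_ker h₂₂ (hS₂ s hs) (hn₂ c) h4.symm hv₂]

end Closure

end LinearMap

/-! ### Derivations of Chevalley-Eilenberg chains -/

namespace DGLie

open LinearMap (IsNil eigSum)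

section ChainDer

variable {K L₀ L₁ : Type*} [Field K] [AddCommGroup L₀] [Module K L₀]
  [AddCommGroup L₁] [Module K L₁]

variable (K L₀ L₁) in
/-- The unit chain. -/
def unitChain : Chains K L₀ L₁ := 1 ⊗ₜ[K] 1

/-- The unit chain generates all chains under multiplication by elements of `L₀` and `L₁`.
Identities between operators on chains are proved below by taking `N` to be a kernel or an
equaliser. -/
theorem chains_le {N : Submodule K (Chains K L₀ L₁)} (h1 : unitChain K L₀ L₁ ∈ N)
    (hw : ∀ a, ∀ c ∈ N, wedge K a c ∈ N) (hm : ∀ m, ∀ c ∈ N, mulSym K m c ∈ N)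
    (c : Chains K L₀ L₁) : c ∈ N := by
  refine chains_induction K (fun s => ?_) (fun x y => add_mem) (fun a x => hw a x) c
  have : ∀ s t : SymmetricAlgebra K L₁, (1 : ExteriorAlgebra K L₀) ⊗ₜ[K] t ∈ N →
      (1 : ExteriorAlgebra K L₀) ⊗ₜ[K] (s * t) ∈ N := by
    intro s
    induction s using SymmetricAlgebra.induction with
    | algebraMap r =>
      intro t ht
      rw [← Algebra.smul_def, TensorProduct.tmul_smul]
      exact N.smul_mem r ht
    | ι m => intro t ht; simpa using hm m _ ht
    | mul a b ha hb => intro t ht; rw [mul_assoc]; exact ha _ (hb _ ht)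
    | add a b ha hb => intro t ht; rw [add_mul, TensorProduct.tmul_add]; exact add_mem (ha t ht) (hb t ht)
  simpa using this s 1 h1

theorem unitChain_mem : unitChain K L₀ L₁ ∈ chainsOfDegree K L₀ L₁ 0 :=
  Submodule.apply_mem_map₂ _
    (by rw [ExteriorAlgebra.exteriorPower, pow_zero]; exact Submodule.one_le.1 le_rfl) trivial

theorem wedge_mem {n : ℕ} (a : L₀) {c : Chains K L₀ L₁} (hc : c ∈ chainsOfDegree K L₀ L₁ n) :
    wedge K a c ∈ chainsOfDegree K L₀ L₁ (n + 1) := by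
  refine Submodule.map₂_le (r := (chainsOfDegree K L₀ L₁ (n + 1)).comap (wedge K a)) |>.2 ?_ hc
  intro x hx s _
  rw [Submodule.mem_comap, TensorProduct.mk_apply, wedge_tmul]
  refine Submodule.apply_mem_map₂ _ ?_ trivial
  rw [ExteriorAlgebra.exteriorPower, pow_succ']
  exact Submodule.mul_mem_mul ⟨a, rfl⟩ hx

theorem mulSym_mem {n : ℕ} (m : L₁) {c : Chains K L₀ L₁} (hc : c ∈ chainsOfDegree K L₀ L₁ n) :
    mulSym K m c ∈ chainsOfDegree K L₀ L₁ n := by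
  refine Submodule.map₂_le (r := (chainsOfDegree K L₀ L₁ n).comap (mulSym K m)) |>.2 ?_ hc
  intro x hx s _
  rw [Submodule.mem_comap, TensorProduct.mk_apply, mulSym_tmul]
  exact Submodule.apply_mem_map₂ _ hx trivial

theorem chainsOfDegree_succ_le {n : ℕ} {N : Submodule K (Chains K L₀ L₁)}
    (h : ∀ a, ∀ c ∈ chainsOfDegree K L₀ L₁ n, wedge K a c ∈ N) :
    chainsOfDegree K L₀ L₁ (n + 1) ≤ N := by
  refine Submodule.map₂_le.2 ?_
  intro x hx s _
  rw [ExteriorAlgebra.exteriorPower, pow_succ'] at hx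
  induction hx using Submodule.mul_induction_on' with
  | mem_mul_mem y hy x hx =>
    obtain ⟨a, rfl⟩ := hy
    rw [TensorProduct.mk_apply, ← wedge_tmul]
    exact h a _ (Submodule.apply_mem_map₂ _ hx trivial)
  | add x _ y _ hx hy => rw [map_add]; exact N.add_mem hx hy

theorem exists_eq_one_tmul {c : Chains K L₀ L₁} (hc : c ∈ chainsOfDegree K L₀ L₁ 0) :
    ∃ s : SymmetricAlgebra K L₁, c = 1 ⊗ₜ[K] s := by
  refine Submodule.map₂_le (r := LinearMap.range
    (TensorProduct.mk K (ExteriorAlgebra K L₀) (SymmetricAlgebra K L₁) 1)) |>.2 ?_ hc |>.imp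
      fun s hs => hs.symm
  intro x hx s _
  rw [ExteriorAlgebra.exteriorPower, pow_zero, Submodule.mem_one] at hx
  obtain ⟨r, rfl⟩ := hx
  exact ⟨r • s, by simp [Algebra.algebraMap_eq_smul_one]⟩

theorem chainsOfDegree_zero_le {N : Submodule K (Chains K L₀ L₁)} (h1 : unitChain K L₀ L₁ ∈ N)
    (hm : ∀ m, ∀ c ∈ chainsOfDegree K L₀ L₁ 0, c ∈ N → mulSym K m c ∈ N) :
    chainsOfDegree K L₀ L₁ 0 ≤ N := by
  intro c hc
  obtain ⟨s, rfl⟩ := exists_eq_one_tmul hc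
  have : ∀ s t : SymmetricAlgebra K L₁,
      (1 : ExteriorAlgebra K L₀) ⊗ₜ[K] t ∈ N ⊓ chainsOfDegree K L₀ L₁ 0 →
      (1 : ExteriorAlgebra K L₀) ⊗ₜ[K] (s * t) ∈ N ⊓ chainsOfDegree K L₀ L₁ 0 := by
    intro s
    induction s using SymmetricAlgebra.induction with
    | algebraMap r =>
      intro t ht
      rw [← Algebra.smul_def, TensorProduct.tmul_smul]
      exact Submodule.smul_mem _ r ht
    | ι m =>
      intro t ht
      have := mulSym_tmul K m (1 : ExteriorAlgebra K L₀) t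
      rw [← this]
      exact ⟨hm m _ ht.2 ht.1, mulSym_mem m ht.2⟩
    | mul a b ha hb => intro t ht; rw [mul_assoc]; exact ha _ (hb _ ht)
    | add a b ha hb => intro t ht; rw [add_mul, TensorProduct.tmul_add]; exact add_mem (ha t ht) (hb t ht)
  simpa using (this s 1 ⟨h1, unitChain_mem⟩).1

/-- The derivation of the algebra of chains that extends endomorphisms of `L₀` and `L₁`. -/
def chainDer (φ₀ : Module.End K L₀) (φ₁ : Module.End K L₁) : Module.End K (Chains K L₀ L₁) :=
  (extDer φ₀).rTensor _ + ((symDer φ₁).toLinearMap).lTensor _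

theorem chainDer_tmul (φ₀ : Module.End K L₀) (φ₁ : Module.End K L₁) (x : ExteriorAlgebra K L₀)
    (s : SymmetricAlgebra K L₁) :
    chainDer φ₀ φ₁ (x ⊗ₜ[K] s) = extDer φ₀ x ⊗ₜ[K] s + x ⊗ₜ[K] symDer φ₁ s := by
  simp [chainDer]

variable {φ₀ ψ₀ χ₀ : Module.End K L₀} {φ₁ ψ₁ χ₁ : Module.End K L₁}

theorem chainDer_wedge (b : L₀) (c : Chains K L₀ L₁) :
    chainDer φ₀ φ₁ (wedge K b c) = wedge K (φ₀ b) c + wedge K b (chainDer φ₀ φ₁ c) := by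
  induction c using TensorProduct.induction_on with
  | zero => simp
  | tmul x s => simp [chainDer_tmul, TensorProduct.add_tmul]; abel
  | add x y hx hy => simp only [map_add, hx, hy]; abel

theorem chainDer_mulSym (m : L₁) (c : Chains K L₀ L₁) :
    chainDer φ₀ φ₁ (mulSym K m c) = mulSym K (φ₁ m) c + mulSym K m (chainDer φ₀ φ₁ c) := by
  induction c using TensorProduct.induction_on with
  | zero => simp
  | tmul x s => simp [chainDer_tmul, TensorProduct.tmul_add, mul_comm]; abel
  | add x y hx hy => simp only [map_add, hx, hy]; abel

theorem chainDer_unitChain : chainDer φ₀ φ₁ (unitChain K L₀ L₁) = 0 := by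
  simp [unitChain, chainDer_tmul]

theorem mulSym_comm (m m' : L₁) (c : Chains K L₀ L₁) :
    mulSym K m (mulSym K m' c) = mulSym K m' (mulSym K m c) := by
  induction c using TensorProduct.induction_on with
  | zero => simp
  | tmul x s => simp [mul_left_comm]
  | add x y hx hy => simp only [map_add, hx, hy]

/-- A commutator of derivations is a derivation, so it is determined by its values `χ₀`, `χ₁` on the
generators. No compatibility with the Lie bracket is involved. -/
theorem chainDer_comm (h₀ : ∀ a, φ₀ (ψ₀ a) = ψ₀ (φ₀ a) + χ₀ a)
    (h₁ : ∀ m, φ₁ (ψ₁ m) = ψ₁ (φ₁ m) + χ₁ m) (c : Chains K L₀ L₁) :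
    chainDer φ₀ φ₁ (chainDer ψ₀ ψ₁ c) = chainDer ψ₀ ψ₁ (chainDer φ₀ φ₁ c) + chainDer χ₀ χ₁ c := by
  have key := chains_le (N := LinearMap.eqLocus (chainDer φ₀ φ₁ ∘ₗ chainDer ψ₀ ψ₁)
    (chainDer ψ₀ ψ₁ ∘ₗ chainDer φ₀ φ₁ + chainDer χ₀ χ₁)) ?_ ?_ ?_ c
  · simpa using key
  · simp [chainDer_unitChain]
  · intro a c hc
    simp only [LinearMap.mem_eqLocus, LinearMap.comp_apply, LinearMap.add_apply] at hc ⊢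
    simp only [chainDer_wedge, map_add, h₀, hc, LinearMap.add_apply]
    abel
  · intro a c hc
    simp only [LinearMap.mem_eqLocus, LinearMap.comp_apply, LinearMap.add_apply] at hc ⊢
    simp only [chainDer_mulSym, map_add, h₁, hc, LinearMap.add_apply]
    abel

theorem chainDer_zero : chainDer (0 : Module.End K L₀) (0 : Module.End K L₁) = 0 := by
  refine LinearMap.ext fun c => chains_le (N := LinearMap.ker (chainDer 0 0)) ?_ ?_ ?_ c
  · exact chainDer_unitChain
  · intro a c hc
    rw [LinearMap.mem_ker] at hc ⊢
    simp [chainDer_wedge, hc]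
  · intro a c hc
    rw [LinearMap.mem_ker] at hc ⊢
    simp [chainDer_mulSym, hc]

theorem chainDer_comm_zero (h₀ : ∀ a, φ₀ (ψ₀ a) = ψ₀ (φ₀ a))
    (h₁ : ∀ m, φ₁ (ψ₁ m) = ψ₁ (φ₁ m)) (c : Chains K L₀ L₁) :
    chainDer φ₀ φ₁ (chainDer ψ₀ ψ₁ c) = chainDer ψ₀ ψ₁ (chainDer φ₀ φ₁ c) := by
  rw [chainDer_comm (χ₀ := 0) (χ₁ := 0) (by simpa using h₀) (by simpa using h₁), chainDer_zero]
  simp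

theorem chainDer_mem {n : ℕ} {c : Chains K L₀ L₁} (hc : c ∈ chainsOfDegree K L₀ L₁ n) :
    chainDer φ₀ φ₁ c ∈ chainsOfDegree K L₀ L₁ n := by
  induction n generalizing c with
  | zero =>
    refine chainsOfDegree_zero_le (N := (chainsOfDegree K L₀ L₁ 0).comap (chainDer φ₀ φ₁)) ?_ ?_ hc
    · rw [Submodule.mem_comap, chainDer_unitChain]; exact zero_mem _
    · intro m c hc h
      rw [Submodule.mem_comap, chainDer_mulSym]
      exact add_mem (mulSym_mem _ hc) (mulSym_mem _ h)
  | succ n ih =>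
    refine chainsOfDegree_succ_le (N := (chainsOfDegree K L₀ L₁ (n + 1)).comap (chainDer φ₀ φ₁))
      (fun a c hc => ?_) hc
    rw [Submodule.mem_comap, chainDer_wedge]
    exact add_mem (wedge_mem _ hc) (wedge_mem _ (ih hc))

theorem isNil_chainDer (h₀ : ∀ a, IsNil φ₀ a) (h₁ : ∀ m, IsNil φ₁ m) (c : Chains K L₀ L₁) :
    IsNil (chainDer φ₀ φ₁) c := by
  refine chains_le (N := { carrier := {c | IsNil (chainDer φ₀ φ₁) c}
                           add_mem' := fun h h' => h.add h'
                           zero_mem' := ⟨0, by simp⟩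
                           smul_mem' := fun r _ h => h.smul r }) ?_ ?_ ?_ c
  · exact IsNil.of_apply_eq_zero chainDer_unitChain
  · exact fun a c hc => IsNil.bilin (B := wedge K) chainDer_wedge (h₀ a) hc
  · exact fun a c hc => IsNil.bilin (B := mulSym K) chainDer_mulSym (h₁ a) hc

/-- The relation says that `g` is homogeneous of degree `ν` for the grading by eigenvalues of `f`.
-/
theorem map_mem_eigSum {V : Type*} [AddCommGroup V] [Module K V] {f g : Module.End K V} {ν : K}
    (h : ∀ v, f (g v) = ν • g v + g (f v)) {A B : Set K} (hAB : ∀ μ ∈ A, ν + μ ∈ B) {v : V}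
    (hv : v ∈ eigSum f A) : g v ∈ eigSum f B := by
  refine LinearMap.eigSum_le (N := (eigSum f B).comap g) (fun μ hμ v hv => ?_) hv
  refine LinearMap.mem_eigSum (hAB μ hμ) ?_
  rw [h, hv, map_smul, add_smul]

theorem wedge_mem_eigSum {a : L₀} {ν : K} (ha : φ₀ a = ν • a) {A B : Set K}
    (hAB : ∀ μ ∈ A, ν + μ ∈ B) {c : Chains K L₀ L₁} (hc : c ∈ eigSum (chainDer φ₀ φ₁) A) :
    wedge K a c ∈ eigSum (chainDer φ₀ φ₁) B :=
  map_mem_eigSum (fun v => by rw [chainDer_wedge, ha, map_smul, LinearMap.smul_apply]) hAB hc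

theorem mulSym_mem_eigSum {m : L₁} {ν : K} (hm : φ₁ m = ν • m) {A B : Set K}
    (hAB : ∀ μ ∈ A, ν + μ ∈ B) {c : Chains K L₀ L₁} (hc : c ∈ eigSum (chainDer φ₀ φ₁) A) :
    mulSym K m c ∈ eigSum (chainDer φ₀ φ₁) B :=
  map_mem_eigSum (fun v => by rw [chainDer_mulSym, hm, map_smul, LinearMap.smul_apply]) hAB hc

theorem unitChain_mem_eigSum {A : Set K} (h : (0 : K) ∈ A) :
    unitChain K L₀ L₁ ∈ eigSum (chainDer φ₀ φ₁) A :=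
  LinearMap.mem_eigSum h (by rw [chainDer_unitChain, zero_smul])

theorem mem_eigSum_chainDer_of_degree_zero (h₁ : ∀ m, m ∈ eigSum φ₁ Set.univ)
    {c : Chains K L₀ L₁} (hc : c ∈ chainsOfDegree K L₀ L₁ 0) :
    c ∈ eigSum (chainDer φ₀ φ₁) Set.univ := by
  refine chainsOfDegree_zero_le (N := eigSum (chainDer φ₀ φ₁) Set.univ)
    (unitChain_mem_eigSum (Set.mem_univ _)) (fun m c _ hc => ?_) hc
  refine LinearMap.eigSum_le (N := (eigSum (chainDer φ₀ φ₁) Set.univ).comap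
    ((mulSym K).flip c)) (fun ν _ m hm => ?_) (h₁ m)
  exact mulSym_mem_eigSum hm (fun _ _ => Set.mem_univ _) hc

variable (K L₀ L₁) in
/-- The operator that counts the number of factors from `L₁`. -/
def symCount : Module.End K (Chains K L₀ L₁) := chainDer 0 1

variable (K L₀ L₁) in
/-- The operator that counts the number of factors. -/
def weight : Module.End K (Chains K L₀ L₁) := chainDer 1 1

theorem mem_eigSum_symCount (c : Chains K L₀ L₁) :
    c ∈ eigSum (symCount K L₀ L₁) (Set.range ((↑) : ℕ → K)) := by
  refine chains_le (N := eigSum (symCount K L₀ L₁) (Set.range ((↑) : ℕ → K)))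
    (unitChain_mem_eigSum ⟨0, by simp⟩) (fun a c hc => ?_) (fun m c hc => ?_) c
  · exact wedge_mem_eigSum (ν := 0) (by simp) (by simp) hc
  · refine mulSym_mem_eigSum (ν := 1) (by simp) ?_ hc
    rintro _ ⟨n, rfl⟩
    exact ⟨n + 1, by push_cast; ring⟩

theorem mem_eigSum_weight (c : Chains K L₀ L₁) : c ∈ eigSum (weight K L₀ L₁) Set.univ := by
  refine chains_le (N := eigSum (weight K L₀ L₁) Set.univ)
    (unitChain_mem_eigSum (Set.mem_univ _)) (fun a c hc => ?_) (fun m c hc => ?_) c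
  · exact wedge_mem_eigSum (ν := 1) (by simp) (by simp) hc
  · exact mulSym_mem_eigSum (ν := 1) (by simp) (by simp) hc

/-- A chain of degree `n` has exactly `n` factors from `L₀`. In particular the eigenvalues of
`weight` are nonzero in positive degree, even on chains without factors from `L₁`. -/
theorem weight_apply {n : ℕ} {c : Chains K L₀ L₁} (hc : c ∈ chainsOfDegree K L₀ L₁ n) :
    weight K L₀ L₁ c = (n : K) • c + symCount K L₀ L₁ c := by
  induction n generalizing c with
  | zero =>
    have := chainsOfDegree_zero_le (N := LinearMap.eqLocus (weight K L₀ L₁) (symCount K L₀ L₁))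
      (by simp [weight, symCount, chainDer_unitChain]) (fun m c _ h => by
        rw [LinearMap.mem_eqLocus] at h ⊢
        rw [weight, symCount] at *
        rw [chainDer_mulSym, chainDer_mulSym, h]) hc
    rw [Nat.cast_zero, zero_smul, zero_add]
    exact this
  | succ n ih =>
    refine chainsOfDegree_succ_le (N := LinearMap.eqLocus (weight K L₀ L₁)
      (((n + 1 : ℕ) : K) • LinearMap.id + symCount K L₀ L₁)) (fun a c hc => ?_) hc
    have := ih hc
    rw [LinearMap.mem_eqLocus]
    simp only [weight, symCount, LinearMap.add_apply, LinearMap.smul_apply,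
      LinearMap.id_apply] at this ⊢
    rw [chainDer_wedge, chainDer_wedge, this]
    simp only [Module.End.one_apply, map_add, map_smul, LinearMap.zero_apply, map_zero, zero_add]
    push_cast
    module

theorem chainDer_weight_comm (c : Chains K L₀ L₁) :
    weight K L₀ L₁ (chainDer φ₀ φ₁ c) = chainDer φ₀ φ₁ (weight K L₀ L₁ c) :=
  chainDer_comm_zero (by simp) (by simp) c

theorem chainDer_symCount_comm (c : Chains K L₀ L₁) :
    symCount K L₀ L₁ (chainDer φ₀ φ₁ c) = chainDer φ₀ φ₁ (symCount K L₀ L₁ c) :=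
  chainDer_comm_zero (by simp) (by simp) c

/-- The commutator is the derivation that extends the identity. The Weyl relation thus survives on
chains, with the number of factors in place of the constant 1. -/
theorem chainDer_weyl (h₀ : ∀ a, φ₀ (ψ₀ a) = ψ₀ (φ₀ a) + a)
    (h₁ : ∀ m, φ₁ (ψ₁ m) = ψ₁ (φ₁ m) + m) (c : Chains K L₀ L₁) :
    chainDer φ₀ φ₁ (chainDer ψ₀ ψ₁ c) = chainDer ψ₀ ψ₁ (chainDer φ₀ φ₁ c) + weight K L₀ L₁ c :=
  chainDer_comm (by simpa using h₀) (by simpa using h₁) c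

/-- A Weyl pair on `L₀` and `L₁` makes the first operator surjective on chains of positive degree,
and on those killed by a third operator that commutes with the pair. -/
theorem exists_chainDer_eq [CharZero K] (h₀ : ∀ a, φ₀ (ψ₀ a) = ψ₀ (φ₀ a) + a)
    (h₁ : ∀ m, φ₁ (ψ₁ m) = ψ₁ (φ₁ m) + m) (hn₀ : ∀ a, IsNil φ₀ a) (hn₁ : ∀ m, IsNil φ₁ m)
    (hφ₀ : ∀ a, χ₀ (φ₀ a) = φ₀ (χ₀ a)) (hφ₁ : ∀ m, χ₁ (φ₁ m) = φ₁ (χ₁ m))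
    (hψ₀ : ∀ a, χ₀ (ψ₀ a) = ψ₀ (χ₀ a)) (hψ₁ : ∀ m, χ₁ (ψ₁ m) = ψ₁ (χ₁ m)) {n : ℕ}
    {c : Chains K L₀ L₁} (hc : c ∈ chainsOfDegree K L₀ L₁ (n + 1)) (hχ : chainDer χ₀ χ₁ c = 0) :
    ∃ b ∈ chainsOfDegree K L₀ L₁ (n + 1), chainDer χ₀ χ₁ b = 0 ∧ chainDer φ₀ φ₁ b = c := by
  set U := chainsOfDegree K L₀ L₁ (n + 1) ⊓ LinearMap.ker (chainDer χ₀ χ₁) with hU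
  have key : U ⊓ eigSum (symCount K L₀ L₁) (Set.range ((↑) : ℕ → K)) ≤
      U.map (chainDer φ₀ φ₁) := by
    refine LinearMap.inf_eigSum_le ?_ ?_
    · rintro v ⟨hv, hv'⟩
      refine ⟨chainDer_mem hv, ?_⟩
      rw [SetLike.mem_coe, LinearMap.mem_ker] at hv' ⊢
      rw [← chainDer_symCount_comm, hv', map_zero]
    · rintro _ ⟨k, rfl⟩ v hv hvk
      -- Fixing the number `k` of factors from `L₁` makes the weight operator the scalar `n + 1 +
      -- k`, which is the nonzero constant of a Weyl pair on `U'`.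
      set U' := U ⊓ LinearMap.ker (symCount K L₀ L₁ - (k : K) • LinearMap.id) with hU'
      have hmem : ∀ u, u ∈ U' ↔ (u ∈ chainsOfDegree K L₀ L₁ (n + 1) ∧ chainDer χ₀ χ₁ u = 0) ∧
          symCount K L₀ L₁ u = (k : K) • u := by
        intro u
        simp [hU', hU, Submodule.mem_inf, sub_eq_zero]
      have hne : ((n + 1 : ℕ) : K) + k ≠ 0 := by
        rw [← Nat.cast_add]; exact Nat.cast_ne_zero.2 (by omega)
      have hU₁ : ∀ u ∈ U', chainDer φ₀ φ₁ u ∈ U' := by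
        intro u hu
        rw [hmem] at hu ⊢
        refine ⟨⟨chainDer_mem hu.1.1, ?_⟩, ?_⟩
        · rw [chainDer_comm_zero hφ₀ hφ₁, hu.1.2, map_zero]
        · rw [chainDer_symCount_comm, hu.2, map_smul]
      have hU₂ : ∀ u ∈ U', chainDer ψ₀ ψ₁ u ∈ U' := by
        intro u hu
        rw [hmem] at hu ⊢
        refine ⟨⟨chainDer_mem hu.1.1, ?_⟩, ?_⟩
        · rw [chainDer_comm_zero hψ₀ hψ₁, hu.1.2, map_zero]
        · rw [chainDer_symCount_comm, hu.2, map_smul]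
      obtain ⟨b, hb, hbv⟩ := LinearMap.exists_apply_eq_of_weyl hU₁ hU₂ hne (fun u hu => by
        rw [hmem] at hu
        rw [chainDer_weyl h₀ h₁, weight_apply hu.1.1, hu.2, ← add_smul])
        ((hmem v).2 ⟨⟨hv.1, hv.2⟩, hvk⟩) (isNil_chainDer hn₀ hn₁ v)
      exact ⟨b, hb.1, hbv⟩
  obtain ⟨b, hb, hbc⟩ := key ⟨⟨hc, hχ⟩, mem_eigSum_symCount c⟩
  exact ⟨b, hb.1, hb.2, hbc⟩

end ChainDer

/-! ### The bracket and internal parts of the differential -/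

section Differential

variable {K L₀ L₁ : Type*} [Field K] [LieRing L₀] [LieAlgebra K L₀]
  [AddCommGroup L₁] [Module K L₁] [LieRingModule L₀ L₁] [LieModule K L₀ L₁] {δ : L₀ →ₗ[K] L₁}

theorem ad_eq_chainDer (a : L₀) : ad K (L₁ := L₁) a =
    chainDer (LieModule.toEnd K L₀ L₀ a) (LieModule.toEnd K L₀ L₁ a) := rfl

theorem ad_mem {n : ℕ} (a : L₀) {c : Chains K L₀ L₁} (hc : c ∈ chainsOfDegree K L₀ L₁ n) :
    ad K a c ∈ chainsOfDegree K L₀ L₁ n := chainDer_mem hc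

theorem diff_eq_zero {c : Chains K L₀ L₁} (hc : c ∈ chainsOfDegree K L₀ L₁ 0) :
    diff K δ c = 0 := by
  obtain ⟨s, rfl⟩ := exists_eq_one_tmul hc
  exact diff_one_tmul K δ s

theorem diff_wedge_of_degree_zero (a : L₀) {c : Chains K L₀ L₁}
    (hc : c ∈ chainsOfDegree K L₀ L₁ 0) :
    diff K δ (wedge K a c) = ad K a c + mulSym K (δ a) c := by
  rw [diff_wedge, diff_eq_zero hc, map_zero, sub_zero]

theorem diff_ad_comm (hδ : ∀ a b : L₀, δ ⁅a, b⁆ = ⁅a, δ b⁆ - ⁅b, δ a⁆) {a : L₀} (ha : δ a = 0)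
    (c : Chains K L₀ L₁) : diff K δ (ad K a c) = ad K a (diff K δ c) := by
  have := diff_ad K δ hδ a c
  rw [ha, map_zero, LinearMap.zero_apply, LinearMap.zero_apply, map_zero, sub_zero, add_zero,
    sub_eq_zero] at this
  exact this

variable (δ) in
/-- The part of the differential that comes from the internal differential. -/
def internalDiff : Module.End K (Chains K L₀ L₁) := diff K δ - diff K 0

theorem internalDiff_eq_zero {c : Chains K L₀ L₁} (hc : c ∈ chainsOfDegree K L₀ L₁ 0) :
    internalDiff δ c = 0 := by
  rw [internalDiff, LinearMap.sub_apply, diff_eq_zero hc, diff_eq_zero hc, sub_zero]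

theorem internalDiff_wedge (a : L₀) (c : Chains K L₀ L₁) :
    internalDiff δ (wedge K a c) = mulSym K (δ a) c - wedge K a (internalDiff δ c) := by
  simp only [internalDiff, LinearMap.sub_apply, diff_wedge, LinearMap.zero_apply, map_zero,
    add_zero, map_sub]
  abel

theorem diff_eq_add (c : Chains K L₀ L₁) : diff K δ c = diff K 0 c + internalDiff δ c := by
  simp [internalDiff]

/-- The bracket terms cancel in `internalDiff`, so commuting with `δ` is enough. This allows
operators such as right multiplication by ∂ᵢ, which are not derivations of the bracket. -/
theorem internalDiff_chainDer {φ₀ : Module.End K L₀} {φ₁ : Module.End K L₁}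
    (h : ∀ a, φ₁ (δ a) = δ (φ₀ a)) {n : ℕ} {c : Chains K L₀ L₁}
    (hc : c ∈ chainsOfDegree K L₀ L₁ n) :
    internalDiff δ (chainDer φ₀ φ₁ c) = chainDer φ₀ φ₁ (internalDiff δ c) := by
  induction n generalizing c with
  | zero => rw [internalDiff_eq_zero hc, internalDiff_eq_zero (chainDer_mem hc), map_zero]
  | succ n ih =>
    refine chainsOfDegree_succ_le (N := LinearMap.eqLocus (internalDiff δ ∘ₗ chainDer φ₀ φ₁)
      (chainDer φ₀ φ₁ ∘ₗ internalDiff δ)) (fun a c hc => ?_) hc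
    simp only [LinearMap.mem_eqLocus, LinearMap.comp_apply]
    rw [chainDer_wedge, map_add, internalDiff_wedge, internalDiff_wedge, internalDiff_wedge,
      map_sub, chainDer_mulSym, chainDer_wedge, ih hc, h]
    abel

theorem internalDiff_mulSym_wedge (m : L₁) (a : L₀) {c : Chains K L₀ L₁}
    (hc : c ∈ chainsOfDegree K L₀ L₁ 0) :
    internalDiff δ (mulSym K m (wedge K a c)) = mulSym K m (internalDiff δ (wedge K a c)) := by
  rw [← wedge_mulSym, internalDiff_wedge, internalDiff_wedge, internalDiff_eq_zero hc,
    internalDiff_eq_zero (mulSym_mem m hc), map_zero, sub_zero, sub_zero, mulSym_comm]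

/-- The bracket merges two factors into one and so lowers the weight by one, while the internal
differential preserves it (`internalDiff_weight`). The induction on weight in
`IsEuler.exists_sub_mulSym_mem` rests on this contrast. -/
theorem weight_diff_zero {n : ℕ} {c : Chains K L₀ L₁} (hc : c ∈ chainsOfDegree K L₀ L₁ n) :
    weight K L₀ L₁ (diff K 0 c) = diff K 0 (weight K L₀ L₁ c) - diff K 0 c := by
  induction n generalizing c with
  | zero =>
    rw [diff_eq_zero hc, diff_eq_zero (c := weight K L₀ L₁ c) (chainDer_mem hc), map_zero, sub_zero]
  | succ n ih =>
    refine chainsOfDegree_succ_le (N := LinearMap.eqLocus (weight K L₀ L₁ ∘ₗ diff K 0)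
      (diff K 0 ∘ₗ weight K L₀ L₁ - diff K 0)) (fun a c hc => ?_) hc
    have h := ih hc
    have hw : ∀ a (c : Chains K L₀ L₁), weight K L₀ L₁ (wedge K a c) =
      wedge K a c + wedge K a (weight K L₀ L₁ c) := fun a c => chainDer_wedge a c
    simp only [LinearMap.mem_eqLocus, LinearMap.comp_apply, LinearMap.sub_apply]
    rw [hw, map_add]
    simp only [diff_wedge, LinearMap.zero_apply, map_zero, add_zero, map_sub, hw, h,
      ad_eq_chainDer, chainDer_weight_comm]
    abel

end Differential

end DGLie

/-! ### Degree two hyperhomology in the presence of Weyl pairs and an Euler element -/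

namespace DGLie

open LinearMap (IsNil eigSum)

/-! ### Linear parts of symmetric and exterior algebras -/

section Linear

variable {K M : Type*} [Field K] [AddCommGroup M] [Module K M]

/-- The projection of the symmetric algebra to its linear part. -/
def symProj : SymmetricAlgebra K M →ₗ[K] M :=
  -- In the square-zero extension `K ⊕ M` products of two elements of `M` vanish, so lifting the
  -- inclusion of `M` discards all degrees above one. The right action is chosen equal to the left
  -- one so that the extension is a commutative algebra.
  letI : Module Kᵐᵒᵖ M := Module.compHom _ ((RingHom.id K).fromOpposite mul_comm)
  haveI : IsCentralScalar K M := ⟨fun _ _ => rfl⟩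
  TrivSqZeroExt.sndHom K M ∘ₗ
    (SymmetricAlgebra.lift (TrivSqZeroExt.inrHom K M : M →ₗ[K] TrivSqZeroExt K M)).toLinearMap

theorem symProj_one : symProj (1 : SymmetricAlgebra K M) = 0 := by
  let : Module Kᵐᵒᵖ M := Module.compHom _ ((RingHom.id K).fromOpposite mul_comm)
  have : IsCentralScalar K M := ⟨fun _ _ => rfl⟩
  simp [symProj]

theorem symProj_ι_mul (m : M) (s : SymmetricAlgebra K M) :
    symProj (SymmetricAlgebra.ι K M m * s) = SymmetricAlgebra.algebraMapInv s • m := by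
  let : Module Kᵐᵒᵖ M := Module.compHom _ ((RingHom.id K).fromOpposite mul_comm)
  have : IsCentralScalar K M := ⟨fun _ _ => rfl⟩
  have h : (TrivSqZeroExt.fstHom K K M).comp
      (SymmetricAlgebra.lift (TrivSqZeroExt.inrHom K M : M →ₗ[K] TrivSqZeroExt K M)) =
      SymmetricAlgebra.algebraMapInv := by
    apply SymmetricAlgebra.algHom_ext
    ext m
    simp [SymmetricAlgebra.algebraMapInv_ι]
  have h' := DFunLike.congr_fun h s
  simp only [AlgHom.comp_apply, TrivSqZeroExt.fstHom_apply] at h'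
  simp only [symProj, LinearMap.comp_apply, AlgHom.toLinearMap_apply, map_mul,
    SymmetricAlgebra.lift_ι_apply, TrivSqZeroExt.sndHom_apply, TrivSqZeroExt.snd_mul, h']
  simp

theorem symProj_ι (m : M) : symProj (SymmetricAlgebra.ι K M m) = m := by
  have := symProj_ι_mul m (1 : SymmetricAlgebra K M)
  rwa [mul_one, map_one, one_smul] at this

theorem sym_induction {N : Submodule K (SymmetricAlgebra K M)} (h1 : 1 ∈ N)
    (h : ∀ m, ∀ s ∈ N, SymmetricAlgebra.ι K M m * s ∈ N) (s : SymmetricAlgebra K M) : s ∈ N := by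
  have : ∀ s t : SymmetricAlgebra K M, t ∈ N → s * t ∈ N := by
    intro s
    induction s using SymmetricAlgebra.induction with
    | algebraMap r => intro t ht; rw [← Algebra.smul_def]; exact N.smul_mem r ht
    | ι m => exact h m
    | mul a b ha hb => intro t ht; rw [mul_assoc]; exact ha _ (hb _ ht)
    | add a b ha hb => intro t ht; rw [add_mul]; exact add_mem (ha t ht) (hb t ht)
  simpa using this s 1 h1

theorem algebraMapInv_symDer (φ : Module.End K M) (s : SymmetricAlgebra K M) :
    SymmetricAlgebra.algebraMapInv (symDer φ s) = 0 := by
  refine sym_induction (N := LinearMap.ker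
    (SymmetricAlgebra.algebraMapInv.toLinearMap ∘ₗ (symDer φ).toLinearMap)) (by simp) ?_ s
  intro m s hs
  simp only [LinearMap.mem_ker, LinearMap.comp_apply, AlgHom.toLinearMap_apply] at hs ⊢
  change SymmetricAlgebra.algebraMapInv (symDer φ s) = 0 at hs
  change SymmetricAlgebra.algebraMapInv (symDer φ _) = 0
  simp [hs, SymmetricAlgebra.algebraMapInv_ι]

theorem symProj_symDer (φ : Module.End K M) (s : SymmetricAlgebra K M) :
    symProj (symDer φ s) = φ (symProj s) := by
  refine sym_induction (N := LinearMap.eqLocus (symProj ∘ₗ (symDer φ).toLinearMap)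
    (φ ∘ₗ symProj)) ?_ ?_ s
  · change symProj (symDer φ 1) = φ (symProj 1)
    simp [symProj_one]
  · intro m s _
    change symProj (symDer φ _) = φ (symProj _)
    rw [Derivation.leibniz, map_add, smul_eq_mul, smul_eq_mul, symDer_ι, mul_comm s,
      symProj_ι_mul, symProj_ι_mul, symProj_ι_mul, algebraMapInv_symDer, zero_smul, zero_add,
      map_smul]

theorem ιInv_ι_mul (m : M) (x : ExteriorAlgebra K M) :
    ExteriorAlgebra.ιInv (ExteriorAlgebra.ι K m * x) = ExteriorAlgebra.algebraMapInv x • m := by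
  let : Module Kᵐᵒᵖ M := Module.compHom _ ((RingHom.id K).fromOpposite mul_comm)
  have : IsCentralScalar K M := ⟨fun _ _ => rfl⟩
  have h : (TrivSqZeroExt.fstHom K K M).comp (ExteriorAlgebra.toTrivSqZeroExt (R := K) (M := M)) =
      ExteriorAlgebra.algebraMapInv := by
    apply ExteriorAlgebra.hom_ext
    ext m
    simp [ExteriorAlgebra.algebraMapInv]
  have h' := DFunLike.congr_fun h x
  simp only [AlgHom.comp_apply, TrivSqZeroExt.fstHom_apply] at h'
  simp only [ExteriorAlgebra.ιInv, LinearMap.comp_apply, AlgHom.toLinearMap_apply, map_mul,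
    ExteriorAlgebra.toTrivSqZeroExt_ι, TrivSqZeroExt.sndHom_apply, TrivSqZeroExt.snd_mul, h']
  simp

theorem ιInv_one : ExteriorAlgebra.ιInv (1 : ExteriorAlgebra K M) = 0 := by
  let : Module Kᵐᵒᵖ M := Module.compHom _ ((RingHom.id K).fromOpposite mul_comm)
  have : IsCentralScalar K M := ⟨fun _ _ => rfl⟩
  simp [ExteriorAlgebra.ιInv]

theorem algebraMapInv_extDer (φ : Module.End K M) (x : ExteriorAlgebra K M) :
    ExteriorAlgebra.algebraMapInv (extDer φ x) = 0 := by
  induction x using ext_induction with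
  | one => simp
  | smul r x h => rw [map_smul, map_smul, h, smul_zero]
  | add x y hx hy => rw [map_add, map_add, hx, hy, add_zero]
  | mul v x h => simp [ExteriorAlgebra.algebraMapInv]

theorem ιInv_extDer (φ : Module.End K M) (x : ExteriorAlgebra K M) :
    ExteriorAlgebra.ιInv (extDer φ x) = φ (ExteriorAlgebra.ιInv x) := by
  induction x using ext_induction with
  | one => simp [ιInv_one]
  | smul r x h => simp only [map_smul, h]
  | add x y hx hy => simp only [map_add, hx, hy]
  | mul v x h =>
    rw [extDer_ι_mul, map_add, ιInv_ι_mul, ιInv_ι_mul, ιInv_ι_mul, algebraMapInv_extDer, zero_smul,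
      add_zero, map_smul]

end Linear

/-! ### Components of chains of low weight -/

section Projections

variable {K L₀ L₁ : Type*} [Field K] [AddCommGroup L₀] [Module K L₀]
  [AddCommGroup L₁] [Module K L₁]

/-- The projection of chains to `Λ⁰(L₀) ⊗ S¹(L₁) = L₁`. -/
def proj₁ : Chains K L₀ L₁ →ₗ[K] L₁ :=
  TensorProduct.lid K L₁ ∘ₗ
    TensorProduct.map ExteriorAlgebra.algebraMapInv.toLinearMap symProj

/-- The projection of chains to `Λ¹(L₀) ⊗ S¹(L₁) = L₀ ⊗ L₁`. -/
def proj₁₁ : Chains K L₀ L₁ →ₗ[K] L₀ ⊗[K] L₁ :=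
  TensorProduct.map ExteriorAlgebra.ιInv symProj

theorem proj₁_tmul (x : ExteriorAlgebra K L₀) (s : SymmetricAlgebra K L₁) :
    proj₁ (x ⊗ₜ[K] s) = ExteriorAlgebra.algebraMapInv x • symProj s := by
  simp [proj₁]

theorem proj₁_mulSym_unitChain (m : L₁) : proj₁ (mulSym K m (unitChain K L₀ L₁)) = m := by
  rw [unitChain, mulSym_tmul, proj₁_tmul, map_one, one_smul, mul_one, symProj_ι]

theorem proj₁₁_wedge (a : L₀) (s : SymmetricAlgebra K L₁) :
    proj₁₁ (wedge K a (1 ⊗ₜ[K] s)) = a ⊗ₜ[K] symProj s := by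
  rw [wedge_tmul, proj₁₁, TensorProduct.map_tmul, ιInv_ι_mul, map_one, one_smul]

theorem proj₁₁_chainDer (φ₀ : Module.End K L₀) (φ₁ : Module.End K L₁) (c : Chains K L₀ L₁) :
    proj₁₁ (chainDer φ₀ φ₁ c) = (φ₀.rTensor L₁ + φ₁.lTensor L₀) (proj₁₁ c) := by
  induction c using TensorProduct.induction_on with
  | zero => simp
  | tmul x s => simp [chainDer_tmul, proj₁₁, ιInv_extDer, symProj_symDer]
  | add x y hx hy => simp only [map_add, hx, hy]

theorem weight_mulSym (m : L₁) (c : Chains K L₀ L₁) :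
    weight K L₀ L₁ (mulSym K m c) = mulSym K m c + mulSym K m (weight K L₀ L₁ c) :=
  chainDer_mulSym m c

theorem weight_unitChain : weight K L₀ L₁ (unitChain K L₀ L₁) = 0 := chainDer_unitChain

theorem weight_mulSym_unitChain (m : L₁) :
    weight K L₀ L₁ (mulSym K m (unitChain K L₀ L₁)) = mulSym K m (unitChain K L₀ L₁) := by
  rw [weight_mulSym, weight_unitChain, map_zero, add_zero]

/-- Chains of degree zero are sums of their parts of weight zero, one and at least two. -/
theorem mem_sup_of_degree_zero {c : Chains K L₀ L₁} (hc : c ∈ chainsOfDegree K L₀ L₁ 0) :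
    c ∈ (K ∙ unitChain K L₀ L₁) ⊔ (LinearMap.range ((mulSym K).flip (unitChain K L₀ L₁)) ⊔
      eigSum (weight K L₀ L₁) (Set.range fun n : ℕ => ((n + 2 : ℕ) : K))) := by
  refine chainsOfDegree_zero_le (N := (K ∙ unitChain K L₀ L₁) ⊔
    (LinearMap.range ((mulSym K).flip (unitChain K L₀ L₁)) ⊔
      eigSum (weight K L₀ L₁) (Set.range fun n : ℕ => ((n + 2 : ℕ) : K)))) ?_ ?_ hc
  · exact Submodule.mem_sup_left (Submodule.mem_span_singleton_self _)
  · intro m c _ h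
    obtain ⟨a, ha, b, hb, rfl⟩ := Submodule.mem_sup.1 h
    obtain ⟨r, rfl⟩ := Submodule.mem_span_singleton.1 ha
    obtain ⟨_, ⟨m', rfl⟩, t, ht, rfl⟩ := Submodule.mem_sup.1 hb
    rw [map_add, map_add, map_smul]
    refine Submodule.mem_sup_right (add_mem ?_ (Submodule.mem_sup_right (add_mem ?_ ?_)))
    · exact Submodule.mem_sup_left (Submodule.smul_mem _ _ ⟨m, rfl⟩)
    · refine LinearMap.mem_eigSum (A := Set.range fun n : ℕ => ((n + 2 : ℕ) : K))
        (μ := ((0 + 2 : ℕ) : K)) ⟨0, rfl⟩ ?_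
      rw [LinearMap.flip_apply, weight_mulSym, weight_mulSym, weight_unitChain]
      simp only [map_zero, add_zero]
      push_cast
      module
    · refine mulSym_mem_eigSum (ν := 1) (by simp) ?_ ht
      rintro _ ⟨n, rfl⟩
      exact ⟨n + 1, by push_cast; ring⟩

/-- Chains of degree zero and weight one. -/
theorem exists_eq_mulSym_unitChain [CharZero K] {c : Chains K L₀ L₁} (hc : c ∈ chainsOfDegree K L₀ L₁ 0)
    (hw : weight K L₀ L₁ c = c) : ∃ m : L₁, c = mulSym K m (unitChain K L₀ L₁) := by
  obtain ⟨a, ha, b, hb, rfl⟩ := Submodule.mem_sup.1 (mem_sup_of_degree_zero hc)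
  obtain ⟨r, rfl⟩ := Submodule.mem_span_singleton.1 ha
  obtain ⟨_, ⟨m, rfl⟩, t, ht, rfl⟩ := Submodule.mem_sup.1 hb
  refine ⟨m, ?_⟩
  rw [← sub_eq_zero, ← Submodule.mem_bot K]
  -- The difference between the chain and its linear part has weight one, but it is also a sum of
  -- components of other weights.
  refine LinearMap.mem_of_add_eigSum_mem (f := weight K L₀ L₁) (μ := 1) (A := {1}ᶜ)
    (t := -(r • unitChain K L₀ L₁ + t)) (by simp) (by simp) ?_ ?_ ?_
  · rw [map_sub, hw, weight_mulSym_unitChain, one_smul]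
  · refine neg_mem (add_mem ?_ ?_)
    · refine LinearMap.mem_eigSum (μ := 0) (by simp) ?_
      rw [map_smul, weight_unitChain, smul_zero, zero_smul]
    · refine LinearMap.eigSum_le (fun μ hμ v hv => LinearMap.mem_eigSum ?_ hv) ht
      obtain ⟨n, rfl⟩ := hμ
      rw [Set.mem_compl_singleton_iff, ← Nat.cast_one, Ne, Nat.cast_inj]
      omega
  · rw [Submodule.mem_bot, LinearMap.flip_apply]; abel

theorem mem_sup_pos_of_degree_zero {c : Chains K L₀ L₁} (hc : c ∈ chainsOfDegree K L₀ L₁ 0) :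
    c ∈ (K ∙ unitChain K L₀ L₁) ⊔
      eigSum (weight K L₀ L₁) (Set.range fun n : ℕ => ((n + 1 : ℕ) : K)) := by
  obtain ⟨a, ha, b, hb, rfl⟩ := Submodule.mem_sup.1 (mem_sup_of_degree_zero hc)
  refine add_mem (Submodule.mem_sup_left ha) (Submodule.mem_sup_right ?_)
  obtain ⟨_, ⟨m, rfl⟩, t, ht, rfl⟩ := Submodule.mem_sup.1 hb
  refine add_mem (LinearMap.mem_eigSum (A := Set.range fun n : ℕ => ((n + 1 : ℕ) : K)) (μ := 1)
    ⟨0, by simp⟩ ?_) ?_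
  · rw [LinearMap.flip_apply, weight_mulSym_unitChain, one_smul]
  · refine LinearMap.eigSum_le (fun μ hμ v hv => LinearMap.mem_eigSum ?_ hv) ht
    obtain ⟨n, rfl⟩ := hμ
    exact ⟨n + 1, rfl⟩

end Projections

end DGLie

/-! ### Reduction of degree-two cycles along the Weyl pairs -/

namespace DGLie

open LinearMap (IsNil eigSum)

variable {K L₀ L₁ : Type*} [Field K] [LieRing L₀] [LieAlgebra K L₀]
  [AddCommGroup L₁] [Module K L₁] [LieRingModule L₀ L₁] [LieModule K L₀ L₁]

/-- Commuting closed elements `z₀, z₁` of degree zero whose adjoint actions are locally nilpotent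
and form Weyl pairs with operators `R₀, R₁` that commute with the internal differential. -/
structure WeylData (δ : L₀ →ₗ[K] L₁) where
  z : Fin 2 → L₀
  R₀ : Fin 2 → Module.End K L₀
  R₁ : Fin 2 → Module.End K L₁
  δ_lie : ∀ a b : L₀, δ ⁅a, b⁆ = ⁅a, δ b⁆ - ⁅b, δ a⁆
  δ_z : ∀ i, δ (z i) = 0
  δ_R : ∀ i a, R₁ i (δ a) = δ (R₀ i a)
  z_comm : ∀ i j, ⁅z i, z j⁆ = 0
  weyl₀ : ∀ i j a, ⁅z i, R₀ j a⁆ = R₀ j ⁅z i, a⁆ + if i = j then a else 0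
  weyl₁ : ∀ i j m, ⁅z i, R₁ j m⁆ = R₁ j ⁅z i, m⁆ + if i = j then m else 0
  nil₀ : ∀ i a, IsNil (LieModule.toEnd K L₀ L₀ (z i)) a
  nil₁ : ∀ i m, IsNil (LieModule.toEnd K L₀ L₁ (z i)) m

theorem internalDiff_weight {δ : L₀ →ₗ[K] L₁} {n : ℕ} {c : Chains K L₀ L₁}
    (hc : c ∈ chainsOfDegree K L₀ L₁ n) :
    internalDiff δ (weight K L₀ L₁ c) = weight K L₀ L₁ (internalDiff δ c) := by
  rw [weight, internalDiff_chainDer (by simp) hc]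

namespace WeylData

variable {δ : L₀ →ₗ[K] L₁} (D : WeylData δ)

/-- The derivation of chains that extends `R₀` and `R₁`. -/
def R (i : Fin 2) : Module.End K (Chains K L₀ L₁) := chainDer (D.R₀ i) (D.R₁ i)

/-- Chains of degree `n` that commute with both `zᵢ`. -/
def inv (n : ℕ) : Submodule K (Chains K L₀ L₁) :=
  chainsOfDegree K L₀ L₁ n ⊓ (LinearMap.ker (ad K (D.z 0)) ⊓ LinearMap.ker (ad K (D.z 1)))

theorem mem_inv {n : ℕ} {c : Chains K L₀ L₁} : c ∈ D.inv n ↔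
    c ∈ chainsOfDegree K L₀ L₁ n ∧ ∀ i, ad K (D.z i) c = 0 := by
  simp [inv, Fin.forall_fin_two]

theorem bracket_comm (i j : Fin 2) {M : Type*} [AddCommGroup M] [LieRingModule L₀ M] (m : M) :
    ⁅D.z i, ⁅D.z j, m⁆⁆ = ⁅D.z j, ⁅D.z i, m⁆⁆ := by
  rw [leibniz_lie, D.z_comm, zero_lie, zero_add]

theorem ad_comm (i j : Fin 2) (c : Chains K L₀ L₁) :
    ad K (D.z i) (ad K (D.z j) c) = ad K (D.z j) (ad K (D.z i) c) := by
  have := ad_lie K (D.z i) (D.z j) c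
  rw [D.z_comm, map_zero, LinearMap.zero_apply] at this
  exact (sub_eq_zero.1 this.symm)

theorem ad_R (i j : Fin 2) (c : Chains K L₀ L₁) :
    ad K (D.z i) (D.R j c) = D.R j (ad K (D.z i) c) + if i = j then weight K L₀ L₁ c else 0 := by
  split_ifs with h
  · exact chainDer_weyl (fun a => by simpa [h] using D.weyl₀ i j a)
      (fun a => by simpa [h] using D.weyl₁ i j a) c
  · rw [add_zero]
    exact chainDer_comm_zero (fun a => by simpa [h] using D.weyl₀ i j a)
      (fun a => by simpa [h] using D.weyl₁ i j a) c

theorem isNil_ad (i : Fin 2) (c : Chains K L₀ L₁) : IsNil (ad K (D.z i)) c :=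
  isNil_chainDer (D.nil₀ i) (D.nil₁ i) c

theorem diff_ad (i : Fin 2) (c : Chains K L₀ L₁) :
    diff K δ (ad K (D.z i) c) = ad K (D.z i) (diff K δ c) :=
  diff_ad_comm D.δ_lie (D.δ_z i) c

theorem diff_wedge (i : Fin 2) (c : Chains K L₀ L₁) :
    diff K δ (wedge K (D.z i) c) = ad K (D.z i) c - wedge K (D.z i) (diff K δ c) := by
  rw [DGLie.diff_wedge, D.δ_z, map_zero, LinearMap.zero_apply, add_zero]

theorem ad_wedge (i j : Fin 2) (c : Chains K L₀ L₁) :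
    ad K (D.z i) (wedge K (D.z j) c) = wedge K (D.z j) (ad K (D.z i) c) := by
  rw [DGLie.ad_wedge, D.z_comm, map_zero, LinearMap.zero_apply, zero_add]

section CharZero

variable [CharZero K]

theorem exists_ad_zero_eq {n : ℕ} {c : Chains K L₀ L₁}
    (hc : c ∈ chainsOfDegree K L₀ L₁ (n + 1)) :
    ∃ b ∈ chainsOfDegree K L₀ L₁ (n + 1), ad K (D.z 0) b = c := by
  -- The third operator is zero here, so the side condition is empty.
  obtain ⟨b, hb, -, h⟩ := exists_chainDer_eq (χ₀ := 0) (χ₁ := 0)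
    (fun a => by simpa using D.weyl₀ 0 0 a) (fun a => by simpa using D.weyl₁ 0 0 a) (D.nil₀ 0)
    (D.nil₁ 0) (by simp) (by simp) (by simp) (by simp) hc (by rw [chainDer_zero]; rfl)
  exact ⟨b, hb, h⟩

/-- The pair formed by `ad z₁` and `R₁` commutes with `ad z₀`, so the equation for `z₁` can be
solved inside the kernel of `ad z₀`. -/
theorem exists_ad_one_eq {n : ℕ} {c : Chains K L₀ L₁}
    (hc : c ∈ chainsOfDegree K L₀ L₁ (n + 1)) (h : ad K (D.z 0) c = 0) :
    ∃ b ∈ chainsOfDegree K L₀ L₁ (n + 1), ad K (D.z 0) b = 0 ∧ ad K (D.z 1) b = c :=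
  exists_chainDer_eq (χ₀ := LieModule.toEnd K L₀ L₀ (D.z 0)) (χ₁ := LieModule.toEnd K L₀ L₁ (D.z 0))
    (fun a => by simpa using D.weyl₀ 1 1 a) (fun a => by simpa using D.weyl₁ 1 1 a) (D.nil₀ 1)
    (D.nil₁ 1) (fun a => by simpa using D.bracket_comm 0 1 a)
    (fun a => by simpa using D.bracket_comm 0 1 a)
    (fun a => by simpa using D.weyl₀ 0 1 a) (fun a => by simpa using D.weyl₁ 0 1 a) hc h

/-- Every cycle of degree two is homologous to `z₀ ∧ z₁ ∧ c` for an invariant boundary `c` of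
degree zero. -/
theorem exists_wedge_wedge {c : Chains K L₀ L₁} (hc : c ∈ cycles K δ 2) :
    ∃ b ∈ boundaries K δ 0, b ∈ D.inv 0 ∧
      c - wedge K (D.z 0) (wedge K (D.z 1) b) ∈ boundaries K δ 2 := by
  obtain ⟨hdc, hc⟩ := hc
  rw [SetLike.mem_coe, LinearMap.mem_ker] at hdc
  -- By Cartan's formula `ad z₀ b` is homologous to `z₀ ∧ d b`. Moreover `ad z₀` kills `d b`, since
  -- `ad z₀ b` is a cycle.
  obtain ⟨b, hb, rfl⟩ := D.exists_ad_zero_eq (n := 1) hc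
  have h1 := D.diff_ad 0 b
  rw [hdc] at h1
  -- Writing `d b = ad z₁ b'` with `ad z₀ b' = 0` repeats the move: `z₀ ∧ d b` is homologous to `z₀
  -- ∧ z₁ ∧ d b'`.
  obtain ⟨b', hb', hb'0, hb'1⟩ := D.exists_ad_one_eq (n := 0) (diff_mem K δ 1 hb) h1.symm
  refine ⟨diff K δ b', ⟨b', hb', rfl⟩, D.mem_inv.2 ⟨diff_mem K δ 0 hb', ?_⟩, ?_⟩
  · rw [Fin.forall_fin_two, ← D.diff_ad, ← D.diff_ad, hb'0, hb'1, map_zero,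
      DGLie.diff_diff K δ D.δ_lie]
    exact ⟨rfl, rfl⟩
  · refine ⟨wedge K (D.z 0) b - wedge K (D.z 0) (wedge K (D.z 1) b'),
      sub_mem (wedge_mem _ hb) (wedge_mem _ (wedge_mem _ hb')), ?_⟩
    rw [map_sub, D.diff_wedge, D.diff_wedge, D.diff_wedge, D.ad_wedge, hb'0, hb'1, map_zero, map_sub]
    abel

omit [CharZero K] in
-- For invariant `e` all adjoint terms in Cartan's formula vanish, so the chain is exactly `d (z₀ ∧
-- z₁ ∧ e)`.
theorem wedge_wedge_diff_mem {e : Chains K L₀ L₁} (he : e ∈ D.inv 1) :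
    wedge K (D.z 0) (wedge K (D.z 1) (diff K δ e)) ∈ boundaries K δ 2 := by
  obtain ⟨he, h⟩ := D.mem_inv.1 he
  refine ⟨wedge K (D.z 0) (wedge K (D.z 1) e), wedge_mem _ (wedge_mem _ he), ?_⟩
  rw [D.diff_wedge, D.diff_wedge, D.ad_wedge, h, h]
  simp

/-- If `z₀ ∧ z₁ ∧ m` is a boundary for an invariant `m ∈ L₁`, then `m` bounds an invariant chain. -/
theorem exists_diff_eq_mulSym {m : L₁} (hm : ∀ i, ⁅D.z i, m⁆ = 0)
    (h : wedge K (D.z 0) (wedge K (D.z 1) (mulSym K m (unitChain K L₀ L₁))) ∈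
      boundaries K δ 2) : ∃ e ∈ D.inv 1, diff K δ e = mulSym K m (unitChain K L₀ L₁) := by
  set p : L₁ → Chains K L₀ L₁ := fun m => mulSym K m (unitChain K L₀ L₁) with hp
  have hp0 : ∀ m, p m ∈ chainsOfDegree K L₀ L₁ 0 := fun m => mulSym_mem m unitChain_mem
  have hpad : ∀ i m, ad K (D.z i) (p m) = p ⁅D.z i, m⁆ := by
    intro i m
    rw [hp]
    dsimp only
    rw [ad_mulSym, ad_eq_chainDer, chainDer_unitChain, map_zero, add_zero]
  -- As `m` is invariant, the chains `p (R₀ m)` and `p (R₁ m)` are dual primitives of `p m` for `ad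
  -- z₀` and `ad z₁`.
  have hpR : ∀ i j, ad K (D.z i) (p (D.R₁ j m)) = if i = j then p m else 0 := by
    intro i j
    rw [hpad, D.weyl₁, hm, map_zero, zero_add]
    split_ifs
    · rfl
    · simp [hp]
  change wedge K (D.z 0) (wedge K (D.z 1) (p m)) ∈ boundaries K δ 2 at h
  obtain ⟨w, hw, hdw⟩ := h
  obtain ⟨u, hu, rfl⟩ := D.exists_ad_zero_eq hw
  -- This is the reverse zigzag. With `w = ad z₀ u` and `d w = z₀ ∧ z₁ ∧ m`, the chain `z₀ ∧ z₁ ∧ R₀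
  -- m - d u` is killed by `ad z₀`, hence equals `ad z₁ u'` with `ad z₀ u' = 0`.
  have hw' : wedge K (D.z 0) (wedge K (D.z 1) (p (D.R₁ 0 m))) - diff K δ u ∈
      chainsOfDegree K L₀ L₁ 2 :=
    sub_mem (wedge_mem _ (wedge_mem _ (hp0 _))) (diff_mem K δ 2 hu)
  obtain ⟨u', hu', hu'0, hu'1⟩ := D.exists_ad_one_eq hw' (by
    rw [map_sub, D.ad_wedge, D.ad_wedge, hpR, if_pos rfl, ← D.diff_ad, hdw, sub_self])
  have hdu' : ad K (D.z 1) (diff K δ u') = wedge K (D.z 1) (p m) := by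
    rw [← D.diff_ad, hu'1, map_sub, DGLie.diff_diff K δ D.δ_lie, D.diff_wedge, D.ad_wedge,
      D.diff_wedge, diff_eq_zero (hp0 _), hpR, hpR]
    simp
  -- The term `d u'` does not affect the differential. It is subtracted to restore invariance, since
  -- `ad z₁` maps both `z₁ ∧ R₁ m` and `d u'` to `z₁ ∧ m`.
  refine ⟨wedge K (D.z 1) (p (D.R₁ 1 m)) - diff K δ u', D.mem_inv.2 ⟨?_, ?_⟩, ?_⟩
  · exact sub_mem (wedge_mem _ (hp0 _)) (diff_mem K δ 1 hu')
  · rw [Fin.forall_fin_two]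
    constructor
    · rw [map_sub, D.ad_wedge, hpR, ← D.diff_ad, hu'0]
      simp
    · rw [map_sub, D.ad_wedge, hpR, if_pos rfl, hdu', sub_self]
  · rw [map_sub, DGLie.diff_diff K δ D.δ_lie, D.diff_wedge, diff_eq_zero (hp0 _), hpR, if_pos rfl,
      map_zero, sub_zero, sub_zero]

end CharZero

/-! ### The Euler homotopy and reduction to weight one -/

/-- An Euler element: it has weight one with respect to both `zᵢ` and acts semisimply on `L₁`, with
all cohomology classes of weight at most `-2`. -/
structure IsEuler (E : L₀) : Prop where
  δ_eq : δ E = 0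
  lie_z : ∀ i, ⁅E, D.z i⁆ = D.z i
  semisimple : ∀ m, m ∈ eigSum (LieModule.toEnd K L₀ L₁ E) Set.univ
  exact : ∀ m, m ∈ LinearMap.range δ ⊔
    eigSum (LieModule.toEnd K L₀ L₁ E) (Set.range fun n : ℕ => -((n + 2 : ℕ) : K))

variable {D} {E : L₀} (hE : D.IsEuler E)

include hE in
-- The correction is again a multiple of `ad zᵢ c`, so `ad E` preserves the invariant chains.
theorem IsEuler.ad_comm (i : Fin 2) (c : Chains K L₀ L₁) :
    ad K (D.z i) (ad K E c) = ad K E (ad K (D.z i) c) - ad K (D.z i) c := by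
  have := ad_lie K E (D.z i) c
  rw [hE.lie_z] at this
  exact eq_sub_of_add_eq' (eq_sub_iff_add_eq.1 this)

variable [CharZero K]

include hE in
/-- Invariant chains of Euler weight different from `-2` bound invariant chains. -/
theorem IsEuler.exists_diff_eq {s : Chains K L₀ L₁} (hs : s ∈ D.inv 0) {n : ℕ} (hn : n ≠ 0)
    (hw : weight K L₀ L₁ s = (n : K) • s) {μ : K} (hμ : ad K E s = μ • s) (hμ2 : μ ≠ -2) :
    ∃ e ∈ D.inv 1, diff K δ e = s := by
  obtain ⟨hs0, hs⟩ := D.mem_inv.1 hs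
  have hR : ∀ i, D.R i s ∈ chainsOfDegree K L₀ L₁ 0 := fun i => chainDer_mem hs0
  have hn' : (n : K) ≠ 0 := Nat.cast_ne_zero.2 hn
  have hμ' : μ + 2 ≠ 0 := fun h => hμ2 (eq_neg_of_add_eq_zero_left h)
  have hadR : ∀ i j, ad K (D.z i) (D.R j s) = if i = j then (n : K) • s else 0 := by
    intro i j
    rw [D.ad_R, hs, map_zero, zero_add, hw]
  have hzE : ∀ i, ⁅D.z i, E⁆ = -D.z i := fun i => by rw [← lie_skew, hE.lie_z]
  -- Since `[zᵢ, E] = -zᵢ`, the chain `E ∧ s` is not invariant. The second sum repairs this because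
  -- `ad zᵢ (Rⱼ s)` is `n • s` for `i = j` and zero otherwise. The differential gives `μ • s` from
  -- `E` and one `s` from each of the two coordinates, hence the factor `μ + 2`.
  refine ⟨(μ + 2)⁻¹ • (wedge K E s + (n : K)⁻¹ • ∑ i, wedge K (D.z i) (D.R i s)), ?_, ?_⟩
  · refine Submodule.smul_mem _ _ (D.mem_inv.2 ⟨add_mem (wedge_mem _ hs0)
      (Submodule.smul_mem _ _ (Submodule.sum_mem _ fun i _ => wedge_mem _ (hR i))), fun i => ?_⟩)
    rw [map_add, DGLie.ad_wedge, hzE, hs, map_smul, map_sum]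
    simp only [D.ad_wedge, hadR]
    rw [Finset.sum_eq_single i (fun j _ hj => by rw [if_neg (Ne.symm hj), map_zero]) (by simp),
      if_pos rfl, map_smul, smul_smul, inv_mul_cancel₀ hn']
    simp
  · rw [map_smul, map_add, diff_wedge_of_degree_zero _ hs0, hE.δ_eq, map_zero, LinearMap.zero_apply,
      add_zero, hμ, map_smul, map_sum]
    simp only [D.diff_wedge, hadR, if_true, diff_eq_zero (hR _), map_zero, sub_zero]
    rw [Fin.sum_univ_two, ← two_smul K, smul_smul, smul_smul, ← add_smul, smul_smul,
      show (n : K)⁻¹ * 2 * n = 2 by field_simp, inv_mul_cancel₀ hμ', one_smul]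

variable (δ) in
/-- Chains of degree zero that are exact for the internal differential. -/
def internalBoundaries : Submodule K (Chains K L₀ L₁) :=
  (chainsOfDegree K L₀ L₁ 1).map (internalDiff δ)

omit [CharZero K] in
theorem mulSym_δ_mem (a : L₀) {c : Chains K L₀ L₁} (hc : c ∈ chainsOfDegree K L₀ L₁ 0) :
    mulSym K (δ a) c ∈ internalBoundaries δ := by
  refine ⟨wedge K a c, wedge_mem a hc, ?_⟩
  rw [internalDiff_wedge, internalDiff_eq_zero hc, map_zero, sub_zero]

omit [CharZero K] in
-- Elements of `L₁` are even and closed, so the internal differential is linear over `S(L₁)` and its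
-- image in degree zero is an ideal.
theorem mulSym_mem_internalBoundaries (m : L₁) {c : Chains K L₀ L₁}
    (hc : c ∈ internalBoundaries δ) : mulSym K m c ∈ internalBoundaries δ := by
  obtain ⟨e, he, rfl⟩ := hc
  have : chainsOfDegree K L₀ L₁ 1 ≤
      (internalBoundaries δ).comap (mulSym K m ∘ₗ internalDiff δ) := by
    refine chainsOfDegree_succ_le fun a c hc => ?_
    rw [Submodule.mem_comap, LinearMap.comp_apply, ← internalDiff_mulSym_wedge m a hc]
    exact ⟨_, mulSym_mem m (wedge_mem a hc), rfl⟩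
  exact this he

omit [CharZero K] in
theorem weight_mem_internalBoundaries {c : Chains K L₀ L₁} (hc : c ∈ internalBoundaries δ) :
    weight K L₀ L₁ c ∈ internalBoundaries δ := by
  obtain ⟨e, he, rfl⟩ := hc
  exact ⟨weight K L₀ L₁ e, chainDer_mem he, internalDiff_weight he⟩

omit [CharZero K] in
include hE in
theorem IsEuler.ad_mem_internalBoundaries {c : Chains K L₀ L₁} (hc : c ∈ internalBoundaries δ) :
    ad K E c ∈ internalBoundaries δ := by
  obtain ⟨e, he, rfl⟩ := hc
  refine ⟨ad K E e, ad_mem E he, ?_⟩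
  rw [ad_eq_chainDer]
  refine internalDiff_chainDer (fun a => ?_) he
  rw [LieModule.toEnd_apply_apply, LieModule.toEnd_apply_apply, D.δ_lie, hE.δ_eq, lie_zero, sub_zero]

omit [CharZero K] in
theorem ad_mulSym_unitChain (a : L₀) (m : L₁) : ad K a (mulSym K m (unitChain K L₀ L₁)) =
    mulSym K ⁅a, m⁆ (unitChain K L₀ L₁) := by
  rw [ad_mulSym, ad_eq_chainDer, chainDer_unitChain, map_zero, add_zero]

variable (K L₀ L₁) in
/-- Chains of degree zero and weight at most one. -/
def shortChains : Submodule K (Chains K L₀ L₁) :=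
  (K ∙ unitChain K L₀ L₁) ⊔ LinearMap.range ((mulSym K (L₀ := L₀)).flip (unitChain K L₀ L₁))

omit [CharZero K] [LieRingModule L₀ L₁] [LieModule K L₀ L₁] in
theorem mulSym_mem_shortChains (m : L₁) :
    mulSym K m (unitChain K L₀ L₁) ∈ shortChains K L₀ L₁ :=
  Submodule.mem_sup_right ⟨m, rfl⟩

omit [CharZero K] [LieRingModule L₀ L₁] [LieModule K L₀ L₁] in
theorem mem_shortChains {c : Chains K L₀ L₁} : c ∈ shortChains K L₀ L₁ ↔
    ∃ (r : K) (m : L₁), c = r • unitChain K L₀ L₁ + mulSym K m (unitChain K L₀ L₁) := by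
  constructor
  · intro h
    obtain ⟨_, ha, _, ⟨m, rfl⟩, rfl⟩ := Submodule.mem_sup.1 h
    obtain ⟨r, rfl⟩ := Submodule.mem_span_singleton.1 ha
    exact ⟨r, m, rfl⟩
  · rintro ⟨r, m, rfl⟩
    exact add_mem (Submodule.smul_mem _ _ (Submodule.mem_sup_left
      (Submodule.mem_span_singleton_self _))) (mulSym_mem_shortChains m)

/-- The possible Euler weights of products of at least two cohomology classes. -/
abbrev lowWeights (K : Type*) [Field K] : Set K := Set.range fun n : ℕ => -((n + 4 : ℕ) : K)

omit [CharZero K] in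
include hE in
-- An exact part of `l` gives an exact product. A remaining part of weight `-(k' + 2)` gives a
-- product of weight `-(k + k' + 4)`.
theorem IsEuler.mulSym_mem_sup (m : L₁) (k : ℕ) (hm : ⁅E, m⁆ = (-((k + 2 : ℕ) : K)) • m) (l : L₁) :
    mulSym K m (mulSym K l (unitChain K L₀ L₁)) ∈
      internalBoundaries δ ⊔ eigSum (ad K E) (lowWeights K) := by
  obtain ⟨_, ⟨a, rfl⟩, m', hm', rfl⟩ := Submodule.mem_sup.1 (hE.exact l)
  rw [map_add, LinearMap.add_apply, map_add]
  refine add_mem (Submodule.mem_sup_left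
    (mulSym_mem_internalBoundaries _ (mulSym_δ_mem a unitChain_mem))) (Submodule.mem_sup_right ?_)
  refine LinearMap.eigSum_le (N := (eigSum (ad K E) (lowWeights K)).comap
    (mulSym K m ∘ₗ (mulSym K (L₀ := L₀)).flip (unitChain K L₀ L₁))) ?_ hm'
  rintro _ ⟨k', rfl⟩ m' hm'
  refine LinearMap.mem_eigSum (A := lowWeights K) (μ := -((k + k' + 4 : ℕ) : K)) ⟨k + k', rfl⟩ ?_
  rw [LieModule.toEnd_apply_apply] at hm'
  rw [LinearMap.comp_apply, LinearMap.flip_apply, ad_mulSym, ad_mulSym_unitChain, hm, hm', map_smul,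
    map_smul, LinearMap.smul_apply, LinearMap.smul_apply, map_smul]
  push_cast
  module

omit [CharZero K] in
include hE in
/-- Chains of degree zero are spanned by exact ones, short ones, and ones of low Euler weight. -/
theorem IsEuler.degree_zero_le : chainsOfDegree K L₀ L₁ 0 ≤
    internalBoundaries δ ⊔ shortChains K L₀ L₁ ⊔ eigSum (ad K E) (lowWeights K) := by
  refine chainsOfDegree_zero_le ?_ ?_
  · exact Submodule.mem_sup_left (Submodule.mem_sup_right (Submodule.mem_sup_left
      (Submodule.mem_span_singleton_self _)))
  intro m c hc h
  obtain ⟨_, ⟨a, rfl⟩, m', hm', rfl⟩ := Submodule.mem_sup.1 (hE.exact m)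
  rw [map_add, LinearMap.add_apply]
  refine add_mem (Submodule.mem_sup_left (Submodule.mem_sup_left (mulSym_δ_mem a hc))) ?_
  refine LinearMap.eigSum_le (N := (internalBoundaries δ ⊔ shortChains K L₀ L₁ ⊔
    eigSum (ad K E) (lowWeights K)).comap ((mulSym K (L₀ := L₀)).flip c)) ?_ hm'
  rintro _ ⟨k, rfl⟩ m hm
  rw [Submodule.mem_comap, LinearMap.flip_apply]
  obtain ⟨b, hb, t, ht, rfl⟩ := Submodule.mem_sup.1 h
  obtain ⟨i, hi, b', hb', rfl⟩ := Submodule.mem_sup.1 hb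
  obtain ⟨r, l, rfl⟩ := mem_shortChains.1 hb'
  rw [map_add, map_add, map_add, map_smul]
  refine add_mem (add_mem (Submodule.mem_sup_left (Submodule.mem_sup_left
    (mulSym_mem_internalBoundaries m hi))) (add_mem (Submodule.smul_mem _ _ (Submodule.mem_sup_left
      (Submodule.mem_sup_right (mulSym_mem_shortChains m)))) ?_)) (Submodule.mem_sup_right ?_)
  · exact sup_le_sup_right (le_sup_left (a := internalBoundaries δ) (b := shortChains K L₀ L₁))
      (eigSum (ad K E) (lowWeights K)) (hE.mulSym_mem_sup m k hm l)
  · refine mulSym_mem_eigSum (φ₀ := LieModule.toEnd K L₀ L₀ E)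
      (φ₁ := LieModule.toEnd K L₀ L₁ E) hm ?_ ht
    rintro _ ⟨k', rfl⟩
    exact ⟨k + k' + 2, by push_cast; ring⟩

include hE in
/-- Chains of degree zero, weight at least two and Euler weight `-2` are exact for the internal
differential. -/
theorem IsEuler.mem_internalBoundaries {s : Chains K L₀ L₁} (hs : s ∈ chainsOfDegree K L₀ L₁ 0)
    {n : ℕ} (hw : weight K L₀ L₁ s = ((n + 2 : ℕ) : K) • s) (hμ : ad K E s = (-2 : K) • s) :
    s ∈ internalBoundaries δ := by
  obtain ⟨b, hb, t, ht, hbt⟩ := Submodule.mem_sup.1 (hE.degree_zero_le hs)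
  have h1 : s ∈ internalBoundaries δ ⊔ shortChains K L₀ L₁ := by
    -- The weights in `lowWeights` are at most `-4`, so the summand `t` can be separated from `s`,
    -- which has Euler weight `-2`.
    refine LinearMap.mem_of_add_eigSum_mem (f := ad K E) (A := lowWeights K) (t := -t) ?_ ?_ hμ
      (neg_mem ht) ?_
    · intro v hv
      obtain ⟨i, hi, b, hb, rfl⟩ := Submodule.mem_sup.1 hv
      obtain ⟨r, l, rfl⟩ := mem_shortChains.1 hb
      have hadu : ad K E (unitChain K L₀ L₁) = 0 := chainDer_unitChain
      rw [map_add, map_add, map_smul, hadu, smul_zero, zero_add, ad_mulSym_unitChain]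
      exact add_mem (Submodule.mem_sup_left (hE.ad_mem_internalBoundaries hi))
        (Submodule.mem_sup_right (mulSym_mem_shortChains _))
    · rintro ⟨k, hk⟩
      have hk' : ((k + 4 : ℕ) : K) = ((2 : ℕ) : K) := by
        simpa using congrArg Neg.neg hk
      have := Nat.cast_injective hk'
      omega
    · rw [← hbt, add_neg_cancel_right]; exact hb
  obtain ⟨i, hi, b, hb, hib⟩ := Submodule.mem_sup.1 h1
  obtain ⟨r, l, rfl⟩ := mem_shortChains.1 hb
  -- Short chains have weight 0 or 1 and `s` has weight at least 2, so a second separation, now by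
  -- weight, removes them.
  refine LinearMap.mem_of_add_eigSum_mem (f := weight K L₀ L₁) (A := {0, 1})
    (t := -(r • unitChain K L₀ L₁ + mulSym K l (unitChain K L₀ L₁)))
    (fun v hv => weight_mem_internalBoundaries hv) ?_ hw ?_ ?_
  · rintro (h | h)
    · have := Nat.cast_eq_zero.1 h
      omega
    · rw [Set.mem_singleton_iff] at h
      have := Nat.cast_eq_one.1 h
      omega
  · refine neg_mem (add_mem (Submodule.smul_mem _ _ ?_) ?_)
    · exact LinearMap.mem_eigSum (μ := 0) (by simp) (by rw [weight_unitChain, zero_smul])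
    · exact LinearMap.mem_eigSum (μ := 1) (by simp) (by rw [weight_mulSym_unitChain, one_smul])
  · rw [← hib, add_neg_cancel_right]; exact hi

variable (D) in
/-- Exactness for the internal differential is compatible with invariants. -/
theorem exists_inv_internalDiff_eq {s : Chains K L₀ L₁} (hs : s ∈ D.inv 0)
    {n : ℕ} (hn : n ≠ 0) (hw : weight K L₀ L₁ s = (n : K) • s) {u : Chains K L₀ L₁}
    (hu : u ∈ chainsOfDegree K L₀ L₁ 1) (hus : internalDiff δ u = s) :
    ∃ e ∈ D.inv 1, weight K L₀ L₁ e = (n : K) • e ∧ internalDiff δ e = s := by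
  have hn' : (n : K) ≠ 0 := Nat.cast_ne_zero.2 hn
  obtain ⟨hs0, hs⟩ := D.mem_inv.1 hs
  -- The primitive is first made homogeneous of weight `n`. On that eigenspace `ad zᵢ` and `Rᵢ` form
  -- a Weyl pair with constant `n`, and both commute with the internal differential.
  obtain ⟨u₁, hu₁, hw₁, hus₁⟩ := LinearMap.exists_eigen_lift (f := weight K L₀ L₁)
    (f' := weight K L₀ L₁) (φ := internalDiff δ) (p := chainsOfDegree K L₀ L₁ 1) (μ := (n : K))
    (fun v hv => chainDer_mem hv) (fun v hv => internalDiff_weight hv) hu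
    (mem_eigSum_weight u) (by rw [hus, hw])
  rw [hus] at hus₁
  set U := chainsOfDegree K L₀ L₁ 1 ⊓ LinearMap.ker (weight K L₀ L₁ - (n : K) • LinearMap.id)
    with hU
  have hmem : ∀ u, u ∈ U ↔ u ∈ chainsOfDegree K L₀ L₁ 1 ∧ weight K L₀ L₁ u = (n : K) • u := by
    intro u
    simp [hU, Submodule.mem_inf, sub_eq_zero]
  have hUder : ∀ (φ₀ : Module.End K L₀) (φ₁ : Module.End K L₁), ∀ u ∈ U, chainDer φ₀ φ₁ u ∈ U := by
    intro φ₀ φ₁ u hu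
    rw [hmem] at hu ⊢
    exact ⟨chainDer_mem hu.1, by rw [chainDer_weight_comm, hu.2, map_smul]⟩
  have hφX : ∀ i, ∀ u ∈ U, internalDiff δ (ad K (D.z i) u) = ad K (D.z i) (internalDiff δ u) := by
    intro i u hu
    refine internalDiff_chainDer (fun a => ?_) hu.1
    change ⁅D.z i, δ a⁆ = δ ⁅D.z i, a⁆
    rw [D.δ_lie, D.δ_z, lie_zero, sub_zero]
  have hφR : ∀ i, ∀ u ∈ U, internalDiff δ (D.R i u) = D.R i (internalDiff δ u) :=
    fun i u hu => internalDiff_chainDer (D.δ_R i) hu.1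
  have hXR : ∀ i, ∀ u ∈ U, ad K (D.z i) (D.R i u) = D.R i (ad K (D.z i) u) + (n : K) • u := by
    intro i u hu
    rw [D.ad_R, if_pos rfl, ((hmem u).1 hu).2]
  obtain ⟨u₂, hu₂, hz₂, hus₂⟩ := LinearMap.exists_ker_lift_of_weyl (U := U) (hUder _ _)
    (hUder _ _) hn' (hXR 0) (hφX 0) (hφR 0) ((hmem u₁).2 ⟨hu₁, hw₁⟩) (D.isNil_ad 0 u₁)
    (by rw [hus₁, hs])
  rw [hus₁] at hus₂
  -- The correction for `z₁` uses only operators that preserve the kernel of `ad z₀`, so the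
  -- invariance already obtained is not lost.
  set U' := U ⊓ LinearMap.ker (ad K (D.z 0)) with hU'
  obtain ⟨u₃, hu₃, hz₃, hus₃⟩ := LinearMap.exists_ker_lift_of_weyl (U := U') (X := ad K (D.z 1))
    (R := D.R 1)
    (fun u hu => ⟨hUder _ _ u hu.1, by
      rw [SetLike.mem_coe, LinearMap.mem_ker, D.ad_comm, LinearMap.mem_ker.1 hu.2, map_zero]⟩)
    (fun u hu => ⟨hUder _ _ u hu.1, by
      rw [SetLike.mem_coe, LinearMap.mem_ker, D.ad_R, LinearMap.mem_ker.1 hu.2, map_zero]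
      simp⟩)
    hn' (fun u hu => hXR 1 u hu.1) (fun u hu => hφX 1 u hu.1) (fun u hu => hφR 1 u hu.1)
    ⟨hu₂, hz₂⟩ (D.isNil_ad 1 u₂) (by rw [hus₂, hs])
  rw [hus₂] at hus₃
  refine ⟨u₃, D.mem_inv.2 ⟨hu₃.1.1, ?_⟩, ((hmem u₃).1 hu₃.1).2, hus₃⟩
  rw [Fin.forall_fin_two]
  exact ⟨hu₃.2, hz₃⟩

include hE in
/-- Invariant chains of degree zero and positive weight are, up to boundaries of invariant chains,
of weight one. -/
theorem IsEuler.exists_sub_mulSym_mem {n : ℕ} {s : Chains K L₀ L₁} (hs : s ∈ D.inv 0)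
    (hw : weight K L₀ L₁ s = ((n + 1 : ℕ) : K) • s) :
    ∃ m : L₁, (∀ i, ⁅D.z i, m⁆ = 0) ∧
      s - mulSym K m (unitChain K L₀ L₁) ∈ (D.inv 1).map (diff K δ) := by
  set Z : Submodule K L₁ := LinearMap.ker (LieModule.toEnd K L₀ L₁ (D.z 0)) ⊓
    LinearMap.ker (LieModule.toEnd K L₀ L₁ (D.z 1)) with hZ
  set N := (D.inv 1).map (diff K δ) ⊔
    Z.map ((mulSym K (L₀ := L₀)).flip (unitChain K L₀ L₁)) with hN
  suffices s ∈ N by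
    obtain ⟨b, hb, _, ⟨m, hm, rfl⟩, rfl⟩ := Submodule.mem_sup.1 this
    refine ⟨m, ?_, by simpa using hb⟩
    rw [Fin.forall_fin_two]
    exact hm
  induction n generalizing s with
  | zero =>
    obtain ⟨hs0, hs⟩ := D.mem_inv.1 hs
    obtain ⟨m, rfl⟩ := exists_eq_mulSym_unitChain hs0 (by simpa using hw)
    refine Submodule.mem_sup_right ⟨m, ?_, rfl⟩
    have : ∀ i, ⁅D.z i, m⁆ = 0 := by
      intro i
      have := congrArg proj₁ (hs i)
      rwa [ad_mulSym, ad_eq_chainDer, chainDer_unitChain, map_zero, add_zero,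
        proj₁_mulSym_unitChain, map_zero] at this
    exact ⟨this 0, this 1⟩
  | succ n ih =>
    set p := D.inv 0 ⊓ LinearMap.ker (weight K L₀ L₁ - ((n + 2 : ℕ) : K) • LinearMap.id) with hp
    have hmem : ∀ u, u ∈ p ↔ u ∈ D.inv 0 ∧ weight K L₀ L₁ u = ((n + 2 : ℕ) : K) • u := by
      intro u
      simp [hp, Submodule.mem_inf, sub_eq_zero]
    have hpE : ∀ v ∈ p, ad K E v ∈ p := by
      intro v hv
      rw [hmem] at hv ⊢
      have h := D.mem_inv.1 hv.1
      refine ⟨D.mem_inv.2 ⟨ad_mem E h.1, fun i => ?_⟩, ?_⟩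
      · rw [hE.ad_comm, h.2, map_zero, sub_zero]
      · rw [ad_eq_chainDer, chainDer_weight_comm, hv.2, map_smul]
    refine LinearMap.inf_eigSum_le (f := ad K E) (p := p) (A := Set.univ) hpE ?_
      ⟨(hmem s).2 ⟨hs, hw⟩, mem_eigSum_chainDer_of_degree_zero hE.semisimple hs.1⟩
    intro μ _ v hv hμ
    rw [hmem] at hv
    by_cases hμ2 : μ = -2
    -- In Euler weight `-2` the homotopy fails, but `v` is internally exact with an invariant
    -- primitive `e`. Then `v = d e - d₀ e`, where the bracket part `d₀ e` is invariant of weight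
    -- one less, and induction applies.
    · obtain ⟨u, hu, huv⟩ := hE.mem_internalBoundaries hv.1.1 hv.2 (by rw [hμ, hμ2])
      obtain ⟨e, he, hwe, hev⟩ := D.exists_inv_internalDiff_eq hv.1 (by omega) hv.2 hu huv
      obtain ⟨he1, hez⟩ := D.mem_inv.1 he
      have h1 : v = diff K δ e - diff K 0 e := by
        rw [diff_eq_add, hev]; abel
      rw [h1]
      refine sub_mem (Submodule.mem_sup_left ⟨e, he, rfl⟩) (ih ?_ ?_)
      · refine D.mem_inv.2 ⟨diff_mem K 0 0 he1, fun i => ?_⟩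
        rw [← diff_ad_comm (δ := (0 : L₀ →ₗ[K] L₁)) (by simp) rfl, hez, map_zero]
      · rw [weight_diff_zero he1, hwe, map_smul]
        push_cast
        module
    · obtain ⟨e, he, rfl⟩ := hE.exists_diff_eq hv.1 (by omega) hv.2 hμ hμ2
      exact Submodule.mem_sup_left ⟨e, he, rfl⟩

omit [CharZero K] in
-- The adjoint action kills the unit chain and `δ a` contributes a factor, so boundaries have no
-- constant component. The reduction to weight one covers positive weights only.
theorem boundaries_zero_le : boundaries K δ 0 ≤
    eigSum (weight K L₀ L₁) (Set.range fun n : ℕ => ((n + 1 : ℕ) : K)) := by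
  rintro _ ⟨e, he, rfl⟩
  refine chainsOfDegree_succ_le (N := (eigSum (weight K L₀ L₁)
    (Set.range fun n : ℕ => ((n + 1 : ℕ) : K))).comap (diff K δ)) (fun a c hc => ?_) he
  rw [Submodule.mem_comap, diff_wedge_of_degree_zero a hc]
  obtain ⟨b, hb, t, ht, rfl⟩ := Submodule.mem_sup.1 (mem_sup_pos_of_degree_zero hc)
  obtain ⟨r, rfl⟩ := Submodule.mem_span_singleton.1 hb
  have hadu : ad K a (unitChain K L₀ L₁) = 0 := chainDer_unitChain
  rw [map_add, map_add, map_smul, map_smul, hadu, smul_zero, zero_add]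
  refine add_mem ?_ (add_mem (Submodule.smul_mem _ _ ?_) ?_)
  · refine map_mem_eigSum (ν := 0) (fun v => ?_) (by simp) ht
    rw [zero_smul, zero_add, ad_eq_chainDer, chainDer_weight_comm]
  · exact LinearMap.mem_eigSum (A := Set.range fun n : ℕ => ((n + 1 : ℕ) : K)) (μ := 1)
      ⟨0, by simp⟩ (by rw [weight_mulSym_unitChain, one_smul])
  · refine map_mem_eigSum (ν := 1) (fun v => ?_) ?_ ht
    · rw [weight_mulSym, one_smul]
    · rintro _ ⟨n, rfl⟩
      exact ⟨n + 1, by push_cast; ring⟩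

include hE in
/-- Every cycle of degree two is homologous to `z₀ ∧ z₁ ∧ m` for an invariant `m ∈ L₁`. -/
theorem IsEuler.exists_wedge_wedge_mulSym {c : Chains K L₀ L₁} (hc : c ∈ cycles K δ 2) :
    ∃ m : L₁, (∀ i, ⁅D.z i, m⁆ = 0) ∧
      c - wedge K (D.z 0) (wedge K (D.z 1) (mulSym K m (unitChain K L₀ L₁))) ∈
        boundaries K δ 2 := by
  obtain ⟨b, hb, hbi, h⟩ := D.exists_wedge_wedge hc
  set Z : Submodule K L₁ := LinearMap.ker (LieModule.toEnd K L₀ L₁ (D.z 0)) ⊓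
    LinearMap.ker (LieModule.toEnd K L₀ L₁ (D.z 1)) with hZ
  have key : b ∈ (D.inv 1).map (diff K δ) ⊔
      Z.map ((mulSym K (L₀ := L₀)).flip (unitChain K L₀ L₁)) := by
    refine LinearMap.inf_eigSum_le (f := weight K L₀ L₁) (p := D.inv 0) ?_ ?_
      ⟨hbi, boundaries_zero_le hb⟩
    · intro v hv
      have h := D.mem_inv.1 hv
      refine D.mem_inv.2 ⟨chainDer_mem h.1, fun i => ?_⟩
      rw [ad_eq_chainDer, ← chainDer_weight_comm, ← ad_eq_chainDer, h.2, map_zero]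
    · rintro _ ⟨n, rfl⟩ v hv hvw
      obtain ⟨m, hm, hvm⟩ := hE.exists_sub_mulSym_mem hv hvw
      exact Submodule.mem_sup.2 ⟨_, hvm, _, ⟨m, ⟨hm 0, hm 1⟩, rfl⟩, by simp⟩
  obtain ⟨_, ⟨e, he, rfl⟩, _, ⟨m, hm, rfl⟩, rfl⟩ := Submodule.mem_sup.1 key
  refine ⟨m, by rw [Fin.forall_fin_two]; exact hm, ?_⟩
  have := add_mem h (D.wedge_wedge_diff_mem he)
  rw [map_add, map_add, LinearMap.flip_apply] at this
  convert this using 1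
  abel

end WeylData

end DGLie

/-! ### Monomials, exactness and the residue on the Jouanolou algebra -/

namespace Jouanolou

/-- The degree zero part `J⁰`. -/
def J₀ : Subalgebra ℂ J := Algebra.adjoin ℂ (Set.range z ∪ Set.range x)

theorem z_mem_J₀ (i : Fin 2) : z i ∈ J₀ := Algebra.subset_adjoin (Or.inl ⟨i, rfl⟩)

theorem x_mem_J₀ (i : Fin 2) : x i ∈ J₀ := Algebra.subset_adjoin (Or.inr ⟨i, rfl⟩)

/-- The monomials in `z¹, z², x¹, x²`. -/
def mono (a b p q : ℕ) : J := z 0 ^ a * z 1 ^ b * x 0 ^ p * x 1 ^ q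

theorem mono_mem_J₀ (a b p q : ℕ) : mono a b p q ∈ J₀ :=
  mul_mem (mul_mem (mul_mem (pow_mem (z_mem_J₀ 0) a) (pow_mem (z_mem_J₀ 1) b))
    (pow_mem (x_mem_J₀ 0) p)) (pow_mem (x_mem_J₀ 1) q)

theorem zx : z 0 * x 0 + z 1 * x 1 = 1 := by
  rw [← z_mul_x, Fin.sum_univ_two]

theorem mul_mono_mem {N : Submodule ℂ J} (h : ∀ a b p q, mono a b p q ∈ N) {g : J} (hg : g ∈ J₀) :
    g ∈ N := by
  suffices ∀ c ∈ Submodule.span ℂ {m | ∃ a b p q, m = mono a b p q},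
      g * c ∈ Submodule.span ℂ {m | ∃ a b p q, m = mono a b p q} by
    have h1 := this 1 (Submodule.subset_span ⟨0, 0, 0, 0, by simp [mono]⟩)
    rw [mul_one] at h1
    refine Submodule.span_le.2 ?_ h1
    rintro _ ⟨a, b, p, q, rfl⟩
    exact h a b p q
  refine Algebra.adjoin_induction (p := fun g _ => ∀ c ∈ Submodule.span ℂ
    {m | ∃ a b p q, m = mono a b p q}, g * c ∈ Submodule.span ℂ {m | ∃ a b p q, m = mono a b p q})
    ?_ ?_ ?_ ?_ hg
  · intro g hg c hc
    refine Submodule.span_induction (p := fun c _ => g * c ∈ Submodule.span ℂ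
      {m | ∃ a b p q, m = mono a b p q}) ?_ (by simp)
      (fun c d _ _ h h' => by rw [mul_add]; exact add_mem h h')
      (fun r c _ h => by rw [mul_smul_comm]; exact Submodule.smul_mem _ r h) hc
    rintro _ ⟨a, b, p, q, rfl⟩
    refine Submodule.subset_span ?_
    rcases hg with ⟨i, rfl⟩ | ⟨i, rfl⟩
    · fin_cases i
      · exact ⟨a + 1, b, p, q, by simp only [mono, Fin.zero_eta]; ring⟩
      · exact ⟨a, b + 1, p, q, by simp only [mono, Fin.mk_one]; ring⟩
    · fin_cases i
      · exact ⟨a, b, p + 1, q, by simp only [mono, Fin.zero_eta]; ring⟩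
      · exact ⟨a, b, p, q + 1, by simp only [mono, Fin.mk_one]; ring⟩
  · intro r c hc
    rw [← Algebra.smul_def]
    exact Submodule.smul_mem _ r hc
  · intro g g' _ _ h h' c hc
    rw [add_mul]
    exact add_mem (h c hc) (h' c hc)
  · intro g g' _ _ h h' c hc
    rw [mul_assoc]
    exact h _ (h' c hc)

theorem P_mul_P : P * P = 0 := by
  have h := fun i j => dx_mul_dx i j
  rw [P]
  linear_combination x 0 * x 0 * h 1 1 - 2 * x 0 * x 1 * h 0 1 + x 1 * x 1 * h 0 0

theorem pderiv_P (i : Fin 2) : pderiv i P = -2 * x i * P := by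
  rw [P]
  simp only [map_sub, Derivation.leibniz, smul_eq_mul, pderiv_x, pderiv_dx]
  ring

theorem dbar_P : dbar P = 0 := by
  rw [P]
  simp only [map_sub, Derivation.leibniz, smul_eq_mul, dbar_x, dbar_dx]
  ring

/-- `J = J⁰ + J⁰ P`. -/
theorem exists_eq_add (a : J) : ∃ g ∈ J₀, ∃ h ∈ J₀, a = g + h * P := by
  obtain ⟨p, rfl⟩ := proj_surjective a
  induction p using MvPolynomial.induction_on with
  | C r => exact ⟨algebraMap ℂ J r, J₀.algebraMap_mem r, 0, zero_mem _, by
      rw [zero_mul, add_zero]; exact proj.commutes r⟩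
  | add p q hp hq =>
    obtain ⟨g, hg, h, hh, e⟩ := hp
    obtain ⟨g', hg', h', hh', e'⟩ := hq
    exact ⟨g + g', add_mem hg hg', h + h', add_mem hh hh', by rw [map_add, e, e']; ring⟩
  | mul_X p i hp =>
    obtain ⟨g, hg, h, hh, e⟩ := hp
    rw [map_mul, e]
    rcases i with i | i | i
    · exact ⟨g * z i, mul_mem hg (z_mem_J₀ i), h * z i, mul_mem hh (z_mem_J₀ i), by
        rw [← z]; ring⟩
    · exact ⟨g * x i, mul_mem hg (x_mem_J₀ i), h * x i, mul_mem hh (x_mem_J₀ i), by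
        rw [← x]; ring⟩
    · rw [← dx]
      fin_cases i
      · refine ⟨0, zero_mem _, -(g * z 1), neg_mem (mul_mem hg (z_mem_J₀ 1)), ?_⟩
        simp only [Fin.zero_eta]
        rw [dx_eq.1]
        linear_combination -h * z 1 * P_mul_P
      · refine ⟨0, zero_mem _, g * z 0, mul_mem hg (z_mem_J₀ 0), ?_⟩
        simp only [Fin.mk_one]
        rw [dx_eq.2]
        linear_combination h * z 0 * P_mul_P

/-- `J¹ = J⁰ P`. -/
theorem mem_J₁_iff {w : J} : w ∈ J₁ ↔ ∃ g ∈ J₀, w = g * P := by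
  refine ⟨fun hw => ?_, fun ⟨g, _, h⟩ => h ▸ J₁.mul_mem_left g P_mem_J₁⟩
  have h1 : ∃ a : J, w = a * P := by
    refine Submodule.span_induction (p := fun w _ => ∃ a : J, w = a * P) ?_ ⟨0, by simp⟩ ?_ ?_ hw
    · rintro _ ⟨i, rfl⟩
      fin_cases i
      · exact ⟨-z 1, by simp only [Fin.zero_eta]; rw [dx_eq.1]; ring⟩
      · exact ⟨z 0, by simp only [Fin.mk_one]; rw [dx_eq.2]⟩
    · rintro _ _ _ _ ⟨a, rfl⟩ ⟨b, rfl⟩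
      exact ⟨a + b, by ring⟩
    · rintro r _ _ ⟨a, rfl⟩
      exact ⟨r * a, by rw [smul_eq_mul]; ring⟩
  obtain ⟨a, rfl⟩ := h1
  obtain ⟨g, hg, h, hh, rfl⟩ := exists_eq_add a
  exact ⟨g, hg, by linear_combination h * P_mul_P⟩

theorem dbar_mul_P (g : J) : dbar g * P = 0 := by
  obtain ⟨g, hg, h, hh, rfl⟩ := exists_eq_add g
  have hP : ∀ i, dx i * P = 0 := by
    intro i
    rw [P]
    linear_combination x 0 * dx_mul_dx i 1 - x 1 * dx_mul_dx i 0
  have h0 : ∀ g ∈ J₀, dbar g * P = 0 := by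
    intro g hg
    refine Algebra.adjoin_induction (p := fun g _ => dbar g * P = 0) ?_ (by simp) ?_ ?_ hg
    · rintro _ (⟨i, rfl⟩ | ⟨i, rfl⟩)
      · simp
      · rw [dbar_x, hP]
    · intro a b _ _ ha hb
      rw [map_add, add_mul, ha, hb, add_zero]
    · intro a b _ _ ha hb
      rw [Derivation.leibniz, smul_eq_mul, smul_eq_mul]
      linear_combination a * hb + b * ha
  rw [map_add, Derivation.leibniz, dbar_P, smul_zero, zero_add, smul_eq_mul]
  linear_combination h0 g hg + dbar h * P_mul_P

/-! ### Euler weights and exact forms -/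

/-- The Euler derivation `z¹∂₁ + z²∂₂`. -/
def euler : Derivation ℂ J J := z 0 • pderiv 0 + z 1 • pderiv 1

theorem euler_apply (a : J) : euler a = z 0 * pderiv 0 a + z 1 * pderiv 1 a := rfl

theorem euler_z (i : Fin 2) : euler (z i) = (1 : ℂ) • z i := by
  rw [euler_apply, one_smul]
  fin_cases i <;> simp

theorem euler_x (i : Fin 2) : euler (x i) = (-1 : ℂ) • x i := by
  rw [euler_apply, pderiv_x, pderiv_x, neg_smul, one_smul]
  linear_combination -x i * zx

theorem euler_P : euler P = (-2 : ℂ) • P := by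
  rw [euler_apply, pderiv_P, pderiv_P, neg_smul, ofNat_smul_eq_nsmul ℂ, nsmul_eq_mul]
  push_cast
  linear_combination -2 * P * zx

theorem euler_mul {f g : J} {μ ν : ℂ} (hf : euler f = μ • f) (hg : euler g = ν • g) :
    euler (f * g) = (μ + ν) • (f * g) := by
  rw [Derivation.leibniz, hf, hg, smul_eq_mul, smul_eq_mul, mul_smul_comm, mul_smul_comm,
    mul_comm g, ← add_smul, add_comm]

theorem euler_pow {f : J} {μ : ℂ} (hf : euler f = μ • f) (n : ℕ) :
    euler (f ^ n) = (n * μ) • f ^ n := by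
  induction n with
  | zero => simp
  | succ n ih =>
    rw [pow_succ, euler_mul ih hf]
    congr 1
    push_cast; ring

theorem euler_mono (a b p q : ℕ) :
    euler (mono a b p q) = ((a : ℂ) + b - p - q) • mono a b p q := by
  rw [mono, euler_mul (euler_mul (euler_mul (euler_pow (euler_z 0) a) (euler_pow (euler_z 1) b))
    (euler_pow (euler_x 0) p)) (euler_pow (euler_x 1) q)]
  congr 1
  ring

theorem pderiv_zero_mono (a b p q : ℕ) : pderiv 0 (mono a b p q) =
    (a : ℂ) • mono (a - 1) b p q - ((p + q : ℕ) : ℂ) • mono a b (p + 1) q := by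
  have hz1 : pderiv 0 (z 1) = 0 := by simp
  have hz0 : pderiv 0 (z 0) = 1 := by simp
  have e1 : pderiv 0 (x 0 ^ p) = -(p * x 0 ^ (p + 1)) := by
    rw [Derivation.leibniz_pow, pderiv_x]
    rcases p with _ | p
    · simp
    · simp only [nsmul_eq_mul, smul_eq_mul, Nat.add_sub_cancel]; ring
  have e2 : pderiv 0 (x 1 ^ q) = -(q * x 0 * x 1 ^ q) := by
    rw [Derivation.leibniz_pow, pderiv_x]
    rcases q with _ | q
    · simp
    · simp only [nsmul_eq_mul, smul_eq_mul, Nat.add_sub_cancel]; ring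
  simp only [mono, Derivation.leibniz, smul_eq_mul, e1, e2]
  rw [Derivation.leibniz_pow, Derivation.leibniz_pow, hz0, hz1]
  simp only [Nat.cast_smul_eq_nsmul ℂ, nsmul_eq_mul, smul_eq_mul]
  push_cast
  ring

theorem pderiv_one_mono (a b p q : ℕ) : pderiv 1 (mono a b p q) =
    (b : ℂ) • mono a (b - 1) p q - ((p + q : ℕ) : ℂ) • mono a b p (q + 1) := by
  have hz1 : pderiv 1 (z 1) = 1 := by simp
  have hz0 : pderiv 1 (z 0) = 0 := by simp
  have e1 : pderiv 1 (x 0 ^ p) = -(p * x 1 * x 0 ^ p) := by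
    rw [Derivation.leibniz_pow, pderiv_x]
    rcases p with _ | p
    · simp
    · simp only [nsmul_eq_mul, smul_eq_mul, Nat.add_sub_cancel]; ring
  have e2 : pderiv 1 (x 1 ^ q) = -(q * x 1 ^ (q + 1)) := by
    rw [Derivation.leibniz_pow, pderiv_x]
    rcases q with _ | q
    · simp
    · simp only [nsmul_eq_mul, smul_eq_mul, Nat.add_sub_cancel]; ring
  simp only [mono, Derivation.leibniz, smul_eq_mul, e1, e2]
  rw [Derivation.leibniz_pow, Derivation.leibniz_pow, hz0, hz1]
  simp only [Nat.cast_smul_eq_nsmul ℂ, nsmul_eq_mul, smul_eq_mul]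
  push_cast
  ring

/-- Everything is expressed through P by ∂̄x¹ = -z²P and ∂̄x² = z¹P. Truncated subtraction is
harmless, as a zero exponent comes with a zero coefficient. -/
theorem dbar_mono (a b p q : ℕ) : dbar (mono a b p q) =
    ((q : ℂ) • mono (a + 1) b p (q - 1) - (p : ℂ) • mono a (b + 1) (p - 1) q) * P := by
  simp only [mono, Derivation.leibniz, smul_eq_mul]
  simp only [Derivation.leibniz_pow, dbar_z, dbar_x, dx_eq.1, dx_eq.2, smul_zero, mul_zero,
    Nat.cast_smul_eq_nsmul ℂ, nsmul_eq_mul, smul_eq_mul]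
  ring

/-- Functions `f` such that `f P` is exact. -/
def exactCoeff : Submodule ℂ J :=
  ((Subalgebra.toSubmodule J₀).map (dbar : J →ₗ[ℂ] J)).comap (LinearMap.mulRight ℂ P)

theorem mem_exactCoeff {f : J} : f ∈ exactCoeff ↔ ∃ g ∈ J₀, dbar g = f * P := Iff.rfl

theorem sub_mem_exactCoeff (a b p q : ℕ) :
    (q : ℂ) • mono (a + 1) b p (q - 1) - (p : ℂ) • mono a (b + 1) (p - 1) q ∈ exactCoeff :=
  ⟨mono a b p q, mono_mem_J₀ a b p q, dbar_mono a b p q⟩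

/-- Modulo exact forms, a factor z¹x¹ can be traded for z²x² up to a nonzero scalar. This lowers
both `a` and `p` by one, until `p = 0`, where the monomial is exact by itself. -/
theorem mono_mem_exactCoeff_of_lt {a b p q : ℕ} (h : p < a) : mono a b p q ∈ exactCoeff := by
  induction p generalizing a b q with
  | zero =>
    obtain ⟨a, rfl⟩ : ∃ a', a = a' + 1 := ⟨a - 1, by omega⟩
    have := sub_mem_exactCoeff a b 0 (q + 1)
    rw [Nat.cast_zero, zero_smul, sub_zero] at this
    exact (Submodule.smul_mem_iff _ (Nat.cast_ne_zero.2 q.succ_ne_zero)).1 this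
  | succ p ih =>
    obtain ⟨a, rfl⟩ : ∃ a', a = a' + 1 := ⟨a - 1, by omega⟩
    have := sub_mem_exactCoeff a b (p + 1) (q + 1)
    have h2 : mono a (b + 1) (p + 1 - 1) (q + 1) ∈ exactCoeff := ih (by omega)
    have h3 := add_mem this (Submodule.smul_mem _ ((p + 1 : ℕ) : ℂ) h2)
    rw [sub_add_cancel] at h3
    exact (Submodule.smul_mem_iff _ (Nat.cast_ne_zero.2 q.succ_ne_zero)).1 h3

theorem mono_mem_exactCoeff_of_lt' {a b p q : ℕ} (h : q < b) : mono a b p q ∈ exactCoeff := by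
  induction q generalizing a b p with
  | zero =>
    obtain ⟨b, rfl⟩ : ∃ b', b = b' + 1 := ⟨b - 1, by omega⟩
    have := neg_mem (sub_mem_exactCoeff a b (p + 1) 0)
    rw [Nat.cast_zero, zero_smul, zero_sub, neg_neg] at this
    exact (Submodule.smul_mem_iff _ (Nat.cast_ne_zero.2 p.succ_ne_zero)).1 this
  | succ q ih =>
    obtain ⟨b, rfl⟩ : ∃ b', b = b' + 1 := ⟨b - 1, by omega⟩
    have := sub_mem_exactCoeff a b (p + 1) (q + 1)
    have h2 : mono (a + 1) b (p + 1) (q + 1 - 1) ∈ exactCoeff := ih (by omega)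
    have h3 := sub_mem (Submodule.smul_mem _ ((q + 1 : ℕ) : ℂ) h2) this
    rw [sub_sub_cancel] at h3
    exact (Submodule.smul_mem_iff _ (Nat.cast_ne_zero.2 p.succ_ne_zero)).1 h3

theorem mono_eq_add (a b p q : ℕ) :
    mono a b p q = mono (a + 1) b (p + 1) q + mono a (b + 1) p (q + 1) := by
  simp only [mono]
  linear_combination -(z 0 ^ a * z 1 ^ b * x 0 ^ p * x 1 ^ q) * zx

/-- The two diagonal monomials obtained by inserting z¹x¹ or z²x² have the given monomial as sum,
and `b + 1` times the first minus `a + 1` times the second is exact. This linear system has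
determinant ±(a + b + 2), so both are multiples of the given one modulo exact forms. -/
theorem mono_diag_mem (a b : ℕ) : mono a b a b ∈ (ℂ ∙ (1 : J)) ⊔ exactCoeff := by
  have key : ∀ a b, mono a b a b ∈ (ℂ ∙ (1 : J)) ⊔ exactCoeff →
      mono (a + 1) b (a + 1) b ∈ (ℂ ∙ (1 : J)) ⊔ exactCoeff ∧
      mono a (b + 1) a (b + 1) ∈ (ℂ ∙ (1 : J)) ⊔ exactCoeff := by
    intro a b h
    have hne : ((a + b + 2 : ℕ) : ℂ) ≠ 0 := Nat.cast_ne_zero.2 (by omega)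
    have h1 : ((b + 1 : ℕ) : ℂ) • mono (a + 1) b (a + 1) b -
        ((a + 1 : ℕ) : ℂ) • mono a (b + 1) a (b + 1) ∈ (ℂ ∙ (1 : J)) ⊔ exactCoeff :=
      Submodule.mem_sup_right (sub_mem_exactCoeff a b (a + 1) (b + 1))
    have e := mono_eq_add a b a b
    constructor
    · refine (Submodule.smul_mem_iff _ hne).1 ?_
      convert add_mem (Submodule.smul_mem _ ((a + 1 : ℕ) : ℂ) h) h1 using 1
      rw [e]
      push_cast
      module
    · refine (Submodule.smul_mem_iff _ hne).1 ?_
      convert sub_mem (Submodule.smul_mem _ ((b + 1 : ℕ) : ℂ) h) h1 using 1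
      rw [e]
      push_cast
      module
  induction a with
  | zero =>
    induction b with
    | zero =>
      refine Submodule.mem_sup_left ?_
      simp [mono, Submodule.mem_span_singleton_self]
    | succ b ih => exact (key 0 b ih).2
  | succ a ih => exact (key a b ih).1

/-! ### The residue functional -/

/-- The values of the residue functional on monomial multiples of `P`. -/
def resCoeff (a b p q : ℕ) : ℂ :=
  if a = p ∧ b = q then (a.factorial * b.factorial : ℂ) / (a + b + 1).factorial else 0

/-- On the diagonal the value is the beta integral of tᵃ(1 - t)ᵇ over [0, 1], and the recursion is 1
= t + (1 - t). It is what makes the residue compatible with z¹x¹ + z²x² = 1. -/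
theorem resCoeff_eq_add (a b p q : ℕ) :
    resCoeff a b p q = resCoeff (a + 1) b (p + 1) q + resCoeff a (b + 1) p (q + 1) := by
  simp only [resCoeff, add_left_inj]
  split_ifs with h
  · rw [show a + 1 + b + 1 = (a + b + 1) + 1 by ring, show a + (b + 1) + 1 = (a + b + 1) + 1 by ring,
      Nat.factorial_succ (a + b + 1), Nat.factorial_succ a, Nat.factorial_succ b]
    have h1 : ((a + b + 1).factorial : ℂ) ≠ 0 := Nat.cast_ne_zero.2 (Nat.factorial_ne_zero _)
    have h2 : ((a + b + 1 + 1 : ℕ) : ℂ) ≠ 0 := Nat.cast_ne_zero.2 (by omega)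
    push_cast at h2 ⊢
    field_simp
    ring
  · simp

theorem resCoeff_dbar (a b p q : ℕ) :
    (q : ℂ) * resCoeff (a + 1) b p (q - 1) - p * resCoeff a (b + 1) (p - 1) q = 0 := by
  rcases p with _ | p <;> rcases q with _ | q
  · simp
  · simp [resCoeff]
  · simp [resCoeff]
  · simp only [resCoeff, Nat.add_sub_cancel, add_left_inj]
    split_ifs with h
    · obtain ⟨rfl, rfl⟩ := h
      rw [show a + 1 + b + 1 = a + (b + 1) + 1 by ring, Nat.factorial_succ a, Nat.factorial_succ b]
      push_cast
      ring
    · simp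

/-- In `p + q + 2` the summand `p + q` comes from differentiating the powers of x¹ and x², and the 2
from ∂₁P = -2x¹P. -/
theorem resCoeff_pderiv_zero (a b p q : ℕ) :
    (a : ℂ) * resCoeff (a - 1) b p q - (p + q + 2) * resCoeff a b (p + 1) q = 0 := by
  rcases a with _ | a
  · simp [resCoeff]
  · simp only [resCoeff, Nat.add_sub_cancel, add_left_inj]
    split_ifs with h
    · obtain ⟨rfl, rfl⟩ := h
      rw [show a + 1 + b + 1 = (a + b + 1) + 1 by ring, Nat.factorial_succ (a + b + 1),
        Nat.factorial_succ a]
      have h1 : ((a + b + 1).factorial : ℂ) ≠ 0 := Nat.cast_ne_zero.2 (Nat.factorial_ne_zero _)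
      have h2 : ((a + b + 1 + 1 : ℕ) : ℂ) ≠ 0 := Nat.cast_ne_zero.2 (by omega)
      push_cast at h2 ⊢
      field_simp
      ring
    · simp

theorem resCoeff_comm (a b p q : ℕ) : resCoeff a b p q = resCoeff b a q p := by
  simp only [resCoeff, and_comm, add_comm a b, mul_comm (a.factorial : ℂ)]

theorem resCoeff_pderiv_one (a b p q : ℕ) :
    (b : ℂ) * resCoeff a (b - 1) p q - (p + q + 2) * resCoeff a b p (q + 1) = 0 := by
  rw [resCoeff_comm a, resCoeff_comm a b, add_comm (p : ℂ)]
  exact resCoeff_pderiv_zero b a q p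

open MvPolynomial in
/-- The residue on the polynomial ring that presents `J`, on monomials. -/
def resGen (μ : Gen →₀ ℕ) : ℂ :=
  -- Only monomials linear in dx¹, dx² contribute. The signs and the shifts by one come from dx¹ =
  -- -z²P and dx² = z¹P.
  if μ (.dx 0) = 1 ∧ μ (.dx 1) = 0 then
    -resCoeff (μ (.z 0)) (μ (.z 1) + 1) (μ (.x 0)) (μ (.x 1))
  else if μ (.dx 0) = 0 ∧ μ (.dx 1) = 1 then
    resCoeff (μ (.z 0) + 1) (μ (.z 1)) (μ (.x 0)) (μ (.x 1))
  else 0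

/-- The residue on the polynomial ring that presents `J`. -/
def resPoly : MvPolynomial Gen ℂ →ₗ[ℂ] ℂ := (MvPolynomial.basisMonomials Gen ℂ).constr ℂ resGen

theorem resPoly_monomial (μ : Gen →₀ ℕ) : resPoly (MvPolynomial.monomial μ 1) = resGen μ := by
  have := (MvPolynomial.basisMonomials Gen ℂ).constr_basis ℂ resGen μ
  rwa [MvPolynomial.coe_basisMonomials] at this

open MvPolynomial in
-- The relation for zx is the recursion `resCoeff_eq_add`, the one for z dx is a cancellation of
-- signs, and multiples of dxⁱdxʲ have degree at least two in the dx.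
theorem resPoly_rel (μ : Gen →₀ ℕ) {r : MvPolynomial Gen ℂ} (hr : Rel r) :
    resPoly (monomial μ 1 * r) = 0 := by
  classical
  have hX : ∀ i : Gen, (X i : MvPolynomial Gen ℂ) = monomial (Finsupp.single i 1) 1 := fun _ => rfl
  rcases hr with _ | _ | ⟨i, j⟩
  · rw [mul_sub, mul_one, Fin.sum_univ_two]
    simp only [hX, mul_add, monomial_mul, map_add, map_sub, mul_one, resPoly_monomial]
    simp only [resGen, Finsupp.add_apply, Finsupp.single_apply, reduceCtorEq, if_false, add_zero,
      Gen.z.injEq, Gen.x.injEq, if_true, zero_add, Fin.zero_eq_one_iff, Fin.one_eq_zero_iff,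
      OfNat.ofNat_ne_one]
    split_ifs
    · rw [resCoeff_eq_add (μ (.z 0)) (μ (.z 1) + 1)]; ring
    · rw [resCoeff_eq_add (μ (.z 0) + 1) (μ (.z 1))]; ring
    · ring
  · rw [Fin.sum_univ_two]
    simp only [hX, mul_add, monomial_mul, map_add, mul_one, resPoly_monomial]
    simp only [resGen, Finsupp.add_apply, Finsupp.single_apply, reduceCtorEq, if_false, add_zero,
      Gen.z.injEq, Gen.dx.injEq, if_true, zero_add, Fin.zero_eq_one_iff, Fin.one_eq_zero_iff,
      OfNat.ofNat_ne_one]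
    simp only [Nat.add_eq_right, and_false, false_and, if_false]
    split_ifs <;> ring
  · simp only [hX, monomial_mul, mul_one, resPoly_monomial]
    simp only [resGen, Finsupp.add_apply, Finsupp.single_apply, Gen.dx.injEq]
    rw [if_neg, if_neg]
    · fin_cases i <;> fin_cases j <;> simp
    · fin_cases i <;> fin_cases j <;> simp

theorem resPoly_eq_zero {p : MvPolynomial Gen ℂ} (hp : p ∈ relIdeal) : resPoly p = 0 := by
  refine Submodule.span_induction (p := fun p _ => ∀ t, resPoly (t * p) = 0) ?_ (by simp)
    (fun a b _ _ ha hb t => by rw [mul_add, map_add, ha, hb, add_zero])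
    (fun r a _ ha t => by rw [smul_eq_mul, ← mul_assoc, ha]) hp 1 |> (by simpa using ·)
  intro r hr t
  induction t using MvPolynomial.induction_on' with
  | monomial μ c =>
    rw [show MvPolynomial.monomial μ c = c • MvPolynomial.monomial μ (1 : ℂ) by
      rw [MvPolynomial.smul_monomial, smul_eq_mul, mul_one], smul_mul_assoc, map_smul,
      resPoly_rel μ hr, smul_zero]
  | add a b ha hb => rw [add_mul, map_add, ha, hb, add_zero]

theorem exists_res : ∃ ρ : J →ₗ[ℂ] ℂ, ∀ p, ρ (proj p) = resPoly p := by
  obtain ⟨s, hs⟩ := LinearMap.exists_rightInverse_of_surjective proj.toLinearMap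
    (LinearMap.range_eq_top.2 proj_surjective)
  refine ⟨resPoly ∘ₗ s, fun p => ?_⟩
  have h1 : proj (s (proj p) - p) = 0 := by
    rw [map_sub, sub_eq_zero]
    exact LinearMap.congr_fun hs (proj p)
  have h2 := resPoly_eq_zero (proj_eq_zero_iff.1 h1)
  rwa [map_sub, sub_eq_zero] at h2

/-- The residue functional on `J`. -/
def res : J →ₗ[ℂ] ℂ := exists_res.choose

theorem res_proj (p : MvPolynomial Gen ℂ) : res (proj p) = resPoly p := exists_res.choose_spec p

open MvPolynomial in
-- Expanding P = x¹dx² - x²dx¹ gives two monomials whose residues are the two summands in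
-- `resCoeff_eq_add`.
theorem res_mono_mul_P (a b p q : ℕ) : res (mono a b p q * P) = resCoeff a b p q := by
  classical
  set μ : Gen →₀ ℕ := Finsupp.single (.z 0) a + Finsupp.single (.z 1) b +
    Finsupp.single (.x 0) p + Finsupp.single (.x 1) q with hμ
  have h1 : mono a b p q * P = proj (monomial (μ + Finsupp.single (.x 0) 1 +
      Finsupp.single (.dx 1) 1) 1 - monomial (μ + Finsupp.single (.x 1) 1 +
      Finsupp.single (.dx 0) 1) 1) := by
    have e : mono a b p q = proj (monomial μ 1) := by
      have : monomial μ (1 : ℂ) = X (.z 0) ^ a * X (.z 1) ^ b * X (.x 0) ^ p * X (.x 1) ^ q := by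
        simp only [X_pow_eq_monomial, monomial_mul, mul_one, hμ]
      rw [this]
      simp [mono, z, x]
    have e2 : P = proj (X (.x 0) * X (.dx 1) - X (.x 1) * X (.dx 0)) := by
      simp [P, x, dx]
    rw [e, e2, ← map_mul]
    congr 1
    simp only [X, mul_sub, monomial_mul, mul_one, add_assoc]
  rw [h1, res_proj, map_sub, resPoly_monomial, resPoly_monomial, resCoeff_eq_add a b p q]
  simp [resGen, hμ]

theorem mul_P_induction {ρ : J →ₗ[ℂ] ℂ} (h : ∀ a b p q, ρ (mono a b p q * P) = 0) {w : J}
    (hw : w ∈ J₁) : ρ w = 0 := by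
  obtain ⟨g, hg, rfl⟩ := mem_J₁_iff.1 hw
  exact mul_mono_mem (N := LinearMap.ker (ρ ∘ₗ LinearMap.mulRight ℂ P)) h hg

theorem res_P : res P = 1 := by
  have := res_mono_mul_P 0 0 0 0
  simpa [mono, resCoeff] using this

theorem res_dbar (f : J) : res (dbar f) = 0 := by
  obtain ⟨g, hg, h, hh, rfl⟩ := exists_eq_add f
  rw [map_add, Derivation.leibniz, dbar_P, smul_zero, zero_add, smul_eq_mul, mul_comm,
    dbar_mul_P, add_zero]
  refine mul_mono_mem (N := LinearMap.ker (res ∘ₗ (dbar : J →ₗ[ℂ] J))) (fun a b p q => ?_) hg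
  rw [LinearMap.mem_ker, LinearMap.comp_apply]
  change res (dbar _) = 0
  rw [dbar_mono, sub_mul, smul_mul_assoc, smul_mul_assoc, map_sub, map_smul, map_smul,
    res_mono_mul_P, res_mono_mul_P, smul_eq_mul, smul_eq_mul, resCoeff_dbar]

/-- This is integration by parts for the residue; its role is in `resLie_rightDiff`. -/
theorem res_pderiv (i : Fin 2) {w : J} (hw : w ∈ J₁) : res (pderiv i w) = 0 := by
  refine mul_P_induction (ρ := res ∘ₗ (pderiv i : J →ₗ[ℂ] J)) (fun a b p q => ?_) hw
  change res (pderiv i _) = 0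
  rw [Derivation.leibniz, pderiv_P, smul_eq_mul, smul_eq_mul]
  fin_cases i
  · simp only [Fin.zero_eta]
    have : mono a b p q * (-2 * x 0 * P) + P * pderiv 0 (mono a b p q) =
        (a : ℂ) • (mono (a - 1) b p q * P) - ((p : ℂ) + q + 2) • (mono a b (p + 1) q * P) := by
      have e : mono a b (p + 1) q = mono a b p q * x 0 := by simp only [mono]; ring
      rw [pderiv_zero_mono, e, show ((p : ℂ) + q + 2) = ((p + q + 2 : ℕ) : ℂ) by push_cast; ring]
      simp only [Nat.cast_smul_eq_nsmul ℂ, nsmul_eq_mul]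
      push_cast
      ring
    rw [this, map_sub, map_smul, map_smul, res_mono_mul_P, res_mono_mul_P, smul_eq_mul,
      smul_eq_mul, resCoeff_pderiv_zero]
  · simp only [Fin.mk_one]
    have : mono a b p q * (-2 * x 1 * P) + P * pderiv 1 (mono a b p q) =
        (b : ℂ) • (mono a (b - 1) p q * P) - ((p : ℂ) + q + 2) • (mono a b p (q + 1) * P) := by
      have e : mono a b p (q + 1) = mono a b p q * x 1 := by simp only [mono]; ring
      rw [pderiv_one_mono, e, show ((p : ℂ) + q + 2) = ((p + q + 2 : ℕ) : ℂ) by push_cast; ring]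
      simp only [Nat.cast_smul_eq_nsmul ℂ, nsmul_eq_mul]
      push_cast
      ring
    rw [this, map_sub, map_smul, map_smul, res_mono_mul_P, res_mono_mul_P, smul_eq_mul,
      smul_eq_mul, resCoeff_pderiv_one]

end Jouanolou

/-! ### Weyl pairs and the Euler element on polynomial differential operators -/

namespace Jouanolou

open LinearMap (IsNil eigSum stableSpan)

theorem pderiv_comm (i j : Fin 2) (a : J) : pderiv i (pderiv j a) = pderiv j (pderiv i a) := by
  have h : ⁅pderiv i, pderiv j⁆ = 0 := by
    refine derivation_ext ?_ ?_ ?_ <;> intro k <;> rw [Derivation.commutator_apply]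
    · simp only [pderiv_z]
      split_ifs <;> simp
    · simp only [pderiv_x, map_neg, Derivation.leibniz, smul_eq_mul, Derivation.zero_apply]
      ring
    · simp only [pderiv_dx, map_neg, map_add, Derivation.leibniz, smul_eq_mul, pderiv_x,
        Derivation.zero_apply]
      ring
  have := DFunLike.congr_fun h a
  rwa [Derivation.commutator_apply, Derivation.zero_apply, sub_eq_zero] at this

theorem partialOp_comm (i j : Fin 2) : partialOp i * partialOp j = partialOp j * partialOp i :=
  LinearMap.ext fun a => pderiv_comm i j a

theorem partialOp_mem (i : Fin 2) : partialOp i ∈ D₀ := Algebra.subset_adjoin (IsGen₀.partialOp i)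

theorem mul_mem_D₀ {g : J} (hg : g ∈ J₀) : mul g ∈ D₀ := by
  refine Algebra.adjoin_induction (p := fun g _ => mul g ∈ D₀) ?_ ?_ ?_ ?_ hg
  · rintro _ (⟨i, rfl⟩ | ⟨i, rfl⟩)
    exacts [Algebra.subset_adjoin (IsGen₀.z i), Algebra.subset_adjoin (IsGen₀.x i)]
  · intro r
    rw [AlgHom.commutes]
    exact D₀.algebraMap_mem r
  · intro a b _ _ ha hb
    rw [map_add]; exact add_mem ha hb
  · intro a b _ _ ha hb
    rw [map_mul]; exact mul_mem ha hb

theorem pderiv_mem_J₀ (i : Fin 2) {g : J} (hg : g ∈ J₀) : pderiv i g ∈ J₀ := by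
  refine Algebra.adjoin_induction (p := fun g _ => pderiv i g ∈ J₀) ?_ ?_ ?_ ?_ hg
  · rintro _ (⟨j, rfl⟩ | ⟨j, rfl⟩)
    · rw [pderiv_z]
      split_ifs
      exacts [one_mem _, zero_mem _]
    · rw [pderiv_x]
      exact neg_mem (mul_mem (x_mem_J₀ i) (x_mem_J₀ j))
  · intro r
    rw [Derivation.map_algebraMap]; exact zero_mem _
  · intro a b _ _ ha hb
    rw [map_add]; exact add_mem ha hb
  · intro a b ha hb ha' hb'
    rw [Derivation.leibniz, smul_eq_mul, smul_eq_mul]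
    exact add_mem (mul_mem ha hb') (mul_mem hb ha')

/-- Every operator in `D₀` is a combination of the operators `g ∂₁ᶜ ∂₂ᵉ` with `g ∈ J⁰`. -/
theorem D₀_le {N : Submodule ℂ (Module.End ℂ J)}
    (h : ∀ g ∈ J₀, ∀ c e : ℕ, mul g * partialOp 0 ^ c * partialOp 1 ^ e ∈ N)
    {T : Module.End ℂ J} (hT : T ∈ D₀) : T ∈ N := by
  set M := Submodule.span ℂ {T : Module.End ℂ J | ∃ g ∈ J₀, ∃ c e : ℕ,
    T = mul g * partialOp 0 ^ c * partialOp 1 ^ e} with hM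
  have hgen : ∀ g ∈ J₀, ∀ c e : ℕ, mul g * partialOp 0 ^ c * partialOp 1 ^ e ∈ M :=
    fun g hg c e => Submodule.subset_span ⟨g, hg, c, e, rfl⟩
  suffices T * 1 ∈ M by
    rw [mul_one] at this
    refine Submodule.span_le.2 ?_ this
    rintro _ ⟨g, hg, c, e, rfl⟩
    exact h g hg c e
  have h1 : (1 : Module.End ℂ J) ∈ M := by
    have := hgen 1 (one_mem _) 0 0
    rwa [map_one, pow_zero, pow_zero, mul_one, mul_one] at this
  have hstab : ∀ T : Module.End ℂ J, (∀ g ∈ J₀, ∀ c e : ℕ,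
      T * (mul g * partialOp 0 ^ c * partialOp 1 ^ e) ∈ M) → ∀ S ∈ M, T * S ∈ M := by
    intro T hT S hS
    refine Submodule.span_induction (p := fun S _ => T * S ∈ M) ?_ (by simp)
      (fun S S' _ _ h h' => by rw [mul_add]; exact add_mem h h')
      (fun r S _ h => by rw [mul_smul_comm]; exact Submodule.smul_mem _ r h) hS
    rintro _ ⟨g, hg, c, e, rfl⟩
    exact hT g hg c e
  refine Algebra.adjoin_induction (p := fun T _ => ∀ S ∈ M, T * S ∈ M) ?_ ?_ ?_ ?_ hT 1 h1
  · rintro _ (i | i | i)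
    · refine hstab _ fun g hg c e => ?_
      rw [← mul_assoc, ← mul_assoc, ← map_mul]
      exact hgen _ (mul_mem (z_mem_J₀ i) hg) c e
    · refine hstab _ fun g hg c e => ?_
      rw [← mul_assoc, ← mul_assoc, ← map_mul]
      exact hgen _ (mul_mem (x_mem_J₀ i) hg) c e
    · refine hstab _ fun g hg c e => ?_
      rw [← mul_assoc, ← mul_assoc, partialOp_mul, add_mul, add_mul]
      refine add_mem (hgen _ (pderiv_mem_J₀ i hg) c e) ?_
      fin_cases i
      · simp only [Fin.zero_eta]
        rw [mul_assoc (mul g), ← pow_succ']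
        exact hgen g hg (c + 1) e
      · simp only [Fin.mk_one]
        rw [mul_assoc (mul g), (Commute.pow_right (partialOp_comm 1 0) c).eq, mul_assoc, mul_assoc,
          ← pow_succ', ← mul_assoc]
        exact hgen g hg c (e + 1)
  · intro r S hS
    rw [← Algebra.smul_def]
    exact Submodule.smul_mem _ r hS
  · intro T T' _ _ h h' S hS
    rw [add_mul]; exact add_mem (h S hS) (h' S hS)
  · intro T T' _ _ h h' S hS
    rw [mul_assoc]; exact h _ (h' S hS)

/-- Every operator in `D₁` is a combination of the operators `w ∂₁ᶜ ∂₂ᵉ` with `w` a monomial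
multiple of `P`. -/
theorem D₁_le {N : Submodule ℂ (Module.End ℂ J)}
    (h : ∀ a b p q c e : ℕ, mul (mono a b p q * P) * partialOp 0 ^ c * partialOp 1 ^ e ∈ N)
    {T : Module.End ℂ J} (hT : T ∈ D₁) : T ∈ N := by
  refine D₁_induction (C := fun T => T ∈ N) (fun w hw T hT => ?_) (fun _ _ => add_mem) hT
  obtain ⟨g, hg, rfl⟩ := mem_J₁_iff.1 hw
  refine D₀_le (N := N.comap (LinearMap.mulLeft ℂ (mul (g * P)))) (fun g' hg' c e => ?_) hT
  rw [Submodule.mem_comap, LinearMap.mulLeft_apply, ← mul_assoc, ← mul_assoc, ← map_mul,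
    mul_right_comm g]
  refine mul_mono_mem (N := N.comap (LinearMap.mulRight ℂ (partialOp 1 ^ e) ∘ₗ
    LinearMap.mulRight ℂ (partialOp 0 ^ c) ∘ₗ mul.toLinearMap ∘ₗ LinearMap.mulRight ℂ P))
    (fun a b p q => ?_) (mul_mem hg hg')
  exact h a b p q c e

/-- Minus right multiplication by `∂ᵢ` on `L₀`. -/
def rightMul₀ (i : Fin 2) : Module.End ℂ L₀ where
  toFun T := mk₀ (-(op₀ T * partialOp i)) (neg_mem (mul_mem (op₀_mem T) (partialOp_mem i)))
  map_add' T T' := op₀_injective (by simp only [op₀_mk₀, map_add, add_mul, neg_add])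
  map_smul' r T := op₀_injective (by
    simp only [op₀_mk₀, map_smul, smul_mul_assoc, smul_neg, RingHom.id_apply])

/-- Minus right multiplication by `∂ᵢ` on `L₁`. -/
def rightMul₁ (i : Fin 2) : Module.End ℂ L₁ where
  toFun T := mk₁ (-(op₁ T * partialOp i)) (neg_mem (D₁_mul_D₀ (partialOp_mem i) (op₁_mem T)))
  map_add' T T' := op₁_injective (by simp only [op₁_mk₁, map_add, add_mul, neg_add])
  map_smul' r T := op₁_injective (by
    simp only [op₁_mk₁, map_smul, smul_mul_assoc, smul_neg, RingHom.id_apply])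

theorem op₀_rightMul₀ (i : Fin 2) (T : L₀) : op₀ (rightMul₀ i T) = -(op₀ T * partialOp i) := rfl

theorem op₁_rightMul₁ (i : Fin 2) (T : L₁) : op₁ (rightMul₁ i T) = -(op₁ T * partialOp i) := rfl

/-- The elements of `L₀` of order zero. -/
def order₀ : Submodule ℂ L₀ := ((Subalgebra.toSubmodule J₀).map mul.toLinearMap).comap op₀

/-- The elements of `L₁` of order zero. -/
def order₁ : Submodule ℂ L₁ := ((J₁.restrictScalars ℂ).map mul.toLinearMap).comap op₁

theorem mem_order₀ {T : L₀} : T ∈ order₀ ↔ ∃ g ∈ J₀, mul g = op₀ T := Iff.rfl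

theorem mem_order₁ {T : L₁} : T ∈ order₁ ↔ ∃ w ∈ J₁, mul w = op₁ T := Iff.rfl

/-- This passes from stability under the abstract operators `R i` to normally ordered products, so
that `D₀_le` and `D₁_le` show that order zero generates everything. -/
theorem mul_pow_mem_map {L : Type*} [AddCommGroup L] [Module ℂ L] {op : L →ₗ[ℂ] Module.End ℂ J}
    {R : Fin 2 → Module.End ℂ L} (hR : ∀ i T, op (R i T) = -(op T * partialOp i))
    {N : Submodule ℂ L} (h : ∀ i, ∀ T ∈ N, R i T ∈ N) {S : Module.End ℂ J} (hS : S ∈ N.map op)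
    (c e : ℕ) : S * partialOp 0 ^ c * partialOp 1 ^ e ∈ N.map op := by
  have key : ∀ i (n : ℕ), ∀ S ∈ N.map op, S * partialOp i ^ n ∈ N.map op := by
    intro i n
    induction n with
    | zero => simp
    | succ n ih =>
      intro S hS
      obtain ⟨T, hT, hTS⟩ := ih S hS
      refine ⟨-R i T, neg_mem (h i T hT), ?_⟩
      rw [map_neg, hR, hTS, neg_neg, pow_succ, mul_assoc]
  exact key 1 e _ (key 0 c S hS)

theorem stableSpan_order₀ : stableSpan (rightMul₀ 0) (rightMul₀ 1) order₀ = ⊤ := by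
  refine eq_top_iff.2 fun T _ => ?_
  have h := D₀_le (N := (stableSpan (rightMul₀ 0) (rightMul₀ 1) order₀).map op₀)
    (fun g hg c e => mul_pow_mem_map op₀_rightMul₀ (fun i T hT => by
      fin_cases i
      exacts [LinearMap.stableSpan_left hT, LinearMap.stableSpan_right hT])
      ⟨mk₀ (mul g) (mul_mem_D₀ hg), LinearMap.le_stableSpan (mem_order₀.2 ⟨g, hg, rfl⟩), rfl⟩ c e) (op₀_mem T)
  obtain ⟨T', hT', e⟩ := h
  rwa [op₀_injective e] at hT'

theorem mul_mem_D₁' {w : J} (hw : w ∈ J₁) : mul w ∈ D₁ := by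
  rw [← mul_one (mul w)]; exact mul_mem_D₁ hw (one_mem _)

theorem mono_mul_P_mem (a b p q : ℕ) : mono a b p q * P ∈ J₁ := J₁.mul_mem_left _ P_mem_J₁

theorem stableSpan_order₁ : stableSpan (rightMul₁ 0) (rightMul₁ 1) order₁ = ⊤ := by
  refine eq_top_iff.2 fun T _ => ?_
  have h := D₁_le (N := (stableSpan (rightMul₁ 0) (rightMul₁ 1) order₁).map op₁)
    (fun a b p q c e => mul_pow_mem_map op₁_rightMul₁ (fun i T hT => by
      fin_cases i
      exacts [LinearMap.stableSpan_left hT, LinearMap.stableSpan_right hT])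
      ⟨mk₁ _ (mul_mem_D₁' (mono_mul_P_mem a b p q)),
        LinearMap.le_stableSpan (mem_order₁.2 ⟨_, mono_mul_P_mem a b p q, rfl⟩), rfl⟩ c e) (op₁_mem T)
  obtain ⟨T', hT', e⟩ := h
  rwa [op₁_injective e] at hT'

theorem mul_neg_mul_sub {A : Type*} [Ring A] (Z T D : A) : Z * -(T * D) - -(T * D) * Z =
    -((Z * T - T * Z) * D) + T * (D * Z - Z * D) := by
  noncomm_ring

theorem neg_commutator_mul {A : Type*} [Ring A] {Z T D : A} (h : Z * D = D * Z) :
    -((Z * T - T * Z) * D) = Z * -(T * D) - -(T * D) * Z := by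
  rw [mul_neg_mul_sub, ← h, sub_self, mul_zero, add_zero]

theorem neg_neg_mul_mul {A : Type*} [Ring A] {D E : A} (h : D * E = E * D) (T : A) :
    -(-(T * D) * E) = -(-(T * E) * D) := by
  rw [neg_mul, neg_mul, mul_assoc, mul_assoc, h]

/-- The bracket with zⁱ passes through T and then meets ∂ⱼ, where [zⁱ, ∂ⱼ] = -δᵢⱼ. The minus sign in
`rightMul₀` turns this into +δᵢⱼ. -/
theorem zOp_lie_rightMul₀ (i j : Fin 2) (T : L₀) :
    ⁅zOp i, rightMul₀ j T⁆ = rightMul₀ j ⁅zOp i, T⁆ + if i = j then T else 0 := by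
  apply op₀_injective
  have h := partialOp_mul j (z i)
  rw [map_add, op₀_lie, op₀_rightMul₀, op₀_rightMul₀, op₀_lie, op₀_zOp]
  have e : mul (z i) * -(op₀ T * partialOp j) - -(op₀ T * partialOp j) * mul (z i) =
      -((mul (z i) * op₀ T - op₀ T * mul (z i)) * partialOp j) +
        op₀ T * (partialOp j * mul (z i) - mul (z i) * partialOp j) :=
    mul_neg_mul_sub _ _ _
  rw [e, h, add_sub_cancel_right, pderiv_z]
  by_cases hij : i = j
  · rw [if_pos hij.symm, if_pos hij, map_one, mul_one]
  · rw [if_neg (Ne.symm hij), if_neg hij, map_zero, mul_zero, map_zero]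

theorem zOp_lie_rightMul₁ (i j : Fin 2) (T : L₁) :
    ⁅zOp i, rightMul₁ j T⁆ = rightMul₁ j ⁅zOp i, T⁆ + if i = j then T else 0 := by
  apply op₁_injective
  have h := partialOp_mul j (z i)
  rw [map_add, op₁_lie, op₁_rightMul₁, op₁_rightMul₁, op₁_lie, op₀_zOp]
  have e : mul (z i) * -(op₁ T * partialOp j) - -(op₁ T * partialOp j) * mul (z i) =
      -((mul (z i) * op₁ T - op₁ T * mul (z i)) * partialOp j) +
        op₁ T * (partialOp j * mul (z i) - mul (z i) * partialOp j) :=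
    mul_neg_mul_sub _ _ _
  rw [e, h, add_sub_cancel_right, pderiv_z]
  by_cases hij : i = j
  · rw [if_pos hij.symm, if_pos hij, map_one, mul_one]
  · rw [if_neg (Ne.symm hij), if_neg hij, map_zero, mul_zero, map_zero]

theorem rightMul₁_dbarL (i : Fin 2) (T : L₀) : rightMul₁ i (dbarL T) = dbarL (rightMul₀ i T) := by
  apply op₁_injective
  have h := sub_eq_zero.1 (dbarOp_partialOp i)
  rw [op₁_rightMul₁, op₁_dbarL, op₁_dbarL, op₀_rightMul₀]
  exact neg_commutator_mul h

/-- Applying `R₁` or `R₂` raises the nilpotency order under `X` by at most one. The constants may be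
zero, so the mixed pairs with different indices are included. -/
theorem isNil_of_stableSpan {V : Type*} [AddCommGroup V] [Module ℂ V] {X R₁ R₂ : Module.End ℂ V}
    {S : Submodule ℂ V} {c₁ c₂ : ℂ} (h₁ : ∀ v, X (R₁ v) = R₁ (X v) + c₁ • v)
    (h₂ : ∀ v, X (R₂ v) = R₂ (X v) + c₂ • v) (hS : ∀ s ∈ S, X s = 0)
    (htop : stableSpan R₁ R₂ S = ⊤) (v : V) : IsNil X v := by
  have key : ∀ {R : Module.End ℂ V} {c : ℂ}, (∀ v, X (R v) = R (X v) + c • v) →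
      ∀ v, IsNil X v → IsNil X (R v) := by
    rintro R c h v ⟨k, hk⟩
    refine ⟨k + 1, ?_⟩
    rw [LinearMap.pow_apply_weyl (U := ⊤) (fun _ _ => trivial) (fun u _ => h u) k v trivial, hk,
      pow_succ', Module.End.mul_apply, hk]
    simp
  refine LinearMap.stableSpan_le (N := { carrier := {v | IsNil X v}
                                         add_mem' := fun h h' => h.add h'
                                         zero_mem' := ⟨0, by simp⟩
                                         smul_mem' := fun r _ h => h.smul r })
    (fun s hs => IsNil.of_apply_eq_zero (hS s hs)) (fun v hv => key h₁ v hv)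
    (fun v hv => key h₂ v hv) (htop ▸ Submodule.mem_top : v ∈ stableSpan R₁ R₂ S)

theorem zOp_lie_of_mem_order₀ (i : Fin 2) {T : L₀} (hT : T ∈ order₀) : ⁅zOp i, T⁆ = 0 := by
  obtain ⟨g, -, hg⟩ := mem_order₀.1 hT
  apply op₀_injective
  rw [op₀_lie, map_zero, op₀_zOp, ← hg, ← map_mul, ← map_mul, mul_comm, sub_self]

theorem zOp_lie_of_mem_order₁ (i : Fin 2) {T : L₁} (hT : T ∈ order₁) : ⁅zOp i, T⁆ = 0 := by
  obtain ⟨g, -, hg⟩ := mem_order₁.1 hT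
  apply op₁_injective
  rw [op₁_lie, map_zero, op₀_zOp, ← hg, ← map_mul, ← map_mul, mul_comm, sub_self]

theorem isNil_zOp₀ (i : Fin 2) (T : L₀) : IsNil (LieModule.toEnd ℂ L₀ L₀ (zOp i)) T :=
  isNil_of_stableSpan (c₁ := if i = 0 then 1 else 0) (c₂ := if i = 1 then 1 else 0)
    (fun v => by simpa [ite_smul] using zOp_lie_rightMul₀ i 0 v)
    (fun v => by simpa [ite_smul] using zOp_lie_rightMul₀ i 1 v)
    (fun s hs => zOp_lie_of_mem_order₀ i hs) stableSpan_order₀ T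

theorem isNil_zOp₁ (i : Fin 2) (T : L₁) : IsNil (LieModule.toEnd ℂ L₀ L₁ (zOp i)) T :=
  isNil_of_stableSpan (c₁ := if i = 0 then 1 else 0) (c₂ := if i = 1 then 1 else 0)
    (fun v => by simpa [ite_smul] using zOp_lie_rightMul₁ i 0 v)
    (fun v => by simpa [ite_smul] using zOp_lie_rightMul₁ i 1 v)
    (fun s hs => zOp_lie_of_mem_order₁ i hs) stableSpan_order₁ T

theorem zOp_comm (i j : Fin 2) : ⁅zOp i, zOp j⁆ = 0 :=
  zOp_lie_of_mem_order₀ i ⟨z j, z_mem_J₀ j, rfl⟩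

theorem dbarL_zOp (i : Fin 2) : dbarL (zOp i) = 0 := op₁_injective (by
  rw [op₁_dbarL, op₀_zOp, dbarOp_mul, dbar_z, map_zero, map_zero])

/-- The coordinates and right multiplication by derivatives. -/
def weylData : DGLie.WeylData dbarL where
  z := zOp
  R₀ := rightMul₀
  R₁ := rightMul₁
  δ_lie := dbarL_lie
  δ_z := dbarL_zOp
  δ_R := rightMul₁_dbarL
  z_comm := zOp_comm
  weyl₀ := zOp_lie_rightMul₀
  weyl₁ := zOp_lie_rightMul₁
  nil₀ := isNil_zOp₀
  nil₁ := isNil_zOp₁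

/-- Elements of `L₁` that commute with the coordinates have order zero. -/
theorem mem_order₁_of_lie {T : L₁} (h : ∀ i, ⁅zOp i, T⁆ = 0) : T ∈ order₁ := by
  refine LinearMap.mem_of_stableSpan_eq_top (X₁ := LieModule.toEnd ℂ L₀ L₁ (zOp 0))
    (X₂ := LieModule.toEnd ℂ L₀ L₁ (zOp 1))
    (fun u => by simpa using zOp_lie_rightMul₁ 0 0 u)
    (fun u => by simpa using zOp_lie_rightMul₁ 1 1 u)
    (fun u => by simpa using zOp_lie_rightMul₁ 0 1 u) (fun u => op₁_injective ?_)
    (isNil_zOp₁ 0) (isNil_zOp₁ 1)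
    (fun s hs => zOp_lie_of_mem_order₁ 0 hs) (fun s hs => zOp_lie_of_mem_order₁ 1 hs)
    stableSpan_order₁ (h 0) (h 1)
  change -(-(op₁ u * partialOp 1) * partialOp 0) = -(-(op₁ u * partialOp 0) * partialOp 1)
  exact neg_neg_mul_mul (partialOp_comm 1 0) _

/-! ### The Euler operator and its weights -/

/-- The Euler operator `z¹∂₁ + z²∂₂`. -/
def eulerOp : L₀ := mk₀ (mul (z 0) * partialOp 0 + mul (z 1) * partialOp 1)
  (add_mem (mul_mem (mul_mem_D₀ (z_mem_J₀ 0)) (partialOp_mem 0))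
    (mul_mem (mul_mem_D₀ (z_mem_J₀ 1)) (partialOp_mem 1)))

theorem eulerOp_mul (f : J) : op₀ eulerOp * mul f - mul f * op₀ eulerOp = mul (euler f) := by
  refine LinearMap.ext fun a => ?_
  change euler (f * a) - f * euler a = euler f * a
  rw [Derivation.leibniz, smul_eq_mul, smul_eq_mul]
  ring

theorem eulerOp_partialOp (i : Fin 2) :
    op₀ eulerOp * partialOp i - partialOp i * op₀ eulerOp = (-1 : ℂ) • partialOp i := by
  refine LinearMap.ext fun a => ?_
  change euler (pderiv i a) - pderiv i (euler a) = (-1 : ℂ) • pderiv i a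
  simp only [euler_apply, map_add, Derivation.leibniz, smul_eq_mul, pderiv_z, neg_smul, one_smul]
  rw [pderiv_comm i 0, pderiv_comm i 1]
  fin_cases i <;> simp

theorem dbarL_eulerOp : dbarL eulerOp = 0 := by
  apply op₁_injective
  rw [op₁_dbarL, map_zero]
  refine LinearMap.ext fun a => ?_
  change dbar (euler a) - euler (dbar a) = 0
  simp only [euler_apply, map_add, Derivation.leibniz, smul_eq_mul, dbar_z, dbar_pderiv]
  ring

theorem eulerOp_zOp (i : Fin 2) : ⁅eulerOp, zOp i⁆ = zOp i := by
  apply op₀_injective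
  rw [op₀_lie, op₀_zOp, eulerOp_mul, euler_z, one_smul]

/-- The operator `z^(a,b) x^(p,q) P ∂₁ᶜ ∂₂ᵉ`. -/
def monoOp (a b p q c e : ℕ) : L₁ :=
  mk₁ (mul (mono a b p q * P) * partialOp 0 ^ c * partialOp 1 ^ e)
    (D₁_mul_D₀ (pow_mem (partialOp_mem 1) e) (D₁_mul_D₀ (pow_mem (partialOp_mem 0) c)
      (mul_mem_D₁' (mono_mul_P_mem a b p q))))

theorem L₁_le {N : Submodule ℂ L₁} (h : ∀ a b p q c e, monoOp a b p q c e ∈ N) (T : L₁) :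
    T ∈ N := by
  obtain ⟨T', hT', e⟩ := D₁_le (N := N.map op₁)
    (fun a b p q c e => ⟨monoOp a b p q c e, h a b p q c e, rfl⟩) (op₁_mem T)
  rwa [op₁_injective e] at hT'

theorem commutator_eigen_mul {A S T : Module.End ℂ J} {μ ν : ℂ} (hS : A * S - S * A = μ • S)
    (hT : A * T - T * A = ν • T) : A * (S * T) - S * T * A = (μ + ν) • (S * T) := by
  have : A * (S * T) - S * T * A = (A * S - S * A) * T + S * (A * T - T * A) := by
    simp only [sub_mul, mul_sub, mul_assoc]; abel
  rw [this, hS, hT, smul_mul_assoc, mul_smul_comm, add_smul]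

theorem commutator_eigen_pow {A S : Module.End ℂ J} {μ : ℂ} (hS : A * S - S * A = μ • S) (n : ℕ) :
    A * S ^ n - S ^ n * A = (n * μ) • S ^ n := by
  induction n with
  | zero => simp
  | succ n ih =>
    rw [pow_succ, commutator_eigen_mul ih hS]
    congr 1
    push_cast; ring

theorem eulerOp_lie_monoOp (a b p q c e : ℕ) : ⁅eulerOp, monoOp a b p q c e⁆ =
    ((a : ℂ) + b - p - q - 2 - c - e) • monoOp a b p q c e := by
  apply op₁_injective
  rw [op₁_lie, map_smul]
  have h1 : op₀ eulerOp * mul (mono a b p q * P) - mul (mono a b p q * P) * op₀ eulerOp =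
      ((a : ℂ) + b - p - q + (-2)) • mul (mono a b p q * P) := by
    rw [eulerOp_mul, euler_mul (euler_mono a b p q) euler_P, map_smul]
  refine (commutator_eigen_mul (commutator_eigen_mul h1
    (commutator_eigen_pow (eulerOp_partialOp 0) c))
    (commutator_eigen_pow (eulerOp_partialOp 1) e)).trans ?_
  rw [monoOp, op₁_mk₁]
  congr 1
  ring

theorem monoOp_mem_range {a b p q : ℕ} (h : mono a b p q ∈ exactCoeff) (c e : ℕ) :
    monoOp a b p q c e ∈ LinearMap.range dbarL := by
  obtain ⟨g, hg, hd⟩ := mem_exactCoeff.1 h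
  refine ⟨mk₀ (mul g * partialOp 0 ^ c * partialOp 1 ^ e)
    (mul_mem (mul_mem (mul_mem_D₀ hg) (pow_mem (partialOp_mem 0) c))
      (pow_mem (partialOp_mem 1) e)), op₁_injective ?_⟩
  have hc : ∀ i (n : ℕ), dbarOp * partialOp i ^ n = partialOp i ^ n * dbarOp := fun i n =>
    (Commute.pow_right (sub_eq_zero.1 (dbarOp_partialOp i) : Commute dbarOp (partialOp i)) n).eq
  rw [op₁_dbarL, op₀_mk₀, monoOp, op₁_mk₁, ← hd, ← dbarOp_mul]
  simp only [sub_mul, mul_assoc]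
  rw [← hc, ← mul_assoc (partialOp 0 ^ c), ← hc, mul_assoc]

/-- A monomial coefficient with `p < a` or `q < b` gives an exact operator. Otherwise `p = a + k`
and `q = b + l`, so the Euler weight is `-(k + l + c + e + 2)`, the 2 being contributed by P. -/
theorem isEuler_eulerOp : weylData.IsEuler eulerOp where
  δ_eq := dbarL_eulerOp
  lie_z := eulerOp_zOp
  semisimple := L₁_le fun a b p q c e =>
    LinearMap.mem_eigSum (Set.mem_univ _) (eulerOp_lie_monoOp a b p q c e)
  exact := L₁_le fun a b p q c e => by
    by_cases h1 : p < a
    · exact Submodule.mem_sup_left (monoOp_mem_range (mono_mem_exactCoeff_of_lt h1) c e)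
    by_cases h2 : q < b
    · exact Submodule.mem_sup_left (monoOp_mem_range (mono_mem_exactCoeff_of_lt' h2) c e)
    obtain ⟨k, rfl⟩ := Nat.exists_eq_add_of_le (not_lt.1 h1)
    obtain ⟨l, rfl⟩ := Nat.exists_eq_add_of_le (not_lt.1 h2)
    refine Submodule.mem_sup_right (LinearMap.mem_eigSum
      (A := Set.range fun n : ℕ => -((n + 2 : ℕ) : ℂ))
      (μ := -((k + l + c + e + 2 : ℕ) : ℂ)) ⟨k + l + c + e, rfl⟩ ?_)
    rw [LieModule.toEnd_apply_apply, eulerOp_lie_monoOp]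
    congr 1
    push_cast
    ring

end Jouanolou

/-! ### The residue of the commutator pairing -/

namespace Jouanolou

open LinearMap (IsNil stableSpan)
open DGLie

theorem apply_mem_J₁ {S : Module.End ℂ J} (hS : S ∈ D₁) (b : J) : S b ∈ J₁ :=
  D₁_induction (C := fun S => S b ∈ J₁) (fun _ hw _ _ => J₁.mul_mem_right _ hw)
    (fun _ _ => add_mem) hS

/-- The residue of the value at `1`. -/
def resOne : L₁ →ₗ[ℂ] ℂ := res ∘ₗ LinearMap.applyₗ (1 : J) ∘ₗ op₁

theorem resOne_apply (T : L₁) : resOne T = res (op₁ T 1) := rfl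

theorem resOne_dbarL (T : L₀) : resOne (dbarL T) = 0 := by
  change res (dbar (op₀ T 1) - op₀ T (dbar 1)) = 0
  rw [Derivation.map_one_eq_zero, map_zero, sub_zero, res_dbar]

/-- The residue of the value of a commutator at `1`. -/
def resLie : L₀ ⊗[ℂ] L₁ →ₗ[ℂ] ℂ :=
  resOne ∘ₗ TensorProduct.lift (LieModule.toEnd ℂ L₀ L₁ : L₀ →ₗ[ℂ] Module.End ℂ L₁)

theorem resLie_tmul (a : L₀) (l : L₁) : resLie (a ⊗ₜ[ℂ] l) = resOne ⁅a, l⁆ := rfl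

/-- For `a ∧ s` the component of the differential in `L₁` is the bracket of `a` with the linear part
of `s`, plus a multiple of ∂̄a. The residue kills the second term. -/
theorem resLie_proj₁₁ {c : Chains ℂ L₀ L₁} (hc : c ∈ chainsOfDegree ℂ L₀ L₁ 1) :
    resOne (proj₁ (diff ℂ dbarL c)) = resLie (proj₁₁ c) := by
  refine chainsOfDegree_succ_le (N := LinearMap.eqLocus (resOne ∘ₗ proj₁ ∘ₗ diff ℂ dbarL)
    (resLie ∘ₗ proj₁₁)) (fun a c hc => ?_) hc
  obtain ⟨s, rfl⟩ := exists_eq_one_tmul hc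
  change resOne (proj₁ (diff ℂ dbarL (wedge ℂ a _))) = resLie (proj₁₁ (wedge ℂ a _))
  rw [diff_wedge_of_degree_zero a hc, proj₁₁_wedge, resLie_tmul, ad_tmul, extDer_one,
    TensorProduct.zero_tmul, zero_add, mulSym_tmul, map_add, proj₁_tmul, proj₁_tmul, map_one,
    one_smul, one_smul, symProj_symDer, symProj_ι_mul, map_add, map_smul, resOne_dbarL, smul_zero,
    add_zero]
  rfl

/-! ### Invariant tensors and vanishing of the residue pairing -/

/-- The derivative `∂ᵢ` as an element of `L₀`. -/
def partialL (i : Fin 2) : L₀ := mk₀ (partialOp i) (partialOp_mem i)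

/-- The difference of the two right multiplications by `∂ᵢ`. -/
def rightDiff (i : Fin 2) : Module.End ℂ (L₀ ⊗[ℂ] L₁) :=
  (rightMul₀ i).rTensor L₁ - (rightMul₁ i).lTensor L₀

/-- Bracket of the first factor with `∂ᵢ`. -/
def leftLie (i : Fin 2) : Module.End ℂ (L₀ ⊗[ℂ] L₁) :=
  (LieModule.toEnd ℂ L₀ L₀ (partialL i)).rTensor L₁

/-- Bracket of both factors with `zⁱ`. -/
def tensorLie (i : Fin 2) : Module.End ℂ (L₀ ⊗[ℂ] L₁) :=
  (LieModule.toEnd ℂ L₀ L₀ (zOp i)).rTensor L₁ + (LieModule.toEnd ℂ L₀ L₁ (zOp i)).lTensor L₀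

theorem rightDiff_tmul (i : Fin 2) (a : L₀) (l : L₁) : rightDiff i (a ⊗ₜ[ℂ] l) =
    rightMul₀ i a ⊗ₜ[ℂ] l - a ⊗ₜ[ℂ] rightMul₁ i l := rfl

theorem leftLie_tmul (i : Fin 2) (a : L₀) (l : L₁) :
    leftLie i (a ⊗ₜ[ℂ] l) = ⁅partialL i, a⁆ ⊗ₜ[ℂ] l := rfl

theorem tensorLie_tmul (i : Fin 2) (a : L₀) (l : L₁) :
    tensorLie i (a ⊗ₜ[ℂ] l) = ⁅zOp i, a⁆ ⊗ₜ[ℂ] l + a ⊗ₜ[ℂ] ⁅zOp i, l⁆ := rfl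

/-- As ∂ᵢ1 = 0, the two sides differ exactly by the residue of ∂ᵢ(a(l(1))), which vanishes because
a(l(1)) lies in J¹. -/
theorem resLie_rightDiff (i : Fin 2) (w : L₀ ⊗[ℂ] L₁) :
    resLie (rightDiff i w) = resLie (leftLie i w) := by
  refine LinearMap.congr_fun (f := resLie ∘ₗ rightDiff i) (g := resLie ∘ₗ leftLie i)
    (TensorProduct.ext' fun a l => ?_) w
  have h : res (pderiv i (op₀ a (op₁ l 1))) = 0 :=
    res_pderiv i (apply_mem_J₁ (D₀_mul_D₁ (op₀_mem a) _ (op₁_mem l)) 1)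
  rw [LinearMap.comp_apply, LinearMap.comp_apply, rightDiff_tmul, leftLie_tmul, map_sub,
    resLie_tmul, resLie_tmul, resLie_tmul]
  change res (-(op₀ a (pderiv i (op₁ l 1))) - op₁ l (-(op₀ a (pderiv i 1)))) -
    res (op₀ a (-(op₁ l (pderiv i 1))) - -(op₁ l (pderiv i (op₀ a 1)))) =
    res (pderiv i (op₀ a (op₁ l 1)) - op₀ a (pderiv i (op₁ l 1)) -
      op₁ l (pderiv i (op₀ a 1) - op₀ a (pderiv i 1)))
  simp only [Derivation.map_one_eq_zero, map_neg, map_sub, map_zero, h]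
  ring

theorem commutator_mul_neg {A : Type*} [Ring A] {D E : A} (h : D * E = E * D) (T : A) :
    D * -(T * E) - -(T * E) * D = -((D * T - T * D) * E) := by
  rw [sub_mul, mul_neg, neg_mul, mul_assoc, mul_assoc, mul_assoc, h]
  abel

theorem partialL_lie_rightMul₀ (i j : Fin 2) (a : L₀) :
    ⁅partialL j, rightMul₀ i a⁆ = rightMul₀ i ⁅partialL j, a⁆ :=
  op₀_injective (commutator_mul_neg (partialOp_comm j i) _)

theorem rightMul₁_comm (i j : Fin 2) (l : L₁) :
    rightMul₁ i (rightMul₁ j l) = rightMul₁ j (rightMul₁ i l) :=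
  op₁_injective (neg_neg_mul_mul (partialOp_comm j i) _)

theorem commute_rightDiff_leftLie (i j : Fin 2) : Commute (rightDiff i) (leftLie j) :=
  TensorProduct.ext' fun a l => by
    simp only [Module.End.mul_apply, leftLie_tmul, rightDiff_tmul, map_sub, partialL_lie_rightMul₀]

theorem partialL_lie_partialL (i j : Fin 2) : ⁅partialL i, partialL j⁆ = 0 :=
  op₀_injective (sub_eq_zero.2 (partialOp_comm i j))

theorem commute_leftLie : Commute (leftLie 0) (leftLie 1) :=
  TensorProduct.ext' fun a l => by
    simp only [Module.End.mul_apply, leftLie_tmul]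
    rw [leibniz_lie, partialL_lie_partialL, zero_lie, zero_add]

theorem commute_rightDiff_lTensor (i j : Fin 2) :
    Commute (rightDiff i) ((rightMul₁ j).lTensor L₀) :=
  TensorProduct.ext' fun a l => by
    simp only [Module.End.mul_apply, LinearMap.lTensor_tmul, rightDiff_tmul, map_sub,
      rightMul₁_comm i j]

theorem commute_tensorLie_rightDiff (i j : Fin 2) : Commute (tensorLie i) (rightDiff j) :=
  TensorProduct.ext' fun a l => by
    simp only [Module.End.mul_apply, tensorLie_tmul, rightDiff_tmul, map_sub, map_add,
      zOp_lie_rightMul₀, zOp_lie_rightMul₁, TensorProduct.tmul_add, TensorProduct.add_tmul]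
    split_ifs
    · abel
    · simp only [TensorProduct.tmul_zero, TensorProduct.zero_tmul]
      abel

/-- Tensors of elements of order zero. -/
def orderTensor : Submodule ℂ (L₀ ⊗[ℂ] L₁) :=
  Submodule.map₂ (TensorProduct.mk ℂ L₀ L₁) order₀ order₁

theorem partialL_lie_mem_order₀ (i : Fin 2) {a : L₀} (ha : a ∈ order₀) :
    ⁅partialL i, a⁆ ∈ order₀ := by
  obtain ⟨g, hg, h⟩ := mem_order₀.1 ha
  refine mem_order₀.2 ⟨pderiv i g, pderiv_mem_J₀ i hg, ?_⟩
  rw [op₀_lie, ← h]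
  exact (sub_eq_of_eq_add (partialOp_mul i g)).symm

theorem leftLie_mem (i : Fin 2) {w : L₀ ⊗[ℂ] L₁} (hw : w ∈ orderTensor) :
    leftLie i w ∈ orderTensor :=
  Submodule.map₂_le (r := orderTensor.comap (leftLie i)) |>.2 (fun _ ha _ hl =>
    Submodule.apply_mem_map₂ _ (partialL_lie_mem_order₀ i ha) hl) hw

theorem resLie_eq_zero_of_mem_orderTensor {w : L₀ ⊗[ℂ] L₁} (hw : w ∈ orderTensor) :
    resLie w = 0 := by
  refine Submodule.map₂_le (r := LinearMap.ker resLie) |>.2 (fun a ha l hl => ?_) hw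
  obtain ⟨g, -, hg⟩ := mem_order₀.1 ha
  obtain ⟨f, -, hf⟩ := mem_order₁.1 hl
  have : ⁅a, l⁆ = 0 := op₁_injective (by
    rw [op₁_lie, map_zero, ← hg, ← hf, ← map_mul, ← map_mul, mul_comm, sub_self])
  rw [LinearMap.mem_ker, TensorProduct.mk_apply, resLie_tmul, this, map_zero]

/-- The tensors on which the brackets with the coordinates vanish. -/
def invTensor : Submodule ℂ (L₀ ⊗[ℂ] L₁) := stableSpan (rightDiff 0) (rightDiff 1) orderTensor

theorem resLie_eq_zero_of_mem_invTensor {w : L₀ ⊗[ℂ] L₁} (hw : w ∈ invTensor) :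
    resLie w = 0 := by
  -- Vanishing of `resLie` alone is not visibly stable under `rightDiff`, which is traded for a
  -- further `leftLie`. Asking for vanishing after every monomial in the `leftLie` operators makes
  -- the condition stable.
  set N : Submodule ℂ (L₀ ⊗[ℂ] L₁) :=
    ⨅ (m : ℕ) (n : ℕ), LinearMap.ker (resLie ∘ₗ (leftLie 0 ^ m * leftLie 1 ^ n)) with hN
  have mem_N : ∀ {w}, w ∈ N ↔ ∀ m n : ℕ, resLie ((leftLie 0 ^ m * leftLie 1 ^ n) w) = 0 := by
    intro w
    simp only [hN, Submodule.mem_iInf, LinearMap.mem_ker, LinearMap.comp_apply]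
  have hcomm : ∀ (i : Fin 2) (m n : ℕ) w, resLie ((leftLie 0 ^ m * leftLie 1 ^ n)
      (rightDiff i w)) = resLie ((leftLie i * (leftLie 0 ^ m * leftLie 1 ^ n)) w) := by
    intro i m n w
    have h := (((commute_rightDiff_leftLie i 0).pow_right m).mul_right
      ((commute_rightDiff_leftLie i 1).pow_right n)).eq
    rw [← Module.End.mul_apply, ← h, Module.End.mul_apply, resLie_rightDiff,
      ← Module.End.mul_apply]
  have hpow : ∀ (i : Fin 2) (n : ℕ), ∀ s ∈ orderTensor, (leftLie i ^ n) s ∈ orderTensor := by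
    intro i n s hs
    induction n with
    | zero => exact hs
    | succ n ih => rw [pow_succ']; exact leftLie_mem i ih
  have h := mem_N.1 (LinearMap.stableSpan_le (N := N) (fun s hs => mem_N.2 fun m n =>
      resLie_eq_zero_of_mem_orderTensor (hpow 0 m _ (hpow 1 n s hs)))
    (fun v hv => mem_N.2 fun m n => ?_) (fun v hv => mem_N.2 fun m n => ?_) hw) 0 0
  · exact h
  · rw [hcomm, ← mul_assoc, ← pow_succ']
    exact mem_N.1 hv _ _
  · rw [hcomm, (commute_leftLie.symm.pow_right m).left_comm, ← pow_succ']
    exact mem_N.1 hv _ _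

theorem tensorLie_eq_zero_of_mem (i : Fin 2) {w : L₀ ⊗[ℂ] L₁} (hw : w ∈ invTensor) :
    tensorLie i w = 0 := by
  refine LinearMap.stableSpan_le (N := LinearMap.ker (tensorLie i)) ?_ ?_ ?_ hw
  · refine Submodule.map₂_le.2 fun a ha l hl => ?_
    rw [LinearMap.mem_ker, TensorProduct.mk_apply, tensorLie_tmul, zOp_lie_of_mem_order₀ i ha,
      zOp_lie_of_mem_order₁ i hl, TensorProduct.zero_tmul, TensorProduct.tmul_zero, add_zero]
  all_goals
    intro v hv
    rw [LinearMap.mem_ker] at hv ⊢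
    rw [← Module.End.mul_apply, (commute_tensorLie_rightDiff i _).eq, Module.End.mul_apply, hv,
      map_zero]

/-- Since Rᵢ ⊗ 1 = (Rᵢ ⊗ 1 - 1 ⊗ Rᵢ) + 1 ⊗ Rᵢ, the closure is also stable under Rᵢ ⊗ 1. From tensors
of order-zero elements the two families generate all of L₀ ⊗ L₁. -/
theorem stableSpan_invTensor :
    stableSpan ((rightMul₁ 0).lTensor L₀) ((rightMul₁ 1).lTensor L₀) invTensor = ⊤ := by
  set M := stableSpan ((rightMul₁ 0).lTensor L₀) ((rightMul₁ 1).lTensor L₀) invTensor with hM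
  have h1 : ∀ i, ∀ w ∈ M, (rightMul₁ i).lTensor L₀ w ∈ M := by
    intro i w hw
    fin_cases i
    exacts [LinearMap.stableSpan_left hw, LinearMap.stableSpan_right hw]
  have hV : ∀ i, ∀ w ∈ invTensor, rightDiff i w ∈ invTensor := by
    intro i w hw
    fin_cases i
    exacts [LinearMap.stableSpan_left hw, LinearMap.stableSpan_right hw]
  have hd : ∀ i, ∀ w ∈ M, rightDiff i w ∈ M := by
    intro i w hw
    have hc : ∀ j, ∀ v ∈ M.comap (rightDiff i),
        (rightMul₁ j).lTensor L₀ v ∈ M.comap (rightDiff i) := by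
      intro j v hv
      rw [Submodule.mem_comap, ← Module.End.mul_apply, (commute_rightDiff_lTensor i j).eq]
      exact h1 j _ hv
    exact LinearMap.stableSpan_le (N := M.comap (rightDiff i))
      (fun v hv => LinearMap.le_stableSpan (hV i v hv)) (hc 0) (hc 1) hw
  have h0 : ∀ i, ∀ w ∈ M, (rightMul₀ i).rTensor L₁ w ∈ M := by
    intro i w hw
    have := add_mem (hd i w hw) (h1 i w hw)
    rwa [rightDiff, LinearMap.sub_apply, sub_add_cancel] at this
  have h2 : ∀ a : L₀, ∀ l ∈ order₁, a ⊗ₜ[ℂ] l ∈ M := by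
    intro a l hl
    exact LinearMap.stableSpan_le (N := M.comap ((TensorProduct.mk ℂ L₀ L₁).flip l))
      (fun a ha => LinearMap.le_stableSpan (LinearMap.le_stableSpan
        (Submodule.apply_mem_map₂ _ ha hl)))
      (fun a ha => h0 0 _ ha) (fun a ha => h0 1 _ ha)
      (stableSpan_order₀ ▸ Submodule.mem_top : a ∈ stableSpan (rightMul₀ 0) (rightMul₀ 1) order₀)
  rw [eq_top_iff, ← TensorProduct.span_tmul_eq_top, Submodule.span_le]
  rintro _ ⟨a, l, rfl⟩
  exact LinearMap.stableSpan_le (N := M.comap (TensorProduct.mk ℂ L₀ L₁ a)) (h2 a)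
    (fun l hl => h1 0 _ hl) (fun l hl => h1 1 _ hl)
    (stableSpan_order₁ ▸ Submodule.mem_top : l ∈ stableSpan (rightMul₁ 0) (rightMul₁ 1) order₁)

theorem isNil_tensorLie (i : Fin 2) (w : L₀ ⊗[ℂ] L₁) : IsNil (tensorLie i) w := by
  induction w using TensorProduct.induction_on with
  | zero => exact ⟨0, by simp⟩
  | add v w hv hw => exact hv.add hw
  | tmul a l =>
    exact IsNil.bilin (B := TensorProduct.mk ℂ L₀ L₁) (tensorLie_tmul i) (isNil_zOp₀ i a)
      (isNil_zOp₁ i l)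

theorem tensorLie_lTensor (i j : Fin 2) (w : L₀ ⊗[ℂ] L₁) :
    tensorLie i ((rightMul₁ j).lTensor L₀ w) =
      (rightMul₁ j).lTensor L₀ (tensorLie i w) + if i = j then w else 0 := by
  induction w using TensorProduct.induction_on with
  | zero => simp
  | add v w hv hw =>
    simp only [map_add, hv, hw]
    split_ifs <;> abel
  | tmul a l =>
    rw [LinearMap.lTensor_tmul, tensorLie_tmul, tensorLie_tmul, map_add, LinearMap.lTensor_tmul,
      LinearMap.lTensor_tmul, zOp_lie_rightMul₁, TensorProduct.tmul_add, add_assoc]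
    split_ifs <;> simp

/-- The operators 1 ⊗ Rᵢ form Weyl pairs with the brackets by zⁱ and generate everything from
`invTensor`, so `mem_of_stableSpan_eq_top` identifies the joint kernel. -/
theorem mem_invTensor {w : L₀ ⊗[ℂ] L₁} (hw : ∀ i, tensorLie i w = 0) : w ∈ invTensor :=
  LinearMap.mem_of_stableSpan_eq_top (X₁ := tensorLie 0) (X₂ := tensorLie 1)
    (fun u => by simpa using tensorLie_lTensor 0 0 u)
    (fun u => by simpa using tensorLie_lTensor 1 1 u)
    (fun u => by simpa using tensorLie_lTensor 0 1 u)
    (fun u => LinearMap.congr_fun (f := (rightMul₁ 0).lTensor L₀ ∘ₗ (rightMul₁ 1).lTensor L₀)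
      (g := (rightMul₁ 1).lTensor L₀ ∘ₗ (rightMul₁ 0).lTensor L₀)
      (TensorProduct.ext' fun a l => by
        simp only [LinearMap.comp_apply, LinearMap.lTensor_tmul, rightMul₁_comm 0 1]) u)
    (isNil_tensorLie 0) (isNil_tensorLie 1)
    (fun _ hs => tensorLie_eq_zero_of_mem 0 hs) (fun _ hs => tensorLie_eq_zero_of_mem 1 hs)
    stableSpan_invTensor (hw 0) (hw 1)

/-- This is the obstruction to bounding P by an invariant chain: invariance of the chain passes to
its component in L₀ ⊗ L₁, where the residue pairing vanishes. -/
theorem resOne_proj₁_diff {e : Chains ℂ L₀ L₁} (he : e ∈ weylData.inv 1) :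
    resOne (proj₁ (diff ℂ dbarL e)) = 0 := by
  obtain ⟨he, h⟩ := weylData.mem_inv.1 he
  rw [resLie_proj₁₁ he]
  refine resLie_eq_zero_of_mem_invTensor (mem_invTensor fun i => ?_)
  have := congrArg proj₁₁ (h i)
  rwa [ad_eq_chainDer, proj₁₁_chainDer, map_zero] at this

/-! ### The second hyperhomology -/

theorem chainPzz_eq : chainPzz =
    wedge ℂ (zOp 0) (wedge ℂ (zOp 1) (mulSym ℂ POp (unitChain ℂ L₀ L₁))) := by
  rw [wedge_mulSym, wedge_mulSym]; rfl

theorem POp_mem_order₁ : POp ∈ order₁ := mem_order₁.2 ⟨P, P_mem_J₁, rfl⟩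

theorem chainPzz_notMem_boundaries : chainPzz ∉ boundaries ℂ dbarL 2 := by
  rw [chainPzz_eq]
  intro h
  obtain ⟨e, he, hd⟩ := weylData.exists_diff_eq_mulSym
    (fun i => zOp_lie_of_mem_order₁ i POp_mem_order₁) h
  have := resOne_proj₁_diff he
  rw [hd, proj₁_mulSym_unitChain, resOne_apply, op₁_POp] at this
  change res (P * 1) = 0 at this
  rw [mul_one, res_P] at this
  exact one_ne_zero this

theorem mul_P_mem_J₁ (g : J) : g * P ∈ J₁ := J₁.mul_mem_left _ P_mem_J₁

/-- Up to boundaries of invariant chains, every element of `L₁` of order zero is a multiple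
of `P`. -/
theorem mulSym_mem_map {m : L₁} (hm : m ∈ order₁) :
    mulSym ℂ m (unitChain ℂ L₀ L₁) ∈
      (ℂ ∙ mulSym ℂ POp (unitChain ℂ L₀ L₁)) ⊔ (weylData.inv 1).map (diff ℂ dbarL) := by
  set W := (ℂ ∙ mulSym ℂ POp (unitChain ℂ L₀ L₁)) ⊔ (weylData.inv 1).map (diff ℂ dbarL) with hW
  set U : Submodule ℂ L₁ := W.comap ((mulSym ℂ (L₀ := L₀)).flip (unitChain ℂ L₀ L₁)) with hU
  set N : Submodule ℂ J := (U.map op₁).comap (mul.toLinearMap ∘ₗ LinearMap.mulRight ℂ P) with hN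
  have mem_N : ∀ {f : J}, mulSym ℂ (mk₁ (mul (f * P))
      (mul_mem_D₁' (mul_P_mem_J₁ _))) (unitChain ℂ L₀ L₁) ∈ W → f ∈ N :=
    fun h => ⟨mk₁ _ (mul_mem_D₁' (mul_P_mem_J₁ _)), h, rfl⟩
  have hexact : ∀ f ∈ exactCoeff, f ∈ N := by
    intro f hf
    obtain ⟨g, hg, hd⟩ := mem_exactCoeff.1 hf
    refine ⟨dbarL (mk₀ (mul g) (mul_mem_D₀ hg)), Submodule.mem_sup_right
      ⟨wedge ℂ (mk₀ (mul g) (mul_mem_D₀ hg)) (unitChain ℂ L₀ L₁), ?_, ?_⟩, ?_⟩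
    · refine weylData.mem_inv.2 ⟨wedge_mem _ unitChain_mem, fun i => ?_⟩
      have : ⁅zOp i, mk₀ (mul g) (mul_mem_D₀ hg)⁆ = 0 :=
        zOp_lie_of_mem_order₀ i (mem_order₀.2 ⟨g, hg, rfl⟩)
      change ad ℂ (zOp i) _ = 0
      rw [ad_wedge, this, ad_eq_chainDer, chainDer_unitChain, map_zero, map_zero,
        LinearMap.zero_apply, add_zero]
    · rw [diff_wedge_of_degree_zero _ unitChain_mem, ad_eq_chainDer, chainDer_unitChain, zero_add]
      rfl
    · rw [op₁_dbarL, op₀_mk₀, dbarOp_mul, hd]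
      rfl
  have hone : (1 : J) ∈ N := by
    refine ⟨POp, Submodule.mem_sup_left (Submodule.mem_span_singleton_self _), ?_⟩
    rw [op₁_POp]
    exact congrArg mul (one_mul P).symm
  obtain ⟨w, hw, hwm⟩ := mem_order₁.1 hm
  obtain ⟨g, hg, rfl⟩ := mem_J₁_iff.1 hw
  have hgN : g ∈ N := by
    refine mul_mono_mem (fun a b p q => ?_) hg
    -- The form has Euler weight `a + b - p - q - 2`, so off this hyperplane the Euler homotopy
    -- applies. On it, a monomial not already exact has `a ≤ p` and `b ≤ q`, hence is diagonal.
    by_cases hd : a + b = p + q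
    · by_cases hpa : p < a
      · exact hexact _ (mono_mem_exactCoeff_of_lt hpa)
      by_cases hqb : q < b
      · exact hexact _ (mono_mem_exactCoeff_of_lt' hqb)
      obtain rfl : p = a := by omega
      obtain rfl : q = b := by omega
      exact sup_le ((Submodule.span_singleton_le_iff_mem _ _).2 hone) hexact (mono_diag_mem p q)
    · refine mem_N (Submodule.mem_sup_right ?_)
      have hm1 : mk₁ (mul (mono a b p q * P)) (mul_mem_D₁' (mul_P_mem_J₁ _)) =
          monoOp a b p q 0 0 := op₁_injective (by
        rw [monoOp, op₁_mk₁, op₁_mk₁, pow_zero, pow_zero, mul_one, mul_one])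
      have hm2 : ∀ i, ⁅zOp i, monoOp a b p q 0 0⁆ = 0 := fun i => zOp_lie_of_mem_order₁ i
        (hm1 ▸ mem_order₁.2 ⟨_, mono_mul_P_mem a b p q, rfl⟩)
      rw [hm1]
      refine isEuler_eulerOp.exists_diff_eq (n := 1)
        (weylData.mem_inv.2 ⟨mulSym_mem _ unitChain_mem, fun i => ?_⟩) one_ne_zero
        (by rw [weight_mulSym_unitChain, Nat.cast_one, one_smul])
        (μ := (a : ℂ) + b - p - q - 2 - (0 : ℕ) - (0 : ℕ))
        (by rw [WeylData.ad_mulSym_unitChain, eulerOp_lie_monoOp, map_smul, LinearMap.smul_apply]) ?_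
      · rw [WeylData.ad_mulSym_unitChain]
        exact (congrArg (fun m => mulSym ℂ m _) (hm2 i)).trans (by simp)
      · intro h
        refine hd ?_
        rw [← Nat.cast_inj (R := ℂ)]
        push_cast at h ⊢
        linear_combination h
  obtain ⟨m', hm', e⟩ := hgN
  have : m' = m := op₁_injective (e.trans hwm)
  exact this ▸ hm'

/-- After reduction to z¹ ∧ z² ∧ m with m invariant, m has order zero and is a multiple of P plus `d
e` with `e` invariant; the latter contributes the boundary of z¹ ∧ z² ∧ e. -/
theorem cycles_le :
    cycles ℂ dbarL 2 ≤ (ℂ ∙ chainPzz) ⊔ boundaries ℂ dbarL 2 := by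
  intro c hc
  obtain ⟨m, hm, h⟩ := isEuler_eulerOp.exists_wedge_wedge_mulSym hc
  obtain ⟨u, hu, v, ⟨e, he, rfl⟩, huv⟩ := Submodule.mem_sup.1 (mulSym_mem_map (mem_order₁_of_lie hm))
  obtain ⟨r, rfl⟩ := Submodule.mem_span_singleton.1 hu
  rw [← huv] at h
  refine Submodule.mem_sup.2 ⟨r • chainPzz, Submodule.smul_mem _ _
    (Submodule.mem_span_singleton_self _), c - r • chainPzz, ?_, add_sub_cancel _ _⟩
  rw [chainPzz_eq]
  have := add_mem h (weylData.wedge_wedge_diff_mem he)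
  rwa [map_add, map_add, map_smul, map_smul, sub_add_eq_sub_sub, sub_add_cancel] at this

theorem span_classPzz : Submodule.span ℂ {classPzz} = ⊤ := by
  refine eq_top_iff.2 ?_
  rintro ⟨_, c, hc, rfl⟩ -
  obtain ⟨u, hu, v, hv, rfl⟩ := Submodule.mem_sup.1 (cycles_le hc)
  obtain ⟨r, rfl⟩ := Submodule.mem_span_singleton.1 hu
  refine Submodule.mem_span_singleton.2 ⟨r, Subtype.ext ?_⟩
  change r • (boundaries ℂ dbarL 2).mkQ chainPzz = (boundaries ℂ dbarL 2).mkQ (r • chainPzz + v)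
  rw [map_add, map_smul, Submodule.mkQ_apply _ v, (Submodule.Quotient.mk_eq_zero _).2 hv, add_zero]

theorem classPzz_ne_zero : classPzz ≠ 0 := fun h =>
  chainPzz_notMem_boundaries ((Submodule.Quotient.mk_eq_zero _).1 (congrArg Subtype.val h))

end Jouanolou

end

theorem mainTheorem2 :
    Module.finrank ℂ (DGLie.hyperhomology ℂ Jouanolou.dbarL 2) = 1 ∧
      Submodule.span ℂ {Jouanolou.classPzz} = ⊤ := by
  refine ⟨?_, Jouanolou.span_classPzz⟩
  refine finrank_eq_one _ Jouanolou.classPzz_ne_zero fun w => ?_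
  exact Submodule.mem_span_singleton.1 (Jouanolou.span_classPzz ▸ Submodule.mem_top)
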